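/- Let $\mathbb K=\mathbb R$ or $\mathbb C$. "Smooth" means infinitely differentiable (holomorphic if $\mathbb K=\mathbb C$); the statement also holds with "smooth" read as real analytic throughout. Let $\mathcal E_p$ be the ring of germs at $0$ of smooth functions $\mathbb K^p\to\mathbb K$ and $\mathfrak m=\mathfrak m_p$ its maximal ideal of germs vanishing at $0$. For a smooth map germ $h:(\mathbb K^p,0)\to(\mathbb K^q,0)$ let $\theta(h)\cong\mathcal E_p^{\,q}$ be the $\mathcal E_p$-module of germs of vector fields along $h$, let $h^*(\mathfrak m_q)$ be the ideal of $\mathcal E_p$ generated by the germs $\varphi\circ h$ with $\varphi\in\mathfrak m_q$, and for a germ $\xi$ of a vector field on $\mathbb K^p$ at $0$ let $\xi(h)=dh(\xi)\in\theta(h)$. Let $V$ be an arbitrary germ at $0$ of a subset of $\mathbb K^p$. Let $\Theta_V$ be the set of germs at $0$ of smooth vector fields on $\mathbb K^p$ whose local flow $\Phi_t$ (with time $t\in\mathbb K$) preserves $V$, i.e. $\Phi_t(x)\in V\iff x\in V$ for all $(t,x)$ near $(0,0)$. Let $\Theta_{V,1}\subseteq\Theta_V$ be the set of those for which in addition, for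 all small $t$, $\Phi_t$ fixes $0$ and has $1$-jet at $0$ equal to that of the identity. Put $$T_V\mathcal K_1(h)=\{\xi(h)\mid\xi\in\Theta_{V,1}\}+\mathfrak m_p\,h^*(\mathfrak m_q)\,\theta(h),\qquad T_V\mathcal K_e(h)=\{\xi(h)\mid\xi\in\Theta_V\}+h^*(\mathfrak m_q)\,\theta(h).$$ Two smooth map germs $f,g:(\mathbb K^p,0)\to(\mathbb K^q,0)$ are ${}_V\mathcal K$-equivalent if there are germs of diffeomorphisms $\Psi$ of $(\mathbb K^p\times\mathbb K^q,(0,0))$ and $\psi$ of $(\mathbb K^p,0)$ such that the first component of $\Psi(x,y)$ is $\psi(x)$, $\Psi(\mathbb K^p\times\{0\})=\mathbb K^p\times\{0\}$, $\Psi(\operatorname{graph} f)=\operatorname{graph} g$ and $\psi(V)=V$ (equalities of set germs). For an integer $l\ge 0$, $h$ is $l$-${}_V\mathcal K$-determined if every smooth map germ $g:(\mathbb K^p,0)\to(\mathbb K^q,0)$ with the same $l$-jet at $0$ as $h$ is ${}_V\mathcal K$-equivalent to $h$. **Theorem 3.6.** Let $h:(\mathbb K^p,0)\to(\mathbb K^q,0)$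 be a smooth map germ, let $l\ge 0$ be an integer, and suppose that $\Theta_V$ is finitely generated as an $\mathcal E_p$-module. (i) If $\mathfrak m^{l+1}\theta(h)\subseteq T_V\mathcal K_1(h)+\mathfrak m^{l+2}\theta(h)$, then $h$ is $l$-${}_V\mathcal K$-determined. (ii) If every vector field in $\Theta_V$ vanishes at the origin and $\mathfrak m^{l}\theta(h)\subseteq T_V\mathcal K_e(h)+\mathfrak m^{l+1}\theta(h)$, then $h$ is $l$-${}_V\mathcal K$-determined. -/

import Mathlib

open scoped Topology ContDiff Pointwise

noncomputable section

namespace VK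

/-- The two standard categories of germs: infinitely differentiable and analytic.
Over `ℂ` both give the holomorphic germs. -/
inductive Regularity
  | smooth
  | analytic

/-- The order of differentiability in Mathlib's `ContDiff` scale. -/
def Regularity.order : Regularity → WithTop ℕ∞
  | .smooth => ∞
  | .analytic => ω

theorem Regularity.order_add_one (r : Regularity) : r.order + 1 ≤ r.order := by
  cases r <;> exact le_of_eq rfl

section Germs

variable (𝕂 : Type*) [RCLike 𝕂] (r : Regularity)

/-- `f` is smooth on some neighbourhood of the origin. -/
def SmoothNear {E F : Type*} [NormedAddCommGroup E] [NormedSpace 𝕂 E]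
    [NormedAddCommGroup F] [NormedSpace 𝕂 F] (f : E → F) : Prop :=
  ∀ᶠ x in 𝓝 (0 : E), ContDiffAt 𝕂 r.order f x

/-- The ring `ℰ_p` of germs at `0` of smooth functions `𝕂^p → 𝕂`. -/
def SmoothGerm (p : ℕ) : Subring (Filter.Germ (𝓝 (0 : Fin p → 𝕂)) 𝕂) where
  carrier := {f | ∃ F : (Fin p → 𝕂) → 𝕂, SmoothNear 𝕂 r F ∧ f = (F : Filter.Germ _ 𝕂)}
  mul_mem' := by
    rintro _ _ ⟨F, hF, rfl⟩ ⟨G, hG, rfl⟩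
    exact ⟨F * G, by filter_upwards [hF, hG] with x h1 h2 using h1.mul h2, rfl⟩
  one_mem' := ⟨1, Filter.Eventually.of_forall fun _ => contDiffAt_const, rfl⟩
  add_mem' := by
    rintro _ _ ⟨F, hF, rfl⟩ ⟨G, hG, rfl⟩
    exact ⟨F + G, by filter_upwards [hF, hG] with x h1 h2 using h1.add h2, rfl⟩
  zero_mem' := ⟨0, Filter.Eventually.of_forall fun _ => contDiffAt_const, rfl⟩
  neg_mem' := by
    rintro _ ⟨F, hF, rfl⟩
    exact ⟨-F, by filter_upwards [hF] with x h1 using h1.neg, rfl⟩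

/-- The maximal ideal `𝔪_p` of `ℰ_p`: the germs that vanish at the origin. -/
def maxIdeal (p : ℕ) : Ideal (SmoothGerm 𝕂 r p) :=
  RingHom.ker ((Filter.Germ.valueRingHom).comp (SmoothGerm 𝕂 r p).subtype)

/-- `q`-tuples of germs in `ℰ_p`. These are the germs of smooth maps `𝕂^p → 𝕂^q`, the module
`θ(h)` of vector fields along a map germ `h`, and for `q = p` the germs of vector fields on
`𝕂^p`. -/
abbrev Tuple (p q : ℕ) : Type _ := Fin q → SmoothGerm 𝕂 r p

variable {𝕂 r}

/-- The function `F` represents the germ `f`. -/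
def Represents {p q : ℕ} (F : (Fin p → 𝕂) → (Fin q → 𝕂)) (f : Tuple 𝕂 r p q) : Prop :=
  ∀ i, (f i : Filter.Germ (𝓝 (0 : Fin p → 𝕂)) 𝕂) = ((fun x => F x i : (Fin p → 𝕂) → 𝕂) :
    Filter.Germ (𝓝 (0 : Fin p → 𝕂)) 𝕂)

/-- The partial derivative `∂f/∂x_j` of a germ. -/
def pderiv {p : ℕ} (j : Fin p) (f : SmoothGerm 𝕂 r p) : SmoothGerm 𝕂 r p :=
  ⟨Filter.Germ.map' (fun F x => fderiv 𝕂 F x (Pi.single j 1))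
      (fun _ _ h => h.fderiv.fun_comp fun L => L (Pi.single j 1)) f.1, by
    obtain ⟨_, F, hF, rfl⟩ := f
    refine ⟨fun x => fderiv 𝕂 F x (Pi.single j 1), ?_, rfl⟩
    filter_upwards [hF] with x hx
    exact (hx.fderiv_right r.order_add_one).clm_apply contDiffAt_const⟩

/-- `ξ(h) = dh(ξ)`, the derivative of the map germ `h` along the vector field `ξ`. -/
def applyField {p q : ℕ} (ξ : Tuple 𝕂 r p p) (h : Tuple 𝕂 r p q) : Tuple 𝕂 r p q :=
  fun i => ∑ j, ξ j * pderiv j (h i)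

/-- The `l`-jet at the origin, as the family of all derivatives of order at most `l`. -/
def jet {p : ℕ} (l : ℕ) (f : SmoothGerm 𝕂 r p) :
    (k : Fin (l + 1)) → ContinuousMultilinearMap 𝕂 (fun _ : Fin k => Fin p → 𝕂) 𝕂 :=
  fun k => Filter.Germ.liftOn f.1 (fun F => iteratedFDeriv 𝕂 k F 0)
    fun _ _ h => (h.iteratedFDeriv 𝕂 k).eq_of_nhds

/-- `h^*(𝔪_q)`, the ideal of `ℰ_p` generated by the compositions `φ ∘ h` with `φ ∈ 𝔪_q`. -/
def pullbackMax {p q : ℕ} (h : Tuple 𝕂 r p q) : Ideal (SmoothGerm 𝕂 r p) :=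
  Ideal.span {f | ∃ φ ∈ maxIdeal 𝕂 r q, ∃ (Φ : (Fin q → 𝕂) → 𝕂) (H : (Fin p → 𝕂) → (Fin q → 𝕂)),
    φ.1 = (Φ : Filter.Germ (𝓝 (0 : Fin q → 𝕂)) 𝕂) ∧ Represents H h ∧
    f.1 = ((Φ ∘ H : (Fin p → 𝕂) → 𝕂) : Filter.Germ (𝓝 (0 : Fin p → 𝕂)) 𝕂)}

/-- The submodule `I θ(h)` of `θ(h)`. -/
def idealTheta {p : ℕ} (q : ℕ) (I : Ideal (SmoothGerm 𝕂 r p)) :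
    Submodule (SmoothGerm 𝕂 r p) (Tuple 𝕂 r p q) :=
  I • ⊤

/-- `Φ` is the local flow at the origin of the vector field germ `ξ`, with time in `𝕂`. -/
def IsLocalFlow {p : ℕ} (ξ : Tuple 𝕂 r p p) (Φ : 𝕂 → (Fin p → 𝕂) → (Fin p → 𝕂)) : Prop :=
  ∃ X : (Fin p → 𝕂) → (Fin p → 𝕂), Represents X ξ ∧
    ∀ᶠ z : 𝕂 × (Fin p → 𝕂) in 𝓝 0,
      Φ 0 z.2 = z.2 ∧ HasDerivAt (fun s => Φ s z.2) (X (Φ z.1 z.2)) z.1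

/-- The diffeomorphisms `Φ t`, for small `t`, preserve the germ at the origin of the set `V`. -/
def FlowPreserves {p : ℕ} (V : Set (Fin p → 𝕂)) (Φ : 𝕂 → (Fin p → 𝕂) → (Fin p → 𝕂)) : Prop :=
  ∀ᶠ z : 𝕂 × (Fin p → 𝕂) in 𝓝 0, (Φ z.1 z.2 ∈ V ↔ z.2 ∈ V)

variable (r)

/-- `Θ_V`: the vector fields that integrate to diffeomorphisms preserving the set germ `V`. -/
def Theta {p : ℕ} (V : Set (Fin p → 𝕂)) : Set (Tuple 𝕂 r p p) :=
  {ξ | ∃ Φ, IsLocalFlow ξ Φ ∧ FlowPreserves V Φ}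

/-- `Θ_{V,1}`: the vector fields that integrate to diffeomorphisms of `(𝕂^p, 0)` with `1`-jet
the identity that preserve `V`. -/
def ThetaOne {p : ℕ} (V : Set (Fin p → 𝕂)) : Set (Tuple 𝕂 r p p) :=
  {ξ | ∃ Φ, IsLocalFlow ξ Φ ∧ FlowPreserves V Φ ∧
    ∀ᶠ t in 𝓝 (0 : 𝕂), Φ t 0 = 0 ∧ HasFDerivAt (Φ t) (ContinuousLinearMap.id 𝕂 (Fin p → 𝕂)) 0}

variable {r}

/-- `T_V 𝒦_e(h) = {ξ(h) | ξ ∈ Θ_V} + h^*(𝔪_q) θ(h)`. -/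
def tangentExt {p q : ℕ} (V : Set (Fin p → 𝕂)) (h : Tuple 𝕂 r p q) : Set (Tuple 𝕂 r p q) :=
  (fun ξ => applyField ξ h) '' Theta r V + (idealTheta q (pullbackMax h) : Set (Tuple 𝕂 r p q))

/-- `T_V 𝒦_1(h) = {ξ(h) | ξ ∈ Θ_{V,1}} + 𝔪_p h^*(𝔪_q) θ(h)`. -/
def tangentOne {p q : ℕ} (V : Set (Fin p → 𝕂)) (h : Tuple 𝕂 r p q) : Set (Tuple 𝕂 r p q) :=
  (fun ξ => applyField ξ h) '' ThetaOne r V +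
    (idealTheta q (maxIdeal 𝕂 r p * pullbackMax h) : Set (Tuple 𝕂 r p q))

variable (𝕂 r)

/-- `ψ` is a germ of a diffeomorphism `(E, 0) → (E, 0)`. -/
def IsDiffeoGerm {E : Type*} [NormedAddCommGroup E] [NormedSpace 𝕂 E] (ψ : E → E) : Prop :=
  ψ 0 = 0 ∧ SmoothNear 𝕂 r ψ ∧
    ∃ χ : E → E, χ 0 = 0 ∧ SmoothNear 𝕂 r χ ∧
      (∀ᶠ x in 𝓝 0, χ (ψ x) = x) ∧ (∀ᶠ x in 𝓝 0, ψ (χ x) = x)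

/-- `ψ (A) = B` as set germs at the origin, for a diffeomorphism germ `ψ` fixing the origin. -/
def MapsGermOnto {E : Type*} [NormedAddCommGroup E] (ψ : E → E) (A B : Set E) : Prop :=
  ∀ᶠ x in 𝓝 0, (x ∈ A ↔ ψ x ∈ B)

variable {𝕂 r}

/-- `_V𝒦`-equivalence of map germs `(𝕂^p, 0) → (𝕂^q, 0)`: a diffeomorphism germ `Ψ` of
`𝕂^p × 𝕂^q`, fibred over a diffeomorphism germ `ψ` of `𝕂^p`, that preserves `𝕂^p × 0` and maps
graph to graph, such that `ψ` preserves `V`. -/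
def Equivalent {p q : ℕ} (V : Set (Fin p → 𝕂)) (f g : Tuple 𝕂 r p q) : Prop :=
  ∃ F G : (Fin p → 𝕂) → (Fin q → 𝕂), Represents F f ∧ Represents G g ∧
    ∃ (Ψ : (Fin p → 𝕂) × (Fin q → 𝕂) → (Fin p → 𝕂) × (Fin q → 𝕂))
      (ψ : (Fin p → 𝕂) → (Fin p → 𝕂)),
      IsDiffeoGerm 𝕂 r Ψ ∧ IsDiffeoGerm 𝕂 r ψ ∧
      (∀ᶠ z in 𝓝 0, (Ψ z).1 = ψ z.1) ∧
      MapsGermOnto Ψ {z | z.2 = 0} {z | z.2 = 0} ∧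
      MapsGermOnto Ψ {z | z.2 = F z.1} {z | z.2 = G z.1} ∧
      MapsGermOnto ψ V V

/-- `h` is `l`-`_V𝒦`-determined: every map germ `(𝕂^p, 0) → (𝕂^q, 0)` with the same `l`-jet as
`h` is `_V𝒦`-equivalent to `h`. -/
def Determined {p q : ℕ} (V : Set (Fin p → 𝕂)) (l : ℕ) (h : Tuple 𝕂 r p q) : Prop :=
  ∀ g : Tuple 𝕂 r p q, (∀ i, g i ∈ maxIdeal 𝕂 r p) → (∀ i, jet l (g i) = jet l (h i)) →
    Equivalent V h g

end Germs

end VK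

end

/-!
Every `g` with the `l`-jet of `h` is joined to `h` by the line `H t = h + t • (g - h)`. The
tangency condition writes each generator of `𝔪 ^ (l + 1) θ(h)` (respectively `𝔪 ^ l θ(h)`) as an
infinitesimal contact deformation of `h` up to higher order; inverting a matrix that is the
identity at the origin, as in Nakayama's lemma, expresses `g - h`, smoothly in `t`, by
infinitesimal contact deformations of `H t`. These involve only finitely many fields of `Θ_V` that
vanish at the origin, so their flows exist up to time one near the origin and trivialize the line.

For an arbitrary set `V`, the flow of a smooth combination of fields preserving `V` again
preserves `V`: in a plaque of maximal dimension through a point of an orbit the fields are tangent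
to the plaque, and the integral curves of the combination stay in it. Flows that are smooth or
analytic in all variables come from the implicit function theorem on the space of continuous
paths, where superposition with a smooth or analytic map is again smooth or analytic.
-/

open Filter Set

noncomputable section

namespace VK

/-! ### Smooth and analytic maps -/

namespace Regularity

theorem order_ne_zero (r : Regularity) : r.order ≠ 0 := by
  cases r <;> simp [order]

theorem coe_le_order (r : Regularity) (n : ℕ) : (n : WithTop ℕ∞) ≤ r.order := by
  cases r
  exacts [WithTop.coe_le_coe.2 le_top, le_top]

theorem one_le_order (r : Regularity) : 1 ≤ r.order := by
  simpa using r.coe_le_order 1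

theorem infty_le_order (r : Regularity) : ∞ ≤ r.order := by
  cases r
  exacts [le_rfl, le_top]

end Regularity

section SmoothAt

variable {𝕂 : Type*} [RCLike 𝕂] {r : Regularity}
  {E F G : Type*} [NormedAddCommGroup E] [NormedSpace 𝕂 E] [NormedAddCommGroup F]
  [NormedSpace 𝕂 F] [NormedAddCommGroup G] [NormedSpace 𝕂 G]

variable (𝕂 r) in
/-- `f` is smooth on some neighbourhood of `x`. At the origin this is `SmoothNear`. In the `C^∞`
case it is stronger than `ContDiffAt 𝕂 ∞ f x`, where the neighbourhood may shrink with the order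
of differentiability. -/
def SmoothAt (f : E → F) (x : E) : Prop :=
  ∀ᶠ y in 𝓝 x, ContDiffAt 𝕂 r.order f y

namespace SmoothAt

variable {f g : E → F} {x : E}

theorem of_contDiff (hf : ContDiff 𝕂 r.order f) : SmoothAt 𝕂 r f x :=
  .of_forall fun _ => hf.contDiffAt

theorem const {c : F} : SmoothAt 𝕂 r (fun _ => c) x :=
  of_contDiff contDiff_const

theorem id : SmoothAt 𝕂 r (fun y : E => y) x :=
  of_contDiff contDiff_id

theorem fst {z : E × F} : SmoothAt 𝕂 r Prod.fst z :=
  of_contDiff contDiff_fst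

theorem snd {z : E × F} : SmoothAt 𝕂 r Prod.snd z :=
  of_contDiff contDiff_snd

theorem contDiffAt (hf : SmoothAt 𝕂 r f x) : ContDiffAt 𝕂 r.order f x :=
  hf.self_of_nhds

theorem continuousAt (hf : SmoothAt 𝕂 r f x) : ContinuousAt f x :=
  hf.contDiffAt.continuousAt

theorem tendsto (hf : SmoothAt 𝕂 r f x) {y : F} (h : f x = y) : Tendsto f (𝓝 x) (𝓝 y) :=
  h ▸ hf.continuousAt

theorem differentiableAt (hf : SmoothAt 𝕂 r f x) : DifferentiableAt 𝕂 f x :=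
  hf.contDiffAt.differentiableAt r.order_ne_zero

theorem hasFDerivAt (hf : SmoothAt 𝕂 r f x) : HasFDerivAt f (fderiv 𝕂 f x) x :=
  hf.differentiableAt.hasFDerivAt

theorem eventually (hf : SmoothAt 𝕂 r f x) : ∀ᶠ y in 𝓝 x, SmoothAt 𝕂 r f y :=
  hf.eventually_nhds

theorem congr (hf : SmoothAt 𝕂 r f x) (h : g =ᶠ[𝓝 x] f) : SmoothAt 𝕂 r g x := by
  filter_upwards [hf, h.eventually_nhds] with y hy hfg using hy.congr_of_eventuallyEq hfg

theorem comp {g : F → G} (x : E) (hg : SmoothAt 𝕂 r g (f x)) (hf : SmoothAt 𝕂 r f x) :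
    SmoothAt 𝕂 r (fun y => g (f y)) x := by
  filter_upwards [hf, hf.continuousAt.eventually hg] with y hfy hgy using hgy.comp y hfy

theorem prodMk {g : E → G} (hf : SmoothAt 𝕂 r f x) (hg : SmoothAt 𝕂 r g x) :
    SmoothAt 𝕂 r (fun y => (f y, g y)) x := by
  filter_upwards [hf, hg] with y hfy hgy using hfy.prodMk hgy

theorem add (hf : SmoothAt 𝕂 r f x) (hg : SmoothAt 𝕂 r g x) :
    SmoothAt 𝕂 r (fun y => f y + g y) x := by
  filter_upwards [hf, hg] with y hfy hgy using hfy.add hgy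

theorem sub (hf : SmoothAt 𝕂 r f x) (hg : SmoothAt 𝕂 r g x) :
    SmoothAt 𝕂 r (fun y => f y - g y) x := by
  filter_upwards [hf, hg] with y hfy hgy using hfy.sub hgy

theorem smul {c : E → 𝕂} (hc : SmoothAt 𝕂 r c x) (hf : SmoothAt 𝕂 r f x) :
    SmoothAt 𝕂 r (fun y => c y • f y) x := by
  filter_upwards [hc, hf] with y hcy hfy using hcy.smul hfy

theorem sum {ι : Type*} {s : Finset ι} {f : ι → E → F} (hf : ∀ i, SmoothAt 𝕂 r (f i) x) :
    SmoothAt 𝕂 r (fun y => ∑ i ∈ s, f i y) x := by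
  filter_upwards [(s.eventually_all).2 fun i _ => hf i] with y hy using ContDiffAt.sum hy

theorem pi {ι : Type*} [Fintype ι] {f : E → ι → F} (hf : ∀ i, SmoothAt 𝕂 r (fun y => f y i) x) :
    SmoothAt 𝕂 r f x := by
  filter_upwards [eventually_all.2 hf] with y hy using contDiffAt_pi.2 hy

theorem clm_apply {A : E → F →L[𝕂] G} {f : E → F} (hA : SmoothAt 𝕂 r A x)
    (hf : SmoothAt 𝕂 r f x) : SmoothAt 𝕂 r (fun y => A y (f y)) x := by
  filter_upwards [hA, hf] with y hAy hfy using hAy.clm_apply hfy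

theorem clm_comp {H : Type*} [NormedAddCommGroup H] [NormedSpace 𝕂 H] {B : E → G →L[𝕂] H}
    {A : E → F →L[𝕂] G} (hB : SmoothAt 𝕂 r B x) (hA : SmoothAt 𝕂 r A x) :
    SmoothAt 𝕂 r (fun y => (B y).comp (A y)) x := by
  filter_upwards [hB, hA] with y hBy hAy using hBy.clm_comp hAy

theorem fderiv (hf : SmoothAt 𝕂 r f x) : SmoothAt 𝕂 r (fderiv 𝕂 f) x := by
  filter_upwards [hf] with y hy using hy.fderiv_right r.order_add_one

theorem restrictScalars [NormedSpace ℝ E] [IsScalarTower ℝ 𝕂 E] [NormedSpace ℝ F]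
    [IsScalarTower ℝ 𝕂 F] (hf : SmoothAt 𝕂 r f x) : SmoothAt ℝ .smooth f x := by
  filter_upwards [hf] with y hy using (hy.restrict_scalars ℝ).of_le r.infty_le_order

end SmoothAt

theorem eventually_isInvertible [CompleteSpace E] {X : Type*} [TopologicalSpace X]
    {A : X → E →L[𝕂] F} {x : X} (hA : ContinuousAt A x) (h : (A x).IsInvertible) :
    ∀ᶠ y in 𝓝 x, (A y).IsInvertible := by
  obtain ⟨e, he⟩ := h
  exact hA.eventually_mem (he ▸ e.nhds)

theorem SmoothAt.clm_inverse [CompleteSpace F] {A : E → F →L[𝕂] G} {x : E}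
    (hA : SmoothAt 𝕂 r A x) (h : (A x).IsInvertible) : SmoothAt 𝕂 r (fun y => (A y).inverse) x := by
  filter_upwards [hA, eventually_isInvertible hA.continuousAt h] with y hAy hy
  exact hy.contDiffAt_map_inverse.comp y hAy

end SmoothAt

section LocalDiffeo

variable {𝕂 : Type*} [RCLike 𝕂] {r : Regularity}
  {E F G : Type*} [NormedAddCommGroup E] [NormedSpace 𝕂 E] [NormedAddCommGroup F]
  [NormedSpace 𝕂 F] [NormedAddCommGroup G] [NormedSpace 𝕂 G]

variable (𝕂 r) in
/-- `f` is smooth near `x` with invertible derivative at `x`; by the inverse function theorem it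
is a local diffeomorphism at `x`. -/
structure IsLocalDiffeoAt (f : E → F) (x : E) : Prop where
  smoothAt : SmoothAt 𝕂 r f x
  isInvertible : (fderiv 𝕂 f x).IsInvertible

namespace IsLocalDiffeoAt

variable {f : E → F} {x : E}

theorem id : IsLocalDiffeoAt 𝕂 r (fun y : E => y) x :=
  ⟨.id, ⟨.refl 𝕂 E, fderiv_fun_id.symm⟩⟩

theorem comp {g : F → G} (hg : IsLocalDiffeoAt 𝕂 r g (f x)) (hf : IsLocalDiffeoAt 𝕂 r f x) :
    IsLocalDiffeoAt 𝕂 r (fun y => g (f y)) x := by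
  refine ⟨hg.smoothAt.comp x hf.smoothAt, ?_⟩
  rw [fderiv_fun_comp x hg.smoothAt.differentiableAt hf.smoothAt.differentiableAt]
  exact hg.isInvertible.comp hf.isInvertible

variable [CompleteSpace E]

theorem eventually (hf : IsLocalDiffeoAt 𝕂 r f x) : ∀ᶠ y in 𝓝 x, IsLocalDiffeoAt 𝕂 r f y := by
  filter_upwards [hf.smoothAt.eventually,
    eventually_isInvertible hf.smoothAt.fderiv.continuousAt hf.isInvertible] with y hs hi
  exact ⟨hs, hi⟩

theorem exists_inverse (hf : IsLocalDiffeoAt 𝕂 r f x) :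
    ∃ g : F → E, g (f x) = x ∧ IsLocalDiffeoAt 𝕂 r g (f x) ∧
      (∀ᶠ y in 𝓝 x, g (f y) = y) ∧ ∀ᶠ z in 𝓝 (f x), f (g z) = z := by
  obtain ⟨A, hA⟩ := hf.isInvertible
  have hfx := hf.smoothAt.contDiffAt
  have hderiv : HasFDerivAt f (A : E →L[𝕂] F) x := hA ▸ hf.smoothAt.hasFDerivAt
  set e := hfx.toOpenPartialHomeomorph f hderiv r.order_ne_zero
  have hx : x ∈ e.source := hfx.mem_toOpenPartialHomeomorph_source hderiv r.order_ne_zero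
  have hfx' : f x ∈ e.target := e.map_source hx
  have hinv : e.symm (f x) = x := e.left_inv hx
  have hright : ∀ᶠ z in 𝓝 (f x), f (e.symm z) = z := by
    filter_upwards [e.open_target.mem_nhds hfx'] with z hz using e.right_inv hz
  have hcont : Tendsto e.symm (𝓝 (f x)) (𝓝 x) := by
    simpa only [ContinuousAt, hinv] using e.continuousAt_symm hfx'
  refine ⟨e.symm, hinv, ⟨?_, ?_⟩, ?_, hright⟩
  · filter_upwards [e.open_target.mem_nhds hfx', hcont.eventually hf.eventually] with z hz hfz
    obtain ⟨B, hB⟩ := hfz.isInvertible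
    exact e.contDiffAt_symm hz (f₀' := B) (hB ▸ hfz.smoothAt.hasFDerivAt) hfz.smoothAt.contDiffAt
  · exact ⟨A.symm, (HasFDerivAt.of_local_left_inverse (e.continuousAt_symm hfx')
      (by rwa [hinv]) hright).fderiv.symm⟩
  · filter_upwards [e.open_source.mem_nhds hx] with y hy using e.left_inv hy

end IsLocalDiffeoAt

variable {Φ : G × E → E} {p₀ : G} {x₀ : E}

theorem fderiv_comp_inr_eq_id (hΦ : SmoothAt 𝕂 r Φ (p₀, x₀)) (h : ∀ᶠ x in 𝓝 x₀, Φ (p₀, x) = x) :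
    fderiv 𝕂 Φ (p₀, x₀) ∘L .inr 𝕂 G E = .id 𝕂 E :=
  (hΦ.hasFDerivAt.comp x₀ (hasFDerivAt_prodMk_right p₀ x₀)).unique
    ((hasFDerivAt_id x₀).congr_of_eventuallyEq h)

theorem eventually_isLocalDiffeoAt_slice [CompleteSpace E] (hΦ : SmoothAt 𝕂 r Φ (p₀, x₀))
    (h : ∀ᶠ x in 𝓝 x₀, Φ (p₀, x) = x) :
    ∀ᶠ z in 𝓝 (p₀, x₀), IsLocalDiffeoAt 𝕂 r (fun x => Φ (z.1, x)) z.2 := by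
  have hinv := eventually_isInvertible
    (hΦ.fderiv.clm_comp (.const (c := .inr 𝕂 G E))).continuousAt
    (fderiv_comp_inr_eq_id hΦ h ▸ ⟨.refl 𝕂 E, rfl⟩)
  filter_upwards [hΦ.eventually, hinv] with z hs hi
  refine ⟨SmoothAt.comp (f := fun x => (z.1, x)) z.2 hs (.prodMk .const .id), ?_⟩
  exact (HasFDerivAt.comp (f := fun x => (z.1, x)) z.2 hs.hasFDerivAt
    (hasFDerivAt_prodMk_right z.1 z.2)).fderiv ▸ hi

end LocalDiffeo

/-! ### The superposition operator on path spaces -/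

section Superposition

universe u

variable {I : Type*} [TopologicalSpace I]

open Classical in
/-- The superposition (Nemytskii) operator `α ↦ f ∘ α` on continuous paths. Its value is the junk
value `0` when `f ∘ α` is not continuous, so that a function defined near `α` can be superposed
without restricting its domain. -/
def superposition {E F : Type*} [TopologicalSpace E] [TopologicalSpace F] [Zero F]
    (f : E → F) (α : C(I, E)) : C(I, F) :=
  if h : Continuous (f ∘ α) then ⟨f ∘ α, h⟩ else 0

theorem superposition_apply {E F : Type*} [TopologicalSpace E] [TopologicalSpace F] [Zero F]
    {f : E → F} {α : C(I, E)} (h : ∀ s, ContinuousAt f (α s)) (s : I) :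
    superposition f α s = f (α s) := by
  have hcont : Continuous (f ∘ α) :=
    continuous_iff_continuousAt.2 fun s => (h s).comp α.continuous.continuousAt
  simp [superposition, hcont]

theorem update_path_apply {ι E : Type*} [DecidableEq ι] [TopologicalSpace E] (m : ι → C(I, E))
    (i : ι) (c : C(I, E)) (s : I) :
    (fun j => Function.update m i c j s) = Function.update (fun j => m j s) i (c s) := by
  ext j
  rcases eq_or_ne j i with rfl | h <;> simp [*]

variable [CompactSpace I]

theorem isOpen_paths {E : Type*} [TopologicalSpace E] {U : Set E} (hU : IsOpen U) :
    IsOpen {α : C(I, E) | ∀ s, α s ∈ U} := by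
  simpa [MapsTo] using ContinuousMap.isOpen_setOfPred_mapsTo (isCompact_univ (X := I)) hU

theorem continuousAt_superposition {E F : Type*} [PseudoMetricSpace E] [NormedAddCommGroup F]
    {f : E → F} {U : Set E} (hU : IsOpen U) (hf : ∀ x ∈ U, ContinuousAt f x) {α : C(I, E)}
    (hα : ∀ s, α s ∈ U) : ContinuousAt (superposition (I := I) f) α := by
  rw [Metric.continuousAt_iff']
  intro ε hε
  have huniform := (isCompact_range α.continuous).uniformContinuousAt_of_continuousAt f
    (by rintro _ ⟨s, rfl⟩; exact hf _ (hα s)) (Metric.dist_mem_uniformity (half_pos hε))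
  obtain ⟨δ, hδ, hclose⟩ := Metric.mem_uniformity_dist.1 huniform
  filter_upwards [Metric.ball_mem_nhds α hδ, (isOpen_paths hU).mem_nhds hα] with β hβ hβU
  refine ((ContinuousMap.dist_le (half_pos hε).le).2 fun s => ?_).trans_lt (half_lt_self hε)
  rw [superposition_apply fun s => hf _ (hβU s), superposition_apply fun s => hf _ (hα s),
    dist_comm]
  refine (hclose (a := α s) (b := β s) ?_ ⟨s, rfl⟩).le
  rw [dist_comm]
  exact (ContinuousMap.dist_apply_le_dist s).trans_lt hβ

section Derivative

variable (𝕂 : Type*) [RCLike 𝕂] {E F : Type*} [NormedAddCommGroup E] [NormedSpace 𝕂 E]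
  [NormedAddCommGroup F] [NormedSpace 𝕂 F]

variable (I E F) in
/-- Pointwise application of a path of operators to a path of vectors. -/
def pathApply : C(I, E →L[𝕂] F) →L[𝕂] C(I, E) →L[𝕂] C(I, F) :=
  LinearMap.mkContinuous₂
    (LinearMap.mk₂ 𝕂 (fun (A : C(I, E →L[𝕂] F)) (β : C(I, E)) =>
        (⟨fun s => A s (β s), A.continuous.clm_apply β.continuous⟩ : C(I, F)))
      (by intros; ext; simp) (by intros; ext; simp) (by intros; ext; simp) (by intros; ext; simp))
    1 (by
      intro A β
      rw [ContinuousMap.norm_le _ (by positivity)]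
      intro s
      rw [one_mul]
      exact (ContinuousLinearMap.le_opNorm _ _).trans
        (by gcongr; exacts [A.norm_coe_le_norm s, β.norm_coe_le_norm s]))

theorem pathApply_apply (A : C(I, E →L[𝕂] F)) (β : C(I, E)) (s : I) :
    pathApply I 𝕂 E F A β s = A s (β s) := rfl

variable {𝕂}

/-- A point near `α s` lies on the translate of `α` by a small constant path: this turns the
continuity of superposition at `α` into equicontinuity along `α`. -/
theorem eventually_forall_ball_norm_sub_le {E F : Type*} [NormedAddCommGroup E]
    [NormedAddCommGroup F] {f : E → F} {U : Set E} (hU : IsOpen U)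
    (hf : ∀ x ∈ U, ContinuousAt f x) {α : C(I, E)} (hα : ∀ s, α s ∈ U) {c : ℝ} (hc : 0 < c) :
    ∃ δ > 0, ∀ s, ∀ y ∈ Metric.ball (α s) δ, y ∈ U ∧ ‖f y - f (α s)‖ ≤ c := by
  obtain ⟨δ, hδ, hball⟩ := Metric.eventually_nhds_iff_ball.1
    ((Metric.continuousAt_iff'.1 (continuousAt_superposition hU hf hα) c hc).and
      ((isOpen_paths hU).mem_nhds hα))
  refine ⟨δ, hδ, fun s y hy => ?_⟩
  have htranslate : α + ContinuousMap.const I (y - α s) ∈ Metric.ball α δ := by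
    rw [mem_ball_iff_norm, add_sub_cancel_left]
    refine lt_of_le_of_lt ?_ (mem_ball_iff_norm.1 hy)
    exact (ContinuousMap.norm_le _ (norm_nonneg _)).2 fun t => le_rfl
  have hy_eq : (α + ContinuousMap.const I (y - α s)) s = y := add_sub_cancel _ _
  obtain ⟨hdist, hmem⟩ := hball _ htranslate
  have hs := (ContinuousMap.dist_apply_le_dist s).trans hdist.le
  rw [superposition_apply fun s => hf _ (hmem s), superposition_apply fun s => hf _ (hα s),
    hy_eq, dist_eq_norm] at hs
  exact ⟨hy_eq ▸ hmem s, hs⟩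

theorem hasFDerivAt_superposition {f : E → F} {f' : E → E →L[𝕂] F} {U : Set E} (hU : IsOpen U)
    (hf : ∀ x ∈ U, HasFDerivAt f (f' x) x) (hf' : ∀ x ∈ U, ContinuousAt f' x)
    {α : C(I, E)} (hα : ∀ s, α s ∈ U) :
    HasFDerivAt (superposition (I := I) f) (pathApply I 𝕂 E F (superposition f' α)) α := by
  let _ : NormedSpace ℝ E := NormedSpace.restrictScalars ℝ 𝕂 E
  refine HasFDerivAt.of_isLittleO (Asymptotics.isLittleO_iff.2 fun c hc => ?_)
  obtain ⟨δ, hδ, hball⟩ := eventually_forall_ball_norm_sub_le hU hf' hα hc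
  filter_upwards [Metric.ball_mem_nhds α hδ, (isOpen_paths hU).mem_nhds hα] with β hβ hβU
  refine (ContinuousMap.norm_le _ (by positivity)).2 fun s => ?_
  have hmean := (convex_ball (α s) δ).norm_image_sub_le_of_norm_hasFDerivWithin_le'
    (fun x hx => (hf x (hball s x hx).1).hasFDerivWithinAt) (fun x hx => (hball s x hx).2)
    (Metric.mem_ball_self hδ) ((ContinuousMap.dist_apply_le_dist s).trans_lt hβ)
  have hcont := fun x hx => (hf x hx).continuousAt
  simp only [ContinuousMap.sub_apply, pathApply_apply]
  rw [superposition_apply fun s => hcont _ (hβU s), superposition_apply fun s => hcont _ (hα s),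
    superposition_apply fun s => hf' _ (hα s)]
  refine hmean.trans ?_
  gcongr
  exact (β - α).norm_coe_le_norm s

end Derivative

section Smooth

variable {𝕂 : Type*} [RCLike 𝕂]

-- The two spaces share a universe because the induction replaces `F` by `E →L[𝕂] F`.
theorem contDiffOn_superposition_nat (n : ℕ) {E F : Type u} [NormedAddCommGroup E]
    [NormedSpace 𝕂 E] [NormedAddCommGroup F] [NormedSpace 𝕂 F] {f : E → F} {U : Set E}
    (hU : IsOpen U) (hf : ContDiffOn 𝕂 n f U) :
    ContDiffOn 𝕂 n (superposition (I := I) f) {α | ∀ s, α s ∈ U} := by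
  induction n generalizing F with
  | zero =>
    exact contDiffOn_zero.2 fun α hα => (continuousAt_superposition hU
      (fun x hx => hf.continuousOn.continuousAt (hU.mem_nhds hx)) hα).continuousWithinAt
  | succ n ih =>
    have hfderiv : ContDiffOn 𝕂 n (fderiv 𝕂 f) U := hf.fderiv_of_isOpen hU (by norm_cast)
    rw [Nat.cast_add, Nat.cast_one,
      contDiffOn_succ_iff_hasFDerivWithinAt_of_uniqueDiffOn (isOpen_paths hU).uniqueDiffOn]
    refine ⟨by simp, _, (pathApply I 𝕂 E F).contDiff.comp_contDiffOn (ih hfderiv), fun α hα =>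
      (hasFDerivAt_superposition hU (fun x hx => ?_) (fun x hx => ?_) hα).hasFDerivWithinAt⟩
    · exact ((hf.contDiffAt (hU.mem_nhds hx)).differentiableAt (by simp)).hasFDerivAt
    · exact hfderiv.continuousOn.continuousAt (hU.mem_nhds hx)

theorem contDiffOn_superposition {E F : Type u} [NormedAddCommGroup E]
    [NormedSpace 𝕂 E] [NormedAddCommGroup F] [NormedSpace 𝕂 F] {f : E → F} {U : Set E}
    (hU : IsOpen U) (hf : ContDiffOn 𝕂 ∞ f U) :
    ContDiffOn 𝕂 ∞ (superposition (I := I) f) {α | ∀ s, α s ∈ U} :=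
  contDiffOn_infty.2 fun n => contDiffOn_superposition_nat n hU (contDiffOn_infty.1 hf n)

section Analytic

variable {E F : Type*} [NormedAddCommGroup E] [NormedSpace 𝕂 E] [NormedAddCommGroup F]
  [NormedSpace 𝕂 F]

variable (I) in
/-- The multilinear map on paths given by the pointwise application of a multilinear map. -/
def pathMultilinear {n : ℕ} (A : E [×n]→L[𝕂] F) : C(I, E) [×n]→L[𝕂] C(I, F) :=
  MultilinearMap.mkContinuous
    { toFun := fun m => ⟨fun s => A fun i => m i s, A.cont.comp (by fun_prop)⟩
      map_update_add' := by intros; ext; simp [update_path_apply]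
      map_update_smul' := by intros; ext; simp [update_path_apply] }
    ‖A‖ (by
      intro m
      rw [ContinuousMap.norm_le _ (by positivity)]
      exact fun s => (A.le_opNorm _).trans (mul_le_mul_of_nonneg_left
        (Finset.prod_le_prod (fun _ _ => norm_nonneg _) fun i _ => (m i).norm_coe_le_norm s)
        (norm_nonneg _)))

theorem norm_pathMultilinear_le {n : ℕ} (A : E [×n]→L[𝕂] F) : ‖pathMultilinear I A‖ ≤ ‖A‖ :=
  MultilinearMap.mkContinuous_norm_le _ (norm_nonneg _) _

theorem summable_pathMultilinear [CompleteSpace F] {p : FormalMultilinearSeries 𝕂 E F}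
    {ρ : NNReal} (hρ : ρ < p.radius) {α : C(I, E)} (hα : ‖α‖ ≤ ρ) :
    Summable fun n => pathMultilinear I (p n) fun _ => α := by
  refine .of_norm ((p.summable_norm_mul_pow hρ).of_nonneg_of_le (fun n => norm_nonneg _)
    fun n => (ContinuousMultilinearMap.le_opNorm _ _).trans ?_)
  rw [Finset.prod_const, Finset.card_univ, Fintype.card_fin]
  gcongr
  exact norm_pathMultilinear_le _

theorem analyticAt_superposition [CompleteSpace F] {f : E → F} {x : E}
    (hf : AnalyticAt 𝕂 f x) :
    AnalyticAt 𝕂 (superposition (I := I) f) (ContinuousMap.const I x) := by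
  obtain ⟨p, R, hp⟩ := hf
  obtain ⟨ρ, hρ, hρR⟩ := ENNReal.lt_iff_exists_nnreal_btwn.1 hp.r_pos
  have hρp : (ρ : ENNReal) < p.radius := hρR.trans_le hp.r_le
  refine ⟨fun n => pathMultilinear I (p n), ρ, ?_, hρ, fun {α} hα => ?_⟩
  · refine FormalMultilinearSeries.le_radius_of_summable_norm _
      ((p.summable_norm_mul_pow hρp).of_nonneg_of_le (fun n => by positivity) fun n => ?_)
    gcongr
    exact norm_pathMultilinear_le _
  · have hαρ : ‖α‖ < ρ := by simpa using hα
    have hαR (s : I) : α s ∈ Metric.eball (0 : E) R := by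
      refine lt_of_le_of_lt ?_ hρR
      rw [edist_zero_right]
      exact_mod_cast (α.norm_coe_le_norm s).trans hαρ.le
    have hsum := (summable_pathMultilinear hρp hαρ.le).hasSum
    suffices superposition f (ContinuousMap.const I x + α) =
        ∑' n, pathMultilinear I (p n) fun _ => α from this ▸ hsum
    ext s
    have hcont (s : I) : ContinuousAt f ((ContinuousMap.const I x + α) s) :=
      hp.continuousOn.continuousAt (Metric.isOpen_eball.mem_nhds
        (by simpa [edist_eq_enorm_sub] using hαR s))
    rw [superposition_apply hcont]
    exact (hp.hasSum (hαR s)).unique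
      (hsum.map (ContinuousMap.evalCLM 𝕂 s) (ContinuousMap.evalCLM 𝕂 s).continuous)

end Analytic

theorem SmoothAt.superposition {r : Regularity} {E F : Type u} [NormedAddCommGroup E]
    [NormedSpace 𝕂 E] [NormedAddCommGroup F] [NormedSpace 𝕂 F] [CompleteSpace F] {f : E → F}
    {x : E} (hf : SmoothAt 𝕂 r f x) :
    SmoothAt 𝕂 r (superposition (I := I) f) (ContinuousMap.const I x) := by
  cases r with
  | smooth =>
    obtain ⟨U, hU, hUo, hxU⟩ := eventually_nhds_iff.1 hf
    have hsmooth := contDiffOn_superposition (I := I) (𝕂 := 𝕂) hUo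
      fun y hy => (hU y hy).contDiffWithinAt
    have hconst : ContinuousMap.const I x ∈ {α : C(I, E) | ∀ s, α s ∈ U} := fun _ => hxU
    filter_upwards [(isOpen_paths hUo).mem_nhds hconst] with α hα
    exact hsmooth.contDiffAt ((isOpen_paths hUo).mem_nhds hα)
  | analytic =>
    exact (analyticAt_superposition hf.contDiffAt.analyticAt).eventually_analyticAt.mono
      fun α h => h.contDiffAt

end Smooth

end Superposition

/-! ### Paths in the unit interval and Hadamard's lemma -/

section Uniqueness

variable {E : Type*} [NormedAddCommGroup E] [NormedSpace ℝ E]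

theorem eventuallyEq_of_hasDerivAt {v : E → E} {γ γ' : ℝ → E} {t₀ : ℝ}
    (hv : ContDiffAt ℝ 1 v (γ t₀)) (hγ : ∀ᶠ t in 𝓝 t₀, HasDerivAt γ (v (γ t)) t)
    (hγ' : ∀ᶠ t in 𝓝 t₀, HasDerivAt γ' (v (γ' t)) t) (h : γ t₀ = γ' t₀) : γ =ᶠ[𝓝 t₀] γ' := by
  obtain ⟨K, s, hs, hK⟩ := hv.exists_lipschitzOnWith
  exact ODE_solution_unique_of_eventually (v := fun _ => v) (s := fun _ => s)
    (.of_forall fun _ => hK) (hγ.and (hγ.self_of_nhds.continuousAt.eventually_mem hs))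
    (hγ'.and (hγ'.self_of_nhds.continuousAt.eventually_mem (h ▸ hs))) h

theorem eqOn_of_hasDerivAt {v : E → E} {s : Set ℝ} (hs : IsOpen s) (hs' : IsPreconnected s)
    {γ γ' : ℝ → E} (hv : ∀ t ∈ s, ContDiffAt ℝ 1 v (γ t))
    (hγ : ∀ t ∈ s, HasDerivAt γ (v (γ t)) t) (hγ' : ∀ t ∈ s, HasDerivAt γ' (v (γ' t)) t)
    {t₀ : ℝ} (ht₀ : t₀ ∈ s) (h : γ t₀ = γ' t₀) : EqOn γ γ' s := by
  have hlocal {t : ℝ} (ht : t ∈ s) (heq : γ t = γ' t) : γ =ᶠ[𝓝 t] γ' :=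
    eventuallyEq_of_hasDerivAt (hv t ht) (eventually_of_mem (hs.mem_nhds ht) hγ)
      (eventually_of_mem (hs.mem_nhds ht) hγ') heq
  have hopen : IsOpen {t | γ =ᶠ[𝓝 t] γ'} :=
    isOpen_iff_mem_nhds.2 fun t ht => eventually_eventually_nhds.2 ht
  have hsub : s ⊆ {t | γ =ᶠ[𝓝 t] γ'} := by
    refine hs'.subset_of_closure_inter_subset hopen ⟨t₀, ht₀, hlocal ht₀ h⟩ ?_
    rintro t ⟨hcl, ht⟩
    refine hlocal ht (by_contra fun hne => ?_)
    have hnear : ∀ᶠ u in 𝓝 t, γ u ≠ γ' u :=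
      ((hγ t ht).continuousAt.prodMk (hγ' t ht).continuousAt).eventually
        (isClosed_diagonal.isOpen_compl.eventually_mem (x := (γ t, γ' t)) hne)
    obtain ⟨u, hu, hu'⟩ := mem_closure_iff_nhds.1 hcl _ hnear
    exact hu hu'.self_of_nhds
  exact fun t ht => (hsub ht).self_of_nhds

end Uniqueness

section PathSpace

variable (𝕂 : Type*) [RCLike 𝕂] (E : Type*) [NormedAddCommGroup E] [NormedSpace 𝕂 E]
  [NormedSpace ℝ E] [IsScalarTower ℝ 𝕂 E]

/-- The antiderivative of a path on the unit interval, as an operator on paths. -/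
def pathIntegral : C(unitInterval, E) →L[𝕂] C(unitInterval, E) :=
  have hint (α : C(unitInterval, E)) (a b : ℝ) :
      IntervalIntegrable (IccExtend zero_le_one α) MeasureTheory.volume a b :=
    (α.continuous.Icc_extend').intervalIntegrable _ _
  LinearMap.mkContinuous
    { toFun := fun α => ⟨fun s => ∫ u in (0 : ℝ)..s, IccExtend zero_le_one α u,
        (intervalIntegral.continuous_primitive (hint α) 0).comp continuous_subtype_val⟩
      map_add' := fun α β => by
        ext s
        simpa [IccExtend] using intervalIntegral.integral_add (hint α 0 s) (hint β 0 s)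
      map_smul' := fun c α => by
        ext s
        exact intervalIntegral.integral_smul c _ }
    1 (fun α => by
      rw [ContinuousMap.norm_le _ (by positivity)]
      intro s
      refine (intervalIntegral.norm_integral_le_of_norm_le_const
        (C := ‖α‖) fun u _ => α.norm_coe_le_norm _).trans ?_
      rw [one_mul, sub_zero, abs_of_nonneg s.2.1]
      exact mul_le_of_le_one_right (norm_nonneg _) s.2.2)

variable {E} in
/-- The linear path `s ↦ s • x`. -/
def linearPath : E →L[𝕂] C(unitInterval, E) :=
  LinearMap.mkContinuous
    { toFun := fun x => ⟨fun s => (s : ℝ) • x, by fun_prop⟩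
      map_add' := fun x y => by ext; simp
      map_smul' := fun c x => by
        ext s
        exact smul_comm _ _ _ }
    1 (fun x => by
      rw [ContinuousMap.norm_le _ (by positivity)]
      intro s
      simp only [LinearMap.coe_mk, AddHom.coe_mk, ContinuousMap.coe_mk, norm_smul]
      gcongr
      rw [Real.norm_of_nonneg s.2.1]
      exact s.2.2)

end PathSpace

section Hadamard

universe u

variable {𝕂 : Type*} [RCLike 𝕂] {r : Regularity} {E F : Type u} [NormedAddCommGroup E]
  [NormedSpace 𝕂 E] [NormedSpace ℝ E] [IsScalarTower ℝ 𝕂 E] [NormedAddCommGroup F]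
  [NormedSpace 𝕂 F] [NormedSpace ℝ F] [IsScalarTower ℝ 𝕂 F] [CompleteSpace F]

/-- The average `∫₀¹ df(s x) ds` of the derivative of `f` along the segment from `0` to `x`. -/
def averageFDeriv (𝕂 : Type*) [RCLike 𝕂] [NormedSpace 𝕂 E] [IsScalarTower ℝ 𝕂 E] [NormedSpace 𝕂 F]
    [IsScalarTower ℝ 𝕂 F] (f : E → F) (x : E) : E →L[𝕂] F :=
  pathIntegral 𝕂 (E →L[𝕂] F) (superposition (fderiv 𝕂 f) (linearPath 𝕂 x)) 1

theorem smoothAt_averageFDeriv {f : E → F} (hf : SmoothAt 𝕂 r f 0) :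
    SmoothAt 𝕂 r (averageFDeriv 𝕂 f) 0 := by
  have hlin : linearPath 𝕂 (0 : E) = ContinuousMap.const _ 0 := map_zero _
  have hsup : SmoothAt 𝕂 r (superposition (I := unitInterval) (fderiv 𝕂 f)) (linearPath 𝕂 0) :=
    hlin ▸ hf.fderiv.superposition
  let ev : C(unitInterval, E →L[𝕂] F) →L[𝕂] E →L[𝕂] F :=
    (ContinuousMap.evalCLM 𝕂 (1 : unitInterval)).comp (pathIntegral 𝕂 (E →L[𝕂] F))
  exact (SmoothAt.of_contDiff ev.contDiff).comp 0
    (hsup.comp 0 (.of_contDiff (linearPath 𝕂 (E := E)).contDiff))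

theorem averageFDeriv_apply_self {f : E → F} {x : E}
    (hf : ∀ s ∈ Icc (0 : ℝ) 1, ContDiffAt 𝕂 1 f (s • x)) :
    averageFDeriv 𝕂 f x x = f x - f 0 := by
  set α := superposition (fderiv 𝕂 f) (linearPath 𝕂 x)
  have hα_apply (s : unitInterval) : α s = fderiv 𝕂 f ((s : ℝ) • x) :=
    superposition_apply (f := fderiv 𝕂 f) (α := linearPath 𝕂 x)
      (fun s => ((hf s s.2).fderiv_right (m := 0) le_rfl).continuousAt) s
  have hα_cont : Continuous (IccExtend zero_le_one α) := α.continuous.Icc_extend'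
  calc averageFDeriv 𝕂 f x x
      = ∫ s in (0 : ℝ)..1, IccExtend zero_le_one α s x := by
        rw [← ContinuousLinearMap.intervalIntegral_apply (hα_cont.intervalIntegrable _ _)]
        rfl
    _ = f ((1 : ℝ) • x) - f ((0 : ℝ) • x) := by
        refine intervalIntegral.integral_eq_sub_of_hasDerivAt (f := fun s : ℝ => f (s • x))
          (fun s hs => ?_) ((hα_cont.clm_apply continuous_const).intervalIntegrable _ _)
        rw [uIcc_of_le zero_le_one] at hs
        rw [IccExtend_of_mem _ _ hs, hα_apply]
        have hline : HasDerivAt (fun s : ℝ => s • x) x s := by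
          simpa using (hasDerivAt_id s).smul_const x
        exact (((hf s hs).differentiableAt one_ne_zero).hasFDerivAt.restrictScalars
          ℝ).comp_hasDerivAt s hline
    _ = f x - f 0 := by rw [one_smul, zero_smul]

/-- Hadamard's lemma. -/
theorem SmoothAt.exists_eq_add_apply_self {f : E → F} (hf : SmoothAt 𝕂 r f 0) :
    ∃ g : E → E →L[𝕂] F, SmoothAt 𝕂 r g 0 ∧ ∀ᶠ x in 𝓝 0, f x = f 0 + g x x := by
  refine ⟨averageFDeriv 𝕂 f, smoothAt_averageFDeriv hf, ?_⟩
  obtain ⟨δ, hδ, hball⟩ := Metric.eventually_nhds_iff_ball.1 hf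
  filter_upwards [Metric.ball_mem_nhds 0 hδ] with x hx
  rw [averageFDeriv_apply_self fun s hs => (hball _ ?_).of_le r.one_le_order, add_sub_cancel]
  exact (convex_ball 0 δ).starConvex (Metric.mem_ball_self hδ) |>.smul_mem hx hs.1 hs.2

end Hadamard

/-! ### Local flows -/

theorem exists_smoothAt_implicitFunction {𝕂 : Type*} [RCLike 𝕂] {r : Regularity} {E F G : Type*}
    [NormedAddCommGroup E] [NormedSpace 𝕂 E] [CompleteSpace E] [NormedAddCommGroup F]
    [NormedSpace 𝕂 F] [CompleteSpace F] [NormedAddCommGroup G] [NormedSpace 𝕂 G] [CompleteSpace G]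
    {f : E × F → G} {u : E × F} (hf : SmoothAt 𝕂 r f u)
    (hinv : (fderiv 𝕂 f u ∘L .inr 𝕂 E F).IsInvertible) :
    ∃ ψ : E → F, SmoothAt 𝕂 r ψ u.1 ∧ ψ u.1 = u.2 ∧ ∀ᶠ v in 𝓝 u, f v = f u ↔ ψ v.1 = v.2 := by
  set ψ := hf.contDiffAt.implicitFunction r.order_ne_zero hinv
  have hψu : ψ u.1 = u.2 := hf.contDiffAt.implicitFunction_apply_self r.order_ne_zero hinv
  have hiff : ∀ᶠ v in 𝓝 u, f v = f u ↔ ψ v.1 = v.2 :=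
    hf.contDiffAt.eventually_apply_eq_iff_implicitFunction r.order_ne_zero hinv
  have hψ : ContDiffAt 𝕂 r.order ψ u.1 :=
    hf.contDiffAt.contDiffAt_implicitFunction r.order_ne_zero hinv
  have hgraph : ∀ᶠ y in 𝓝 u.1, Tendsto (fun z => (z, ψ z)) (𝓝 y) (𝓝 (y, ψ y)) := by
    filter_upwards [(hψ.of_le r.one_le_order).eventually (by simp)] with y hy
    exact continuousAt_id.prodMk hy.continuousAt
  have hgraph_u : Tendsto (fun z => (z, ψ z)) (𝓝 u.1) (𝓝 u) := by
    simpa only [hψu] using hgraph.self_of_nhds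
  refine ⟨ψ, ?_, hψu, hiff⟩
  have hinv' := eventually_isInvertible
    (hf.fderiv.clm_comp (.const (c := .inr 𝕂 E F))).continuousAt hinv
  filter_upwards [hgraph_u.eventually (hf.and (hinv'.and hiff.eventually_nhds)), hgraph]
    with y ⟨hfy, hinvy, hiffy⟩ hy
  have hval : f (y, ψ y) = f u := hiffy.self_of_nhds.2 rfl
  have heq : ψ =ᶠ[𝓝 y] hfy.implicitFunction r.order_ne_zero hinvy := by
    filter_upwards [hy.eventually hiffy, hy.eventually
      (hfy.eventually_apply_eq_iff_implicitFunction r.order_ne_zero hinvy)] with z h₁ h₂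
    exact (h₂.1 ((h₁.2 rfl).trans hval.symm)).symm
  exact (hfy.contDiffAt_implicitFunction r.order_ne_zero hinvy).congr_of_eventuallyEq heq

theorem eventually_exists_ball {𝕂 E : Type*} [SeminormedAddCommGroup 𝕂] [TopologicalSpace E]
    {x₀ : E} {P : 𝕂 × E → Prop} (hP : ∀ᶠ z in 𝓝 (0, x₀), P z) :
    ∀ᶠ z : 𝕂 × E in 𝓝 (0, x₀), ∃ ε, ‖z.1‖ < ε ∧ ∀ s : 𝕂, ‖s‖ < ε → P (s, z.2) := by
  rw [nhds_prod_eq] at hP ⊢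
  obtain ⟨p, hp, q, hq, hpq⟩ := eventually_prod_iff.1 hP
  obtain ⟨ε, hε, hball⟩ := Metric.eventually_nhds_iff_ball.1 hp
  simp only [mem_ball_zero_iff] at hball
  filter_upwards [prod_mem_prod (Metric.ball_mem_nhds (0 : 𝕂) hε) hq] with z hz
  exact ⟨ε, mem_ball_zero_iff.1 hz.1, fun s hs => hpq (hball s hs) hz.2⟩

section Picard

universe u

variable (𝕂 : Type*) [RCLike 𝕂] {r : Regularity} {E : Type u} [NormedAddCommGroup E]
  [NormedSpace 𝕂 E] [NormedSpace ℝ E] [IsScalarTower ℝ 𝕂 E] {f : E → E} {x₀ : E}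

/-- The defect `α - x - τ ∫₀ˢ f (α u) du` of a path `α` in the integral equation for the rescaled
integral curve `s ↦ Φ (s τ, x)` of `f`. Having all these curves on the unit interval turns the
equation into a smooth one on a fixed Banach space. -/
def picardDefect (f : E → E) (z : (𝕂 × E) × C(unitInterval, E)) : C(unitInterval, E) :=
  z.2 - ContinuousLinearMap.const 𝕂 unitInterval z.1.2 -
    z.1.1 • pathIntegral 𝕂 E (superposition f z.2)

variable {𝕂}

theorem picardDefect_zero (x : E) (α : C(unitInterval, E)) :
    picardDefect 𝕂 f ((0, x), α) = α - .const unitInterval x := by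
  rw [picardDefect, zero_smul, sub_zero]
  rfl

theorem picardDefect_eq_zero_iff {z : 𝕂 × E} {α : C(unitInterval, E)} :
    picardDefect 𝕂 f (z, α) = 0 ↔ ∀ s : unitInterval,
      α s = z.2 + z.1 • ∫ u in (0 : ℝ)..s, IccExtend zero_le_one (superposition f α) u := by
  rw [picardDefect, sub_sub, sub_eq_zero, ContinuousMap.ext_iff]
  rfl

theorem smoothAt_picardDefect [CompleteSpace E] (hf : SmoothAt 𝕂 r f x₀) :
    SmoothAt 𝕂 r (picardDefect 𝕂 f) ((0, x₀), .const unitInterval x₀) := by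
  have hsup : SmoothAt 𝕂 r (fun z : (𝕂 × E) × C(unitInterval, E) => superposition f z.2)
      ((0, x₀), .const unitInterval x₀) :=
    SmoothAt.comp (f := Prod.snd) _ hf.superposition .snd
  have hconst : ContDiff 𝕂 r.order fun z : (𝕂 × E) × C(unitInterval, E) =>
      ContinuousLinearMap.const 𝕂 unitInterval z.1.2 :=
    (ContinuousLinearMap.const 𝕂 unitInterval (M := E)).contDiff.comp contDiff_fst.snd
  exact .sub (.sub .snd (.of_contDiff hconst)) (.smul (.of_contDiff contDiff_fst.fst)
    ((SmoothAt.of_contDiff (pathIntegral 𝕂 E).contDiff).comp _ hsup))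

theorem fderiv_picardDefect_inr [CompleteSpace E] (hf : SmoothAt 𝕂 r f x₀) :
    fderiv 𝕂 (picardDefect 𝕂 f) ((0, x₀), .const unitInterval x₀) ∘L .inr 𝕂 (𝕂 × E) _ =
      .id 𝕂 C(unitInterval, E) := by
  rw [← ((smoothAt_picardDefect hf).hasFDerivAt.comp _ (hasFDerivAt_prodMk_right _ _)).fderiv]
  exact ((hasFDerivAt_id _).sub_const _).congr_of_eventuallyEq
    (.of_forall (picardDefect_zero x₀)) |>.fderiv

/-- `A (τ, x)` is the solution on `[0, 1]` of the integral equation for the curve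
`s ↦ Φ (s τ, x)`, where `Φ` is the flow of `f`, for `(τ, x)` near `(0, x₀)`. -/
structure IsPicardSolution (r : Regularity) (f : E → E) (x₀ : E)
    (A : 𝕂 × E → C(unitInterval, E)) : Prop where
  smoothAt : SmoothAt 𝕂 r A (0, x₀)
  apply_base : A (0, x₀) = .const unitInterval x₀
  eventually_iff : ∀ᶠ v in 𝓝 ((0, x₀), .const unitInterval x₀),
    picardDefect 𝕂 f v = 0 ↔ A v.1 = v.2

theorem exists_isPicardSolution [CompleteSpace E] (hf : SmoothAt 𝕂 r f x₀) :
    ∃ A : 𝕂 × E → C(unitInterval, E), IsPicardSolution r f x₀ A := by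
  obtain ⟨A, hA, hA₀, hiff⟩ := exists_smoothAt_implicitFunction (smoothAt_picardDefect hf)
    (fderiv_picardDefect_inr hf ▸ ⟨.refl 𝕂 _, rfl⟩)
  have hbase : picardDefect 𝕂 f ((0, x₀), .const unitInterval x₀) = 0 := by
    rw [picardDefect_zero, sub_self]
  exact ⟨A, hA, hA₀, by simpa only [hbase] using hiff⟩

/-- The path `s ↦ α (u s)`. -/
def rescale (α : C(unitInterval, E)) (u : unitInterval) : C(unitInterval, E) :=
  ⟨fun s => α (u * s), by fun_prop⟩

theorem integral_rescale (α : C(unitInterval, E)) (u s : unitInterval) :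
    (u : ℝ) • ∫ v in (0 : ℝ)..s, IccExtend zero_le_one (rescale α u) v =
      ∫ v in (0 : ℝ)..(u * s : unitInterval), IccExtend zero_le_one α v := by
  calc (u : ℝ) • ∫ v in (0 : ℝ)..s, IccExtend zero_le_one (rescale α u) v
      = (u : ℝ) • ∫ v in (0 : ℝ)..s, IccExtend zero_le_one α (u * v) := by
        congr 1
        refine intervalIntegral.integral_congr fun v hv => ?_
        rw [uIcc_of_le s.2.1] at hv
        have hv₁ : v ∈ Icc (0 : ℝ) 1 := ⟨hv.1, hv.2.trans s.2.2⟩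
        simp only [IccExtend_of_mem _ _ hv₁, IccExtend_of_mem _ α (unitInterval.mul_mem u.2 hv₁)]
        rfl
    _ = ∫ v in (0 : ℝ)..(u * s : unitInterval), IccExtend zero_le_one α v := by
        rw [intervalIntegral.smul_integral_comp_mul_left, mul_zero]
        rfl

theorem picardDefect_rescale_eq_zero {z : 𝕂 × E} {α : C(unitInterval, E)}
    (hf : ∀ s, ContinuousAt f (α s)) (h : picardDefect 𝕂 f (z, α) = 0) (u : unitInterval) :
    picardDefect 𝕂 f ((((u : ℝ) : 𝕂) * z.1, z.2), rescale α u) = 0 := by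
  have hsup : superposition f (rescale α u) = rescale (superposition f α) u := by
    ext s
    rw [superposition_apply fun s => hf (u * s)]
    exact (superposition_apply hf (u * s)).symm
  rw [picardDefect_eq_zero_iff] at h ⊢
  intro s
  rw [hsup, mul_comm, mul_smul, ← RCLike.real_smul_eq_coe_smul (K := 𝕂), integral_rescale]
  exact h (u * s)

namespace IsPicardSolution

variable {A : 𝕂 × E → C(unitInterval, E)}

theorem tendsto (hA : IsPicardSolution r f x₀ A) :
    Tendsto A (𝓝 (0, x₀)) (𝓝 (.const unitInterval x₀)) :=
  hA.smoothAt.tendsto hA.apply_base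

theorem eventually_apply (hA : IsPicardSolution r f x₀ A) :
    ∀ᶠ z in 𝓝 (0, x₀), ∀ s : unitInterval, A z s =
      z.2 + z.1 • ∫ u in (0 : ℝ)..s, IccExtend zero_le_one (superposition f (A z)) u := by
  filter_upwards [(tendsto_id.prodMk_nhds hA.tendsto).eventually hA.eventually_iff] with z hz
  exact picardDefect_eq_zero_iff.1 (hz.2 rfl)

theorem eventually_smoothAt (hA : IsPicardSolution r f x₀ A) (hf : SmoothAt 𝕂 r f x₀) :
    ∀ᶠ z in 𝓝 (0, x₀), ∀ s, SmoothAt 𝕂 r f (A z s) := by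
  obtain ⟨U, hU, hUo, hx₀⟩ := eventually_nhds_iff.1 hf.eventually
  filter_upwards [hA.tendsto.eventually ((isOpen_paths hUo).mem_nhds fun _ => hx₀)] with z hz s
  exact hU _ (hz s)

theorem eventually_apply_mul (hA : IsPicardSolution r f x₀ A) (hf : SmoothAt 𝕂 r f x₀) :
    ∀ᶠ z in 𝓝 (0, x₀), ∀ u : unitInterval, A (((u : ℝ) : 𝕂) * z.1, z.2) 1 = A z u := by
  obtain ⟨ρ, hρ, hball⟩ := Metric.eventually_nhds_iff_ball.1 hA.eventually_iff
  filter_upwards [Metric.ball_mem_nhds _ hρ, hA.tendsto.eventually (Metric.ball_mem_nhds _ hρ),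
    hA.eventually_smoothAt hf, hA.eventually_apply] with z hz hAz hfz hsol u
  rw [← picardDefect_eq_zero_iff] at hsol
  have hmem : ((((u : ℝ) : 𝕂) * z.1, z.2), rescale (A z) u) ∈
      Metric.ball ((0, x₀), .const unitInterval x₀) ρ := by
    simp only [Metric.mem_ball, Prod.dist_eq, dist_zero_right, max_lt_iff] at hz hAz ⊢
    refine ⟨⟨?_, hz.2⟩, lt_of_le_of_lt ((ContinuousMap.dist_le dist_nonneg).2 fun s => ?_) hAz⟩
    · rw [norm_mul, RCLike.norm_ofReal, abs_of_nonneg u.2.1]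
      exact (mul_le_of_le_one_left (norm_nonneg _) u.2.2).trans_lt hz.1
    · exact ContinuousMap.dist_apply_le_dist (f := A z) (g := .const unitInterval x₀) (u * s)
  have heq := (hball _ hmem).1
    (picardDefect_rescale_eq_zero (fun s => (hfz s).continuousAt) hsol u)
  simpa [rescale] using DFunLike.congr_fun heq 1

theorem eventually_eq_add_integral (hA : IsPicardSolution r f x₀ A) (hf : SmoothAt 𝕂 r f x₀) :
    ∀ᶠ z : ℝ × E in 𝓝 (0, x₀), A ((z.1 : 𝕂), z.2) 1 =
      z.2 + ∫ t in (0 : ℝ)..z.1, f (A ((t : 𝕂), z.2) 1) := by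
  have hcast : Tendsto (fun z : ℝ × E => ((z.1 : 𝕂), z.2)) (𝓝 (0, x₀)) (𝓝 (0, x₀)) :=
    ((RCLike.continuous_ofReal.comp continuous_fst).prodMk continuous_snd).tendsto' _ _ (by simp)
  filter_upwards [hcast.eventually hA.eventually_apply, hcast.eventually
    (hA.eventually_smoothAt hf), hcast.eventually (hA.eventually_apply_mul hf)] with z hsol hfz hmul
  have hint := intervalIntegral.smul_integral_comp_mul_right (a := 0) (b := 1)
    (fun t : ℝ => f (A ((t : 𝕂), z.2) 1)) z.1
  rw [zero_mul, one_mul] at hint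
  refine (hsol 1).trans ?_
  rw [← hint, RCLike.real_smul_eq_coe_smul (K := 𝕂) z.1]
  congr 2
  refine intervalIntegral.integral_congr fun v hv => ?_
  rw [Icc.coe_one, uIcc_of_le zero_le_one] at hv
  simp only [IccExtend_of_mem _ _ hv]
  rw [superposition_apply fun s => (hfz s).continuousAt, ← hmul ⟨v, hv⟩]
  simp

end IsPicardSolution

end Picard

section Flow

universe u

variable {𝕂 : Type*} [RCLike 𝕂] {r : Regularity} {E : Type u} [NormedAddCommGroup E]
  [NormedSpace 𝕂 E] [NormedSpace ℝ E] {X : E → E} {x₀ : E} {Φ : 𝕂 × E → E}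

/-- `Φ` is a local flow of `X` near `x₀`: smooth over `𝕂`, and restricting to integral curves of
`X` for real times. -/
structure IsSmoothFlow (r : Regularity) (X : E → E) (x₀ : E) (Φ : 𝕂 × E → E) : Prop where
  smoothAt : SmoothAt 𝕂 r Φ (0, x₀)
  apply_zero : ∀ᶠ x in 𝓝 x₀, Φ (0, x) = x
  hasDerivAt : ∀ᶠ z : ℝ × E in 𝓝 (0, x₀),
    HasDerivAt (fun s : ℝ => Φ ((s : 𝕂), z.2)) (X (Φ ((z.1 : 𝕂), z.2))) z.1

theorem exists_isSmoothFlow [IsScalarTower ℝ 𝕂 E] [CompleteSpace E] (hX : SmoothAt 𝕂 r X x₀) :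
    ∃ Φ : 𝕂 × E → E, IsSmoothFlow r X x₀ Φ := by
  obtain ⟨A, hA⟩ := exists_isPicardSolution hX
  let ev : C(unitInterval, E) →L[𝕂] E := ContinuousMap.evalCLM 𝕂 1
  have hΦ : SmoothAt 𝕂 r (fun z => A z 1) (0, x₀) :=
    (SmoothAt.of_contDiff ev.contDiff).comp (0, x₀) hA.smoothAt
  refine ⟨fun z => A z 1, hΦ, ?_, ?_⟩
  · have hzero : Tendsto (fun x : E => ((0 : 𝕂), x)) (𝓝 x₀) (𝓝 (0, x₀)) :=
      (Continuous.prodMk_right 0).tendsto x₀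
    filter_upwards [hzero.eventually hA.eventually_apply] with x hx
    simpa using hx 1
  · have hcast : Tendsto (fun z : ℝ × E => ((z.1 : 𝕂), z.2)) (𝓝 (0, x₀)) (𝓝 (0, x₀)) :=
      ((RCLike.continuous_ofReal.comp continuous_fst).prodMk continuous_snd).tendsto' _ _ (by simp)
    have hX' : SmoothAt 𝕂 r X (A (0, x₀) 1) := by simpa [hA.apply_base] using hX
    filter_upwards [eventually_exists_ball ((hcast.eventually (hX'.comp (0, x₀) hΦ).eventually).and
      (hA.eventually_eq_add_integral hX))] with z ⟨ε, hz, hball⟩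
    let v (t : ℝ) : E := X (A ((t : 𝕂), z.2) 1)
    have hv : ContinuousOn v (Metric.ball 0 ε) := fun t ht =>
      ((hball t (by simpa using ht)).1.continuousAt.comp (f := fun t : ℝ => ((t : 𝕂), z.2))
        (by fun_prop)).continuousWithinAt
    have hz' : z.1 ∈ Metric.ball (0 : ℝ) ε := by simpa using hz
    have hsub : uIcc 0 z.1 ⊆ Metric.ball 0 ε :=
      (convex_ball (0 : ℝ) ε).ordConnected.uIcc_subset
        (Metric.mem_ball_self ((norm_nonneg _).trans_lt hz)) hz'
    refine ((intervalIntegral.integral_hasDerivAt_right (hv.mono hsub).intervalIntegrable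
      (hv.stronglyMeasurableAtFilter Metric.isOpen_ball _ hz')
      (hv.continuousAt (Metric.isOpen_ball.mem_nhds hz'))).const_add z.2).congr_of_eventuallyEq ?_
    filter_upwards [Metric.isOpen_ball.mem_nhds hz'] with t ht
    exact (hball t (by simpa using ht)).2

namespace IsSmoothFlow

theorem apply_base (hΦ : IsSmoothFlow r X x₀ Φ) : Φ (0, x₀) = x₀ :=
  hΦ.apply_zero.self_of_nhds

theorem tendsto (hΦ : IsSmoothFlow r X x₀ Φ) : Tendsto Φ (𝓝 (0, x₀)) (𝓝 x₀) :=
  hΦ.smoothAt.tendsto hΦ.apply_base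

theorem fderiv_inr (hΦ : IsSmoothFlow r X x₀ Φ) :
    fderiv 𝕂 Φ (0, x₀) ∘L .inr 𝕂 𝕂 E = .id 𝕂 E :=
  fderiv_comp_inr_eq_id hΦ.smoothAt hΦ.apply_zero

theorem eventually_isLocalDiffeoAt [CompleteSpace E] (hΦ : IsSmoothFlow r X x₀ Φ) :
    ∀ᶠ z in 𝓝 (0, x₀), IsLocalDiffeoAt 𝕂 r (fun x => Φ (z.1, x)) z.2 :=
  eventually_isLocalDiffeoAt_slice hΦ.smoothAt hΦ.apply_zero

end IsSmoothFlow

end Flow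

/-! ### Orbits and plaques -/

section Orbits

universe u

variable {E : Type u} [NormedAddCommGroup E] [NormedSpace ℝ E] {V : Set E}

/-- The integral curve of `X` through `x` stays, for small times, in `V` or in its complement. -/
def Invariant (X : E → E) (V : Set E) (x : E) : Prop :=
  ∀ c : ℝ → E, c 0 = x → (∀ᶠ s in 𝓝 0, HasDerivAt c (X (c s)) s) →
    ∀ᶠ s in 𝓝 0, (c s ∈ V ↔ x ∈ V)

theorem Invariant.mem_iff {X : E → E} {s : Set ℝ} (hs : IsOpen s) (hs' : IsPreconnected s)
    {γ : ℝ → E} (hγ : ∀ t ∈ s, HasDerivAt γ (X (γ t)) t) (hX : ∀ t ∈ s, Invariant X V (γ t))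
    {t₀ t₁ : ℝ} (h₀ : t₀ ∈ s) (h₁ : t₁ ∈ s) : γ t₀ ∈ V ↔ γ t₁ ∈ V := by
  refine hs'.induction₂ (fun a b => γ a ∈ V ↔ γ b ∈ V) (fun t ht => ?_)
    (fun a b c _ _ _ hab hbc => hab.trans hbc) (fun a b _ _ h => h.symm) h₀ h₁
  have hadd : Tendsto (fun u : ℝ => t + u) (𝓝 0) (𝓝 t) :=
    (continuous_const_add t).tendsto' 0 t (add_zero t)
  have hshift := hX t ht (fun u => γ (t + u)) (by simp) (by
    filter_upwards [hadd.eventually (hs.mem_nhds ht)] with u hu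
    exact (hγ _ hu).comp_const_add t u)
  have hsub : Tendsto (fun u : ℝ => u - t) (𝓝 t) (𝓝 0) :=
    (continuous_sub_right t).tendsto' t 0 (sub_self t)
  refine nhdsWithin_le_nhds ?_
  filter_upwards [hsub.eventually hshift] with u hu
  simpa [iff_comm] using hu

/-- Some local diffeomorphism preserving `V` maps `y` to `x`. -/
def LocallyEquivalent (V : Set E) (y x : E) : Prop :=
  ∃ g : E → E, g y = x ∧ IsLocalDiffeoAt ℝ .smooth g y ∧ ∀ᶠ z in 𝓝 y, (g z ∈ V ↔ z ∈ V)

namespace LocallyEquivalent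

variable {x y z : E}

theorem refl (x : E) : LocallyEquivalent V x x :=
  ⟨fun y => y, rfl, .id, .of_forall fun _ => Iff.rfl⟩

theorem mem_iff (h : LocallyEquivalent V y x) : x ∈ V ↔ y ∈ V := by
  obtain ⟨g, rfl, -, hgV⟩ := h
  exact hgV.self_of_nhds

theorem trans (h₁ : LocallyEquivalent V z y) (h₂ : LocallyEquivalent V y x) :
    LocallyEquivalent V z x := by
  obtain ⟨g, rfl, hg, hgV⟩ := h₁
  obtain ⟨f, rfl, hf, hfV⟩ := h₂
  refine ⟨fun w => f (g w), rfl, hf.comp hg, ?_⟩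
  filter_upwards [hgV, hg.smoothAt.continuousAt.eventually hfV] with w hgw hfw
  exact hfw.trans hgw

theorem symm [CompleteSpace E] (h : LocallyEquivalent V y x) : LocallyEquivalent V x y := by
  obtain ⟨g, rfl, hg, hgV⟩ := h
  obtain ⟨χ, hχy, hχ, -, hgχ⟩ := hg.exists_inverse
  refine ⟨χ, hχy, hχ, ?_⟩
  filter_upwards [hgχ, (hχ.smoothAt.tendsto hχy).eventually hgV] with w hw hwV
  rw [← hwV, hw]

end LocallyEquivalent

theorem eventually_locallyEquivalent [CompleteSpace E] {g : E → E} {y : E}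
    (hg : IsLocalDiffeoAt ℝ .smooth g y) (hgV : ∀ᶠ z in 𝓝 y, (g z ∈ V ↔ z ∈ V)) :
    ∀ᶠ z in 𝓝 y, LocallyEquivalent V z (g z) := by
  filter_upwards [hg.eventually, hgV.eventually_nhds] with z hz hzV using ⟨g, rfl, hz, hzV⟩

namespace IsSmoothFlow

variable {X : E → E} {x₀ : E} {Φ : ℝ × E → E}

theorem eventually_hasDerivAt (hΦ : IsSmoothFlow .smooth X x₀ Φ) :
    ∀ᶠ z in 𝓝 (0, x₀), HasDerivAt (fun s => Φ (s, z.2)) (X (Φ z)) z.1 := by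
  simpa only [RCLike.ofReal_real_eq_id, id_eq, Prod.mk.eta] using hΦ.hasDerivAt

theorem fderiv_apply (hΦ : IsSmoothFlow .smooth X x₀ Φ) (z : ℝ × E) :
    fderiv ℝ Φ (0, x₀) z = z.1 • X x₀ + z.2 := by
  have htime : fderiv ℝ Φ (0, x₀) (1, 0) = X x₀ := by
    have hcurve : HasDerivAt (fun s : ℝ => (s, x₀)) (1, 0) 0 :=
      (hasDerivAt_id 0).prodMk (hasDerivAt_const _ _)
    have hX := hΦ.eventually_hasDerivAt.self_of_nhds
    rw [hΦ.apply_base] at hX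
    exact (HasFDerivAt.comp_hasDerivAt 0 hΦ.smoothAt.hasFDerivAt hcurve).unique hX
  have hspace : fderiv ℝ Φ (0, x₀) (0, z.2) = z.2 := DFunLike.congr_fun hΦ.fderiv_inr z.2
  calc fderiv ℝ Φ (0, x₀) z
      = fderiv ℝ Φ (0, x₀) (z.1 • (1, 0) + (0, z.2)) := by simp
    _ = z.1 • X x₀ + z.2 := by rw [map_add, map_smul, htime, hspace]

theorem eventually_mem_iff (hΦ : IsSmoothFlow .smooth X x₀ Φ)
    (hV : ∀ᶠ x in 𝓝 x₀, Invariant X V x) : ∀ᶠ z in 𝓝 (0, x₀), (Φ z ∈ V ↔ z.2 ∈ V) := by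
  filter_upwards [eventually_exists_ball (hΦ.eventually_hasDerivAt.and (hΦ.tendsto.eventually hV)),
    (continuous_snd.tendsto ((0 : ℝ), x₀)).eventually hΦ.apply_zero] with z ⟨ε, hz, hball⟩ hz₀
  simp only [← mem_ball_zero_iff] at hz hball
  have hiff := Invariant.mem_iff Metric.isOpen_ball (convex_ball (0 : ℝ) ε).isPreconnected
    (fun s hs => (hball s hs).1) (fun s hs => (hball s hs).2) hz
    (Metric.mem_ball_self (Metric.pos_of_mem_ball hz))
  rwa [hz₀] at hiff

theorem eventually_locallyEquivalent [CompleteSpace E] (hΦ : IsSmoothFlow .smooth X x₀ Φ)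
    (hV : ∀ᶠ x in 𝓝 x₀, Invariant X V x) : ∀ᶠ z in 𝓝 (0, x₀), LocallyEquivalent V z.2 (Φ z) := by
  filter_upwards [hΦ.eventually_isLocalDiffeoAt, (hΦ.eventually_mem_iff hV).eventually_nhds]
    with z hdiffeo hmem
  exact ⟨fun x => Φ (z.1, x), rfl, hdiffeo,
    ((Continuous.prodMk_right z.1).tendsto' z.2 z rfl).eventually hmem⟩

end IsSmoothFlow

end Orbits

section Plaques

universe u

variable {E : Type u} {W W' : Type*} [NormedAddCommGroup E] [NormedSpace ℝ E] [NormedAddCommGroup W]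
  [NormedSpace ℝ W] [NormedAddCommGroup W'] [NormedSpace ℝ W'] {V : Set E} {H : W → E} {σ : W}

/-- Near `σ`, the map `H` is an immersion into the orbit of `H σ` under the pseudogroup of local
diffeomorphisms that preserve `V`. -/
structure IsPlaque (V : Set E) (H : W → E) (σ : W) : Prop where
  smoothAt : SmoothAt ℝ .smooth H σ
  injective : Function.Injective (fderiv ℝ H σ)
  locallyEquivalent : ∀ᶠ τ in 𝓝 σ, LocallyEquivalent V (H τ) (H σ)

namespace IsPlaque

theorem eventually [CompleteSpace E] [FiniteDimensional ℝ W] (hH : IsPlaque V H σ) :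
    ∀ᶠ τ in 𝓝 σ, IsPlaque V H τ := by
  filter_upwards [hH.smoothAt.eventually, hH.smoothAt.fderiv.continuousAt.eventually
    (ContinuousLinearMap.isOpen_injective.mem_nhds hH.injective),
    hH.locallyEquivalent.eventually_nhds] with τ hs hi he
  exact ⟨hs, hi, he.mono fun τ' h => h.trans he.self_of_nhds.symm⟩

theorem exists_transport [CompleteSpace E] (hH : IsPlaque V H σ) {x : E}
    (hx : LocallyEquivalent V (H σ) x) : ∃ H' : W → E, H' σ = x ∧ IsPlaque V H' σ := by
  obtain ⟨g, rfl, hg, hgV⟩ := hx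
  refine ⟨fun τ => g (H τ), rfl, hg.smoothAt.comp σ hH.smoothAt, ?_, ?_⟩
  · rw [fderiv_fun_comp σ hg.smoothAt.differentiableAt hH.smoothAt.differentiableAt]
    exact hg.isInvertible.injective.comp hH.injective
  · have hg' := eventually_locallyEquivalent hg hgV
    filter_upwards [hH.smoothAt.continuousAt.eventually hg', hH.locallyEquivalent] with τ hgτ hτ
    exact hgτ.symm.trans (hτ.trans hg'.self_of_nhds)

theorem comp_equiv (hH : IsPlaque V H σ) (e : W' ≃L[ℝ] W) {σ' : W'} (hσ' : e σ' = σ) :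
    IsPlaque V (fun τ => H (e τ)) σ' := by
  subst hσ'
  refine ⟨hH.smoothAt.comp σ' (.of_contDiff e.contDiff), ?_,
    e.continuous.continuousAt.eventually hH.locallyEquivalent⟩
  rw [fderiv_fun_comp σ' hH.smoothAt.differentiableAt e.differentiableAt, e.fderiv]
  exact hH.injective.comp e.injective

theorem flow [CompleteSpace E] (hH : IsPlaque V H σ) {X : E → E} {Φ : ℝ × E → E}
    (hΦ : IsSmoothFlow .smooth X (H σ) Φ) (hV : ∀ᶠ x in 𝓝 (H σ), Invariant X V x)
    (hX : X (H σ) ∉ (fderiv ℝ H σ).range) :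
    IsPlaque V (fun z : ℝ × W => Φ (z.1, H z.2)) (0, σ) := by
  have hgraph : SmoothAt ℝ .smooth (fun z : ℝ × W => (z.1, H z.2)) (0, σ) :=
    .prodMk .fst (SmoothAt.comp (f := Prod.snd) _ hH.smoothAt .snd)
  have hderiv : HasFDerivAt (fun z : ℝ × W => (z.1, H z.2))
      ((ContinuousLinearMap.fst ℝ ℝ W).prod ((fderiv ℝ H σ).comp (.snd ℝ ℝ W))) (0, σ) :=
    hasFDerivAt_fst.prodMk
      (HasFDerivAt.comp (f := Prod.snd) _ hH.smoothAt.hasFDerivAt hasFDerivAt_snd)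
  have hflow : fderiv ℝ (fun z : ℝ × W => Φ (z.1, H z.2)) (0, σ) = _ :=
    (HasFDerivAt.comp (f := fun z : ℝ × W => (z.1, H z.2)) (0, σ)
      hΦ.smoothAt.hasFDerivAt hderiv).fderiv
  refine ⟨SmoothAt.comp (f := fun z : ℝ × W => (z.1, H z.2)) (0, σ) hΦ.smoothAt hgraph, ?_, ?_⟩
  · rw [hflow]
    refine (injective_iff_map_eq_zero _).2 fun ⟨a, w⟩ haw => ?_
    have hsum : a • X (H σ) + fderiv ℝ H σ w = 0 := by simpa [hΦ.fderiv_apply] using haw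
    have ha : a = 0 := by
      by_contra ha
      refine hX ⟨-a⁻¹ • w, ?_⟩
      simp [eq_neg_of_add_eq_zero_right hsum, smul_smul, ha]
    have hw : fderiv ℝ H σ w = fderiv ℝ H σ 0 := by simpa [ha] using hsum
    exact Prod.ext ha (hH.injective hw)
  · have hbase : Φ (0, H σ) = H σ := hΦ.apply_base
    filter_upwards [hgraph.continuousAt.eventually (hΦ.eventually_locallyEquivalent hV),
      (continuous_snd.tendsto ((0 : ℝ), σ)).eventually hH.locallyEquivalent] with z hz hzσ
    simp only [hbase]
    exact hz.symm.trans hzσ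

theorem exists_succ [CompleteSpace E] {n : ℕ} {H : (Fin n → ℝ) → E} {σ : Fin n → ℝ}
    (hH : IsPlaque V H σ) {X : E → E} (hXs : SmoothAt ℝ .smooth X (H σ))
    (hV : ∀ᶠ x in 𝓝 (H σ), Invariant X V x) (hX : X (H σ) ∉ (fderiv ℝ H σ).range) {x : E}
    (hx : LocallyEquivalent V (H σ) x) :
    ∃ (H' : (Fin (n + 1) → ℝ) → E) (σ' : Fin (n + 1) → ℝ), H' σ' = x ∧ IsPlaque V H' σ' := by
  obtain ⟨Φ, hΦ⟩ := exists_isSmoothFlow hXs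
  let e : (Fin (n + 1) → ℝ) ≃L[ℝ] ℝ × (Fin n → ℝ) := (Fin.consEquivL ℝ fun _ => ℝ).symm
  have hplaque := (hH.flow hΦ hV hX).comp_equiv e (e.apply_symm_apply _)
  obtain ⟨H', hH'x, hH'⟩ := hplaque.exists_transport
    (x := x) (by simpa only [e.apply_symm_apply, hΦ.apply_base] using hx)
  exact ⟨H', _, hH'x, hH'⟩

end IsPlaque

theorem exists_maximal_isPlaque [FiniteDimensional ℝ E] (V : Set E) (x₀ : E) :
    ∃ (n : ℕ) (H : (Fin n → ℝ) → E) (σ : Fin n → ℝ), H σ = x₀ ∧ IsPlaque V H σ ∧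
      ∀ (H' : (Fin (n + 1) → ℝ) → E) (σ' : Fin (n + 1) → ℝ), H' σ' = x₀ → ¬ IsPlaque V H' σ' := by
  let P (n : ℕ) : Prop := ∃ (H : (Fin n → ℝ) → E) (σ : Fin n → ℝ), H σ = x₀ ∧ IsPlaque V H σ
  have hzero : P 0 := ⟨fun _ => x₀, 0, rfl, .const, Function.injective_of_subsingleton _,
    .of_forall fun _ => .refl x₀⟩
  have hbound : ¬ P (Module.finrank ℝ E + 1) := by
    rintro ⟨H, σ, -, hH⟩
    have hle := LinearMap.finrank_le_finrank_of_injective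
      (f := (fderiv ℝ H σ).toLinearMap) hH.injective
    simp at hle
  obtain ⟨n, ⟨H, σ, hσ, hH⟩, hn⟩ : ∃ n, P n ∧ ¬ P (n + 1) := by
    by_contra! hsucc
    exact hbound (Nat.rec (motive := P) hzero hsucc _)
  exact ⟨n, H, σ, hσ, hH, fun H' σ' hσ' hH' => hn ⟨H', σ', hσ', hH'⟩⟩

end Plaques

section Tangency

theorem exists_smoothAt_lift {E W : Type*} [NormedAddCommGroup E] [NormedSpace ℝ E]
    [FiniteDimensional ℝ E] [NormedAddCommGroup W] [NormedSpace ℝ W] [CompleteSpace W]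
    {H : W → E} {σ : W} {Y : E → E} (hH : SmoothAt ℝ .smooth H σ)
    (hinj : Function.Injective (fderiv ℝ H σ)) (hY : SmoothAt ℝ .smooth Y (H σ))
    (hrange : ∀ᶠ τ in 𝓝 σ, Y (H τ) ∈ (fderiv ℝ H τ).range) :
    ∃ b : W → W, SmoothAt ℝ .smooth b σ ∧ ∀ᶠ τ in 𝓝 σ, fderiv ℝ H τ (b τ) = Y (H τ) := by
  obtain ⟨L, hL⟩ := LinearMap.exists_leftInverse_of_injective (fderiv ℝ H σ).toLinearMap
    (LinearMap.ker_eq_bot.2 hinj)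
  let A (τ : W) : W →L[ℝ] W := L.toContinuousLinearMap.comp (fderiv ℝ H τ)
  have hA : SmoothAt ℝ .smooth A σ := .clm_comp .const hH.fderiv
  have hAσ : (A σ).IsInvertible :=
    ⟨.refl ℝ W, ContinuousLinearMap.ext fun w => (LinearMap.congr_fun hL w).symm⟩
  refine ⟨fun τ => (A τ).inverse (L.toContinuousLinearMap (Y (H τ))),
    (hA.clm_inverse hAσ).clm_apply (.clm_apply .const (hY.comp σ hH)), ?_⟩
  filter_upwards [eventually_isInvertible hA.continuousAt hAσ, hrange] with τ hAτ ⟨w, hw⟩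
  rw [← hw]
  exact congrArg (fderiv ℝ H τ) (hAτ.inverse_apply_self w)

universe u

variable {E : Type u} [NormedAddCommGroup E] [NormedSpace ℝ E] [FiniteDimensional ℝ E]

theorem IsPlaque.invariant {W : Type*} [NormedAddCommGroup W] [NormedSpace ℝ W] [CompleteSpace W]
    {H : W → E} {σ : W} {Y : E → E} {V : Set E} (hH : IsPlaque V H σ)
    (hY : SmoothAt ℝ .smooth Y (H σ)) (htangent : ∀ᶠ τ in 𝓝 σ, Y (H τ) ∈ (fderiv ℝ H τ).range) :
    Invariant Y V (H σ) := by
  obtain ⟨b, hb, hbY⟩ := exists_smoothAt_lift hH.smoothAt hH.injective hY htangent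
  obtain ⟨Φ, hΦ⟩ := exists_isSmoothFlow hb
  let γ (s : ℝ) : W := Φ (s, σ)
  have hslice : Tendsto (fun s : ℝ => (s, σ)) (𝓝 0) (𝓝 (0, σ)) :=
    (Continuous.prodMk_left σ).tendsto 0
  have hγt : Tendsto γ (𝓝 0) (𝓝 σ) := hΦ.tendsto.comp hslice
  have hHγ : ∀ᶠ s in 𝓝 0, HasDerivAt (fun s => H (γ s)) (Y (H (γ s))) s := by
    filter_upwards [hslice.eventually hΦ.eventually_hasDerivAt, hγt.eventually hbY,
      hγt.eventually hH.smoothAt.eventually] with s hγ hbs hHs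
    rw [← hbs]
    exact hHs.hasFDerivAt.comp_hasDerivAt s hγ
  intro c hc₀ hc
  have hcγ : c =ᶠ[𝓝 0] fun s => H (γ s) := by
    refine eventuallyEq_of_hasDerivAt ?_ hc hHγ (by rw [hc₀]; exact congrArg H hΦ.apply_base.symm)
    exact hc₀ ▸ hY.contDiffAt.of_le (Regularity.one_le_order _)
  filter_upwards [hcγ, hγt.eventually hH.locallyEquivalent] with s hs hequiv
  rw [hs, hequiv.mem_iff]

-- Maximality of the plaque forces the fields `X i`, hence also `Y`, to be tangent to it.
theorem invariant_of_mem_span {ι : Type*} {X : ι → E → E} {Y : E → E} {V : Set E} {x₀ : E}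
    (hX : ∀ᶠ x in 𝓝 x₀, ∀ i, ContDiffAt ℝ ∞ (X i) x ∧ Invariant (X i) V x)
    (hY : SmoothAt ℝ .smooth Y x₀)
    (hmem : ∀ᶠ x in 𝓝 x₀, Y x ∈ Submodule.span ℝ (range fun i => X i x)) :
    Invariant Y V x₀ := by
  have : CompleteSpace E := FiniteDimensional.complete ℝ E
  obtain ⟨n, H, σ, rfl, hH, hmax⟩ := exists_maximal_isPlaque V x₀
  refine hH.invariant hY ?_
  filter_upwards [hH.eventually, hH.locallyEquivalent,
    hH.smoothAt.continuousAt.eventually hX.eventually_nhds,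
    hH.smoothAt.continuousAt.eventually hmem] with τ hτ hτσ hXτ hYτ
  refine Submodule.span_le.2 ?_ hYτ
  rintro _ ⟨i, rfl⟩
  by_contra htransverse
  obtain ⟨H', σ', hσ', hH'⟩ := hτ.exists_succ (hXτ.mono fun x hx => (hx i).1)
    (hXτ.mono fun x hx => (hx i).2) htransverse hτσ
  exact hmax H' σ' hσ' hH'

end Tangency

/-! ### Contact equivalence -/

section Contact

variable {𝕂 : Type*} [RCLike 𝕂] {r : Regularity} {E F : Type*} [NormedAddCommGroup E]
  [NormedSpace 𝕂 E] [NormedAddCommGroup F] [NormedSpace 𝕂 F] {V : Set E} {f g h : E → F}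

/-- Contact equivalence relative to `V` at the origin, in the form that is linear along the fibres:
`g (φ x) = M x (f x)` for a local diffeomorphism `φ` preserving `0` and `V` and a smooth family `M`
of invertible operators. -/
def ContactEquivalent (𝕂 : Type*) [RCLike 𝕂] (r : Regularity) {E F : Type*} [NormedAddCommGroup E]
    [NormedSpace 𝕂 E] [NormedAddCommGroup F] [NormedSpace 𝕂 F] (V : Set E) (f g : E → F) : Prop :=
  ∃ (φ : E → E) (M : E → F →L[𝕂] F), φ 0 = 0 ∧ IsLocalDiffeoAt 𝕂 r φ 0 ∧ SmoothAt 𝕂 r M 0 ∧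
    (M 0).IsInvertible ∧ (∀ᶠ x in 𝓝 0, g (φ x) = M x (f x)) ∧ ∀ᶠ x in 𝓝 0, (φ x ∈ V ↔ x ∈ V)

namespace ContactEquivalent

theorem trans (hfg : ContactEquivalent 𝕂 r V f g) (hgh : ContactEquivalent 𝕂 r V g h) :
    ContactEquivalent 𝕂 r V f h := by
  obtain ⟨φ, M, hφ₀, hφ, hM, hMinv, hfg, hφV⟩ := hfg
  obtain ⟨ψ, N, hψ₀, hψ, hN, hNinv, hgh, hψV⟩ := hgh
  have hφt := hφ.smoothAt.tendsto hφ₀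
  rw [← hφ₀] at hψ hN hNinv
  refine ⟨fun x => ψ (φ x), fun x => (N (φ x)).comp (M x), by simp only [hφ₀, hψ₀], hψ.comp hφ,
    (hN.comp 0 hφ.smoothAt).clm_comp hM, hNinv.comp hMinv, ?_, ?_⟩
  · filter_upwards [hfg, hφt.eventually hgh] with x hx hφx
    rw [hφx, hx, ContinuousLinearMap.comp_apply]
  · filter_upwards [hφV, hφt.eventually hψV] with x hx hφx using hφx.trans hx

theorem symm [CompleteSpace E] [CompleteSpace F] (hfg : ContactEquivalent 𝕂 r V f g) :
    ContactEquivalent 𝕂 r V g f := by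
  obtain ⟨φ, M, hφ₀, hφ, hM, hMinv, hfg, hφV⟩ := hfg
  obtain ⟨χ, hχ₀, hχ, -, hφχ⟩ := hφ.exists_inverse
  rw [hφ₀] at hχ₀ hχ hφχ
  have hχt := hχ.smoothAt.tendsto hχ₀
  refine ⟨χ, fun x => (M (χ x)).inverse, hχ₀, hχ,
    SmoothAt.comp (g := fun x => (M x).inverse) 0 ?_ hχ.smoothAt, ?_, ?_, ?_⟩
  · rw [hχ₀]
    exact hM.clm_inverse hMinv
  · simpa only [hχ₀] using hMinv.inverse
  · filter_upwards [hφχ, hχt.eventually hfg,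
      hχt.eventually (eventually_isInvertible hM.continuousAt hMinv)] with x hx hfgx hinv
    exact (hinv.inverse_apply_eq.2 (by rw [← hfgx, hx])).symm
  · filter_upwards [hφχ, hχt.eventually hφV] with x hx hφVx
    rw [← hφVx, hx]

theorem of_locally [CompleteSpace E] [CompleteSpace F] {H : ℝ → E → F} {a b : ℝ} (hab : a ≤ b)
    (hH : ∀ t ∈ Icc a b, ∀ᶠ τ in 𝓝 0, ContactEquivalent 𝕂 r V (H t) (H (t + τ))) :
    ContactEquivalent 𝕂 r V (H a) (H b) := by
  refine isPreconnected_Icc.induction₂ (fun s t => ContactEquivalent 𝕂 r V (H s) (H t))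
    (fun t ht => nhdsWithin_le_nhds ?_) (fun _ _ _ _ _ _ hst htu => hst.trans htu)
    (fun _ _ _ _ hst => hst.symm) (left_mem_Icc.2 hab) (right_mem_Icc.2 hab)
  have hsub : Tendsto (fun u : ℝ => u - t) (𝓝 t) (𝓝 0) :=
    (continuous_sub_right t).tendsto' t 0 (sub_self t)
  filter_upwards [hsub.eventually (hH t ht)] with u hu
  simpa using hu

end ContactEquivalent

theorem IsLocalDiffeoAt.isDiffeoGerm [CompleteSpace E] {ψ : E → E}
    (hψ : IsLocalDiffeoAt 𝕂 r ψ 0) (hψ₀ : ψ 0 = 0) : IsDiffeoGerm 𝕂 r ψ := by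
  obtain ⟨χ, hχ₀, hχ, hχψ, hψχ⟩ := hψ.exists_inverse
  rw [hψ₀] at hχ₀ hχ hψχ
  exact ⟨hψ₀, hψ.smoothAt, χ, hχ₀, hχ.smoothAt, hχψ, hψχ⟩

theorem isLocalDiffeoAt_bundleMap {φ : E → E} {M : E → F →L[𝕂] F} (hφ : IsLocalDiffeoAt 𝕂 r φ 0)
    (hM : SmoothAt 𝕂 r M 0) (hMinv : (M 0).IsInvertible) :
    IsLocalDiffeoAt 𝕂 r (fun z : E × F => (φ z.1, M z.1 z.2)) 0 := by
  have hM' : SmoothAt 𝕂 r (fun z : E × F => M z.1) 0 := SmoothAt.comp (f := Prod.fst) 0 hM .fst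
  refine ⟨.prodMk (SmoothAt.comp (f := Prod.fst) 0 hφ.smoothAt .fst) (hM'.clm_apply .snd), ?_⟩
  have hderiv : HasFDerivAt (fun z : E × F => (φ z.1, M z.1 z.2))
      ((fderiv 𝕂 φ 0).prodMap (M 0)) 0 := by
    refine (HasFDerivAt.comp (f := Prod.fst) 0 hφ.smoothAt.hasFDerivAt hasFDerivAt_fst).prodMk ?_
    refine (hM'.hasFDerivAt.clm_apply hasFDerivAt_snd).congr_fderiv ?_
    ext <;> simp
  rw [hderiv.fderiv]
  obtain ⟨A, hA⟩ := hφ.isInvertible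
  obtain ⟨B, hB⟩ := hMinv
  exact ⟨A.prodCongr B, by rw [← hA, ← hB]; rfl⟩

theorem ContactEquivalent.equivalent {p q : ℕ} {V : Set (Fin p → 𝕂)} {f g : Tuple 𝕂 r p q}
    {H G : (Fin p → 𝕂) → (Fin q → 𝕂)} (hH : Represents H f) (hG : Represents G g)
    (hHG : ContactEquivalent 𝕂 r V H G) : Equivalent V f g := by
  obtain ⟨φ, M, hφ₀, hφ, hM, hMinv, hfg, hφV⟩ := hHG
  have hfst : Tendsto (Prod.fst : (Fin p → 𝕂) × (Fin q → 𝕂) → _) (𝓝 0) (𝓝 0) :=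
    continuous_fst.tendsto 0
  have hinj : ∀ᶠ z : (Fin p → 𝕂) × (Fin q → 𝕂) in 𝓝 0, Function.Injective (M z.1) :=
    hfst.eventually ((eventually_isInvertible hM.continuousAt hMinv).mono fun x hx => hx.injective)
  refine ⟨H, G, hH, hG, fun z => (φ z.1, M z.1 z.2), φ,
    (isLocalDiffeoAt_bundleMap hφ hM hMinv).isDiffeoGerm (by simp [hφ₀]), hφ.isDiffeoGerm hφ₀,
    .of_forall fun _ => rfl, ?_, ?_, hφV.mono fun x hx => hx.symm⟩
  · filter_upwards [hinj] with z hz using (map_eq_zero_iff _ hz).symm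
  · filter_upwards [hinj, hfst.eventually hfg] with z hz hzfg
    simp only [hzfg, hz.eq_iff]

end Contact

/-! ### Integrating an infinitesimal equivalence -/

section InfinitesimalEquivalence

section Curves

variable {𝕂 : Type*} [RCLike 𝕂] {E F : Type*} [NormedAddCommGroup E] [NormedSpace ℝ E]
  {s : Set ℝ} {γ : ℝ → 𝕂 × E} {η : 𝕂 × E → E}

theorem hasDerivAt_add_ofReal (t₀ : 𝕂) (t : ℝ) : HasDerivAt (fun t : ℝ => t₀ + (t : 𝕂)) 1 t := by
  simpa using (RCLike.ofRealCLM (K := 𝕂)).hasDerivAt.const_add t₀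

theorem fst_eq_add_of_hasDerivAt (hs : IsOpen s) (hs' : IsPreconnected s) (h₀ : 0 ∈ s)
    (hγ : ∀ t ∈ s, HasDerivAt γ (1, η (γ t)) t) {t : ℝ} (ht : t ∈ s) :
    (γ t).1 = (γ 0).1 + t :=
  eqOn_of_hasDerivAt (v := fun _ => (1 : 𝕂)) hs hs' (fun _ _ => contDiffAt_const)
    (fun t ht => (hγ t ht).fst) (fun t _ => hasDerivAt_add_ofReal _ t) h₀ (by simp) ht

theorem snd_eq_zero_of_hasDerivAt (hs : IsOpen s) (hs' : IsPreconnected s) (h₀ : 0 ∈ s)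
    (hη : ∀ t ∈ s, ContDiffAt ℝ 1 η (γ t)) (hγ : ∀ t ∈ s, HasDerivAt γ (1, η (γ t)) t)
    (hγ₀ : (γ 0).2 = 0) (hη₀ : ∀ t ∈ s, η ((γ 0).1 + t, 0) = 0) {t : ℝ} (ht : t ∈ s) :
    (γ t).2 = 0 := by
  have hEq := eqOn_of_hasDerivAt (v := fun z => ((1 : 𝕂), η z)) hs hs'
    (γ' := fun t : ℝ => ((γ 0).1 + (t : 𝕂), (0 : E)))
    (fun t ht => contDiffAt_const.prodMk (hη t ht)) hγ
    (fun t ht => by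
      rw [hη₀ t ht]
      exact (hasDerivAt_add_ofReal _ t).prodMk (hasDerivAt_const t 0))
    h₀ (Prod.ext (by simp) hγ₀) ht
  rw [hEq]

variable [NormedSpace 𝕂 E] [IsScalarTower ℝ 𝕂 E] [NormedAddCommGroup F] [NormedSpace 𝕂 F]
  [NormedSpace ℝ F] [IsScalarTower ℝ 𝕂 F]

-- Both sides solve the linear equation `y' = B (γ t) y`.
theorem family_eq_clm_apply_of_hasDerivAt
    (hs : IsOpen s) (hs' : IsPreconnected s) (h₀ : 0 ∈ s) {𝓗 : 𝕂 × E → F} {B : 𝕂 × E → F →L[𝕂] F}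
    (hη : ∀ t ∈ s, ContDiffAt 𝕂 1 η (γ t)) (hB : ∀ t ∈ s, ContDiffAt 𝕂 1 B (γ t))
    (h𝓗 : ∀ t ∈ s, DifferentiableAt 𝕂 𝓗 (γ t))
    (heq : ∀ t ∈ s, fderiv 𝕂 𝓗 (γ t) (1, η (γ t)) = B (γ t) (𝓗 (γ t)))
    (hγ : ∀ t ∈ s, HasDerivAt γ (1, η (γ t)) t) {M : ℝ → F →L[𝕂] F} (hM₀ : M 0 = 1)
    (hM : ∀ t ∈ s, HasDerivAt M ((B (γ t)).comp (M t)) t) {t : ℝ} (ht : t ∈ s) :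
    𝓗 (γ t) = M t (𝓗 (γ 0)) := by
  have hfield : ∀ t ∈ s, ∀ y : F, ContDiffAt ℝ 1
      (fun w : (𝕂 × E) × F => (((1 : 𝕂), η w.1), B w.1 w.2)) (γ t, y) := fun t ht y =>
    ((contDiffAt_const.prodMk ((hη t ht).comp (γ t, y) contDiffAt_fst)).prodMk
      (((hB t ht).comp (γ t, y) contDiffAt_fst).clm_apply contDiffAt_snd)).restrict_scalars ℝ
  have hleft : ∀ t ∈ s, HasDerivAt (fun t => 𝓗 (γ t)) (B (γ t) (𝓗 (γ t))) t := fun t ht =>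
    (((h𝓗 t ht).hasFDerivAt.restrictScalars ℝ).comp_hasDerivAt t (hγ t ht)).congr_deriv (heq t ht)
  let evaluation : (F →L[𝕂] F) →L[ℝ] F :=
    (ContinuousLinearMap.apply 𝕂 F (𝓗 (γ 0))).restrictScalars ℝ
  have hright : ∀ t ∈ s,
      HasDerivAt (fun t => M t (𝓗 (γ 0))) (B (γ t) (M t (𝓗 (γ 0)))) t := fun t ht =>
    evaluation.hasFDerivAt.comp_hasDerivAt t (hM t ht)
  exact congrArg Prod.snd (eqOn_of_hasDerivAt hs hs' (fun t ht => hfield t ht _)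
    (fun t ht => (hγ t ht).prodMk (hleft t ht)) (fun t ht => (hγ t ht).prodMk (hright t ht)) h₀
    (by simp [hM₀]) ht)

end Curves

/-- The infinitesimal form, near `(t₀, 0)`, of the statement that all the members of the family
`𝓗 (t, ·)` are contact equivalent relative to `V`: the time-dependent field `η` generates the
coordinate changes, and `B` generates the operators along the fibres. -/
structure IsInfinitesimalEquivalence {𝕂 : Type*} [RCLike 𝕂] {E F : Type*} [NormedAddCommGroup E]
    [NormedSpace 𝕂 E] [NormedSpace ℝ E] [NormedAddCommGroup F] [NormedSpace 𝕂 F] (r : Regularity)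
    (V : Set E) (t₀ : 𝕂) (𝓗 : 𝕂 × E → F) (η : 𝕂 × E → E) (B : 𝕂 × E → F →L[𝕂] F) : Prop where
  smoothAt_family : SmoothAt 𝕂 r 𝓗 (t₀, 0)
  smoothAt_field : SmoothAt 𝕂 r η (t₀, 0)
  smoothAt_operator : SmoothAt 𝕂 r B (t₀, 0)
  field_zero : ∀ᶠ t in 𝓝 t₀, η (t, 0) = 0
  fderiv_apply : ∀ᶠ z in 𝓝 (t₀, 0), fderiv 𝕂 𝓗 z (1, η z) = B z (𝓗 z)
  invariant : ∀ᶠ z in 𝓝 (t₀, 0), Invariant (fun z => (1, η z)) {z : 𝕂 × E | z.2 ∈ V} z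

/-- `z ↦ (γ z, M z)` is the flow, starting from `(t₀, x, 1)` for `x` near `0`, of the field
`(1, η, A ↦ B A)` on the space of times, points and operators. -/
structure IsTrivialization {𝕂 : Type*} [RCLike 𝕂] {E F : Type*} [NormedAddCommGroup E]
    [NormedSpace 𝕂 E] [NormedSpace ℝ E] [NormedAddCommGroup F] [NormedSpace 𝕂 F] [NormedSpace ℝ F]
    [SMulCommClass 𝕂 ℝ F] (r : Regularity) (t₀ : 𝕂) (η : 𝕂 × E → E) (B : 𝕂 × E → F →L[𝕂] F)
    (γ : 𝕂 × E → 𝕂 × E) (M : 𝕂 × E → F →L[𝕂] F) : Prop where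
  smoothAt_curve : SmoothAt 𝕂 r γ (0, 0)
  smoothAt_operator : SmoothAt 𝕂 r M (0, 0)
  curve_zero : ∀ᶠ x in 𝓝 0, γ (0, x) = (t₀, x)
  operator_zero : ∀ᶠ x in 𝓝 0, M (0, x) = 1
  hasDerivAt_curve : ∀ᶠ z : ℝ × E in 𝓝 (0, 0),
    HasDerivAt (fun s : ℝ => γ ((s : 𝕂), z.2)) (1, η (γ ((z.1 : 𝕂), z.2))) z.1
  hasDerivAt_operator : ∀ᶠ z : ℝ × E in 𝓝 (0, 0), HasDerivAt (fun s : ℝ => M ((s : 𝕂), z.2))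
    ((B (γ ((z.1 : 𝕂), z.2))).comp (M ((z.1 : 𝕂), z.2))) z.1

theorem tendsto_ofReal_prodMk (𝕂 : Type*) [RCLike 𝕂] {E : Type*} [TopologicalSpace E] (x : E) :
    Tendsto (fun z : ℝ × E => ((z.1 : 𝕂), z.2)) (𝓝 (0, x)) (𝓝 (0, x)) :=
  ((RCLike.continuous_ofReal.comp continuous_fst).prodMk continuous_snd).tendsto' _ _ (by simp)

universe u

variable {𝕂 : Type u} [RCLike 𝕂] {E F : Type u} [NormedAddCommGroup E] [NormedSpace 𝕂 E]
  [NormedSpace ℝ E] [NormedAddCommGroup F] [NormedSpace 𝕂 F] [NormedSpace ℝ F]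
  {r : Regularity} {V : Set E} {t₀ : 𝕂} {𝓗 : 𝕂 × E → F} {η : 𝕂 × E → E} {B : 𝕂 × E → F →L[𝕂] F}
  {γ : 𝕂 × E → 𝕂 × E} {M : 𝕂 × E → F →L[𝕂] F}

namespace IsTrivialization

variable [SMulCommClass 𝕂 ℝ F]

theorem curve_base (h : IsTrivialization r t₀ η B γ M) : γ (0, 0) = (t₀, 0) :=
  h.curve_zero.self_of_nhds

theorem tendsto_curve (h : IsTrivialization r t₀ η B γ M) :
    Tendsto (fun z : ℝ × E => γ ((z.1 : 𝕂), z.2)) (𝓝 (0, 0)) (𝓝 (t₀, 0)) :=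
  (h.smoothAt_curve.tendsto h.curve_base).comp (tendsto_ofReal_prodMk 𝕂 0)

theorem eventually_fst_curve (h : IsTrivialization r t₀ η B γ M) :
    ∀ᶠ z : ℝ × E in 𝓝 (0, 0), (γ ((z.1 : 𝕂), z.2)).1 = t₀ + z.1 := by
  filter_upwards [eventually_exists_ball h.hasDerivAt_curve,
    (continuous_snd.tendsto ((0 : ℝ), (0 : E))).eventually h.curve_zero] with z ⟨ε, hz, hball⟩ h₀
  have hε : 0 < ε := (norm_nonneg _).trans_lt hz
  rw [fst_eq_add_of_hasDerivAt Metric.isOpen_ball (convex_ball (0 : ℝ) ε).isPreconnected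
    (Metric.mem_ball_self hε) (fun t ht => hball t (mem_ball_zero_iff.1 ht))
    (mem_ball_zero_iff.2 hz)]
  simp [h₀]

theorem eventually_mem_iff (h : IsTrivialization r t₀ η B γ M)
    (hV : ∀ᶠ z in 𝓝 (t₀, 0), Invariant (fun z => (1, η z)) {z : 𝕂 × E | z.2 ∈ V} z) :
    ∀ᶠ z : ℝ × E in 𝓝 (0, 0), ((γ ((z.1 : 𝕂), z.2)).2 ∈ V ↔ z.2 ∈ V) := by
  filter_upwards [eventually_exists_ball (h.hasDerivAt_curve.and (h.tendsto_curve.eventually hV)),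
    (continuous_snd.tendsto ((0 : ℝ), (0 : E))).eventually h.curve_zero] with z ⟨ε, hz, hball⟩ h₀
  have hε : 0 < ε := (norm_nonneg _).trans_lt hz
  have hiff := Invariant.mem_iff Metric.isOpen_ball (convex_ball (0 : ℝ) ε).isPreconnected
    (fun t ht => (hball t (mem_ball_zero_iff.1 ht)).1)
    (fun t ht => (hball t (mem_ball_zero_iff.1 ht)).2) (mem_ball_zero_iff.2 hz)
    (Metric.mem_ball_self hε)
  simpa [h₀] using hiff

theorem eventually_isLocalDiffeoAt [CompleteSpace E] (h : IsTrivialization r t₀ η B γ M) :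
    ∀ᶠ τ : ℝ in 𝓝 0, IsLocalDiffeoAt 𝕂 r (fun x => (γ ((τ : 𝕂), x)).2) 0 := by
  have hline : Tendsto (fun τ : ℝ => ((τ : 𝕂), (0 : E))) (𝓝 0) (𝓝 (0, 0)) :=
    (RCLike.continuous_ofReal.prodMk continuous_const).tendsto' _ _ (by simp)
  exact hline.eventually (eventually_isLocalDiffeoAt_slice
    (SmoothAt.snd.comp _ h.smoothAt_curve) (h.curve_zero.mono fun x hx => congrArg Prod.snd hx))

theorem eventually_smoothAt_operator [CompleteSpace F] (h : IsTrivialization r t₀ η B γ M) :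
    ∀ᶠ τ : ℝ in 𝓝 0, SmoothAt 𝕂 r (fun x => M ((τ : 𝕂), x)) 0 ∧
      (M ((τ : 𝕂), 0)).IsInvertible := by
  have hline : Tendsto (fun τ : ℝ => ((τ : 𝕂), (0 : E))) (𝓝 0) (𝓝 (0, 0)) :=
    (RCLike.continuous_ofReal.prodMk continuous_const).tendsto' _ _ (by simp)
  have hone : M (0, 0) = 1 := h.operator_zero.self_of_nhds
  filter_upwards [hline.eventually h.smoothAt_operator.eventually,
    hline.eventually (eventually_isInvertible h.smoothAt_operator.continuousAt
      (hone ▸ ⟨.refl 𝕂 F, rfl⟩))] with τ hs hi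
  exact ⟨SmoothAt.comp (f := fun x : E => ((τ : 𝕂), x)) 0 hs (.prodMk .const .id), hi⟩

end IsTrivialization

variable [IsScalarTower ℝ 𝕂 E] [IsScalarTower ℝ 𝕂 F]

theorem exists_isTrivialization [CompleteSpace E] [CompleteSpace F]
    (hη : SmoothAt 𝕂 r η (t₀, 0)) (hB : SmoothAt 𝕂 r B (t₀, 0)) :
    ∃ γ M, IsTrivialization r t₀ η B γ M := by
  let w₀ : (𝕂 × E) × (F →L[𝕂] F) := ((t₀, 0), 1)
  have hη' : SmoothAt 𝕂 r (fun w => η w.1) w₀ := SmoothAt.comp (f := Prod.fst) w₀ hη .fst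
  have hB' : SmoothAt 𝕂 r (fun w => B w.1) w₀ := SmoothAt.comp (f := Prod.fst) w₀ hB .fst
  obtain ⟨Φ, hΦ⟩ := exists_isSmoothFlow (X := fun w => ((1, η w.1), (B w.1).comp w.2))
    (SmoothAt.prodMk (.prodMk .const hη') (hB'.clm_comp .snd))
  have hstart : ContDiff 𝕂 r.order fun z : 𝕂 × E => (z.1, (t₀, z.2), (1 : F →L[𝕂] F)) := by
    fun_prop
  have hΦ' : SmoothAt 𝕂 r (fun z : 𝕂 × E => Φ (z.1, (t₀, z.2), 1)) (0, 0) :=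
    SmoothAt.comp (f := fun z : 𝕂 × E => (z.1, (t₀, z.2), (1 : F →L[𝕂] F))) _ hΦ.smoothAt
      (.of_contDiff hstart)
  have hzero := ((by fun_prop : Continuous fun x : E => ((t₀, x), (1 : F →L[𝕂] F))).tendsto
    0).eventually hΦ.apply_zero
  have hderiv := ((by fun_prop : Continuous fun z : ℝ × E =>
    (z.1, (t₀, z.2), (1 : F →L[𝕂] F))).tendsto (0, 0)).eventually hΦ.hasDerivAt
  exact ⟨fun z => (Φ (z.1, (t₀, z.2), 1)).1, fun z => (Φ (z.1, (t₀, z.2), 1)).2,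
    SmoothAt.fst.comp _ hΦ', SmoothAt.snd.comp _ hΦ', hzero.mono fun x hx => congrArg Prod.fst hx,
    hzero.mono fun x hx => congrArg Prod.snd hx, hderiv.mono fun z hz => hz.fst,
    hderiv.mono fun z hz => hz.snd⟩

theorem IsTrivialization.eventually_snd_curve (h : IsTrivialization r t₀ η B γ M)
    (hη : SmoothAt 𝕂 r η (t₀, 0)) (hη₀ : ∀ᶠ t in 𝓝 t₀, η (t, 0) = 0) :
    ∀ᶠ τ : ℝ in 𝓝 0, (γ ((τ : 𝕂), 0)).2 = 0 := by
  have hline : Tendsto (fun τ : ℝ => (τ, (0 : E))) (𝓝 0) (𝓝 (0, 0)) :=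
    (Continuous.prodMk_left 0).tendsto 0
  have htime : Tendsto (fun τ : ℝ => t₀ + (τ : 𝕂)) (𝓝 0) (𝓝 t₀) :=
    (continuous_const.add RCLike.continuous_ofReal).tendsto' _ _ (by simp)
  obtain ⟨ε, hε, hball⟩ := Metric.eventually_nhds_iff_ball.1
    ((hline.eventually (h.hasDerivAt_curve.and (h.tendsto_curve.eventually hη))).and
      (htime.eventually hη₀))
  filter_upwards [Metric.ball_mem_nhds (0 : ℝ) hε] with τ hτ
  refine snd_eq_zero_of_hasDerivAt (γ := fun t : ℝ => γ ((t : 𝕂), 0)) Metric.isOpen_ball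
    (convex_ball (0 : ℝ) ε).isPreconnected (Metric.mem_ball_self hε)
    (fun t ht => ((hball t ht).1.2.restrict_scalars ℝ).of_le r.one_le_order)
    (fun t ht => (hball t ht).1.1) ?_ (fun t ht => ?_) hτ
  · simp [h.curve_base]
  · simpa [h.curve_base] using (hball t ht).2

theorem IsTrivialization.eventually_family_eq (h : IsTrivialization r t₀ η B γ M)
    (h𝓗 : IsInfinitesimalEquivalence r V t₀ 𝓗 η B) :
    ∀ᶠ z : ℝ × E in 𝓝 (0, 0),
      𝓗 (γ ((z.1 : 𝕂), z.2)) = M ((z.1 : 𝕂), z.2) (𝓗 (t₀, z.2)) := by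
  have hsmooth := h.tendsto_curve.eventually (h𝓗.smoothAt_field.and (h𝓗.smoothAt_operator.and
    (h𝓗.smoothAt_family.and h𝓗.fderiv_apply)))
  have hderiv := h.hasDerivAt_curve.and h.hasDerivAt_operator
  filter_upwards [eventually_exists_ball (hsmooth.and hderiv),
    (continuous_snd.tendsto ((0 : ℝ), (0 : E))).eventually (h.curve_zero.and h.operator_zero)]
    with z ⟨ε, hz, hball⟩ ⟨hγ₀, hM₀⟩
  have hε : 0 < ε := (norm_nonneg _).trans_lt hz
  replace hball := fun t ht => hball t (mem_ball_zero_iff.1 ht)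
  rw [family_eq_clm_apply_of_hasDerivAt (γ := fun t : ℝ => γ ((t : 𝕂), z.2))
    (M := fun t : ℝ => M ((t : 𝕂), z.2)) Metric.isOpen_ball
    (convex_ball (0 : ℝ) ε).isPreconnected (Metric.mem_ball_self hε)
    (fun t ht => (hball t ht).1.1.of_le r.one_le_order)
    (fun t ht => (hball t ht).1.2.1.of_le r.one_le_order)
    (fun t ht => (hball t ht).1.2.2.1.differentiableAt r.order_ne_zero)
    (fun t ht => (hball t ht).1.2.2.2) (fun t ht => (hball t ht).2.1) (by simp [hM₀])
    (fun t ht => (hball t ht).2.2) (mem_ball_zero_iff.2 hz)]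
  simp [hγ₀]

theorem IsInfinitesimalEquivalence.eventually_contactEquivalent [CompleteSpace E] [CompleteSpace F]
    (h : IsInfinitesimalEquivalence r V t₀ 𝓗 η B) :
    ∀ᶠ τ : ℝ in 𝓝 0,
      ContactEquivalent 𝕂 r V (fun x => 𝓗 (t₀, x)) (fun x => 𝓗 (t₀ + τ, x)) := by
  obtain ⟨γ, M, hγ⟩ := exists_isTrivialization h.smoothAt_field h.smoothAt_operator
  have hslices := (hγ.eventually_fst_curve.and
    ((hγ.eventually_family_eq h).and (hγ.eventually_mem_iff h.invariant))).curry_nhds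
  filter_upwards [hslices, hγ.eventually_snd_curve h.smoothAt_field h.field_zero,
    hγ.eventually_isLocalDiffeoAt, hγ.eventually_smoothAt_operator] with τ hτ hzero hdiffeo hM
  refine ⟨_, _, hzero, hdiffeo, hM.1, hM.2, ?_, hτ.mono fun x hx => hx.2.2⟩
  filter_upwards [hτ] with x hx
  rw [← hx.2.1, ← hx.1]

end InfinitesimalEquivalence

/-! ### Fields preserving a set -/

section Fields

section Invariant

variable {𝕂 : Type*} [RCLike 𝕂] {E : Type*} [NormedAddCommGroup E] [NormedSpace ℝ E] {X Y : E → E}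
  {V : Set E}

theorem Invariant.congr {x : E} (h : Invariant X V x) (hXY : X =ᶠ[𝓝 x] Y) : Invariant Y V x := by
  intro c hc₀ hc
  have hcx : Tendsto c (𝓝 0) (𝓝 x) := hc₀ ▸ hc.self_of_nhds.continuousAt
  refine h c hc₀ ?_
  filter_upwards [hc, hcx.eventually hXY] with s hs hXYs
  rwa [hXYs]

theorem Invariant.prod {z : 𝕂 × E} (h : Invariant X V z.2) :
    Invariant (fun z : 𝕂 × E => (0, X z.2)) {z | z.2 ∈ V} z := fun c hc₀ hc =>
  h (fun s => (c s).2) (by rw [hc₀]) (hc.mono fun _ hs => hs.snd)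

theorem invariant_time (z : 𝕂 × E) : Invariant (fun _ : 𝕂 × E => (1, 0)) {z | z.2 ∈ V} z := by
  intro c hc₀ hc
  have hconst : (fun s => (c s).2) =ᶠ[𝓝 0] fun _ => z.2 :=
    eventuallyEq_of_hasDerivAt (v := fun _ : E => (0 : E)) contDiffAt_const
      (hc.mono fun s hs => hs.snd) (.of_forall fun s => hasDerivAt_const s z.2) (by rw [hc₀])
  filter_upwards [hconst] with s hs
  rw [hs]

theorem eventually_invariant_suspension [NormedSpace 𝕂 E] [IsScalarTower ℝ 𝕂 E]
    [FiniteDimensional ℝ E] {r : Regularity} {ι : Type*} [Fintype ι] {X : ι → E → E}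
    {a : ι → 𝕂 × E → 𝕂} {t₀ : 𝕂} (hX : ∀ i, SmoothAt 𝕂 r (X i) 0)
    (hV : ∀ i, ∀ᶠ x in 𝓝 0, ∀ u : 𝕂, Invariant (fun x => u • X i x) V x)
    (ha : ∀ i, SmoothAt 𝕂 r (a i) (t₀, 0)) :
    ∀ᶠ z in 𝓝 (t₀, 0),
      Invariant (fun z => (1, ∑ i, a i z • X i z.2)) {z : 𝕂 × E | z.2 ∈ V} z := by
  have hsnd : Tendsto (fun z : 𝕂 × E => z.2) (𝓝 (t₀, 0)) (𝓝 0) := continuous_snd.tendsto _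
  have hXV := eventually_all.2 fun i => hsnd.eventually ((hX i).eventually.and (hV i))
  filter_upwards [hXV.eventually_nhds, eventually_all.2 fun i => (ha i).eventually] with z hz haz
  have hXz (w : 𝕂 × E) (hw : ∀ i, SmoothAt 𝕂 r (X i) w.2) (i : ι) :
      SmoothAt 𝕂 r (fun z : 𝕂 × E => X i z.2) w :=
    SmoothAt.comp (f := Prod.snd) w (hw i) .snd
  let Y : Option (ι × 𝕂) → 𝕂 × E → 𝕂 × E
    | none => fun _ => (1, 0)
    | some (i, u) => fun z => (0, u • X i z.2)
  refine invariant_of_mem_span (X := Y) ?_ ?_ (.of_forall fun w => ?_)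
  · filter_upwards [hz] with w hw
    rintro (_ | ⟨i, u⟩)
    · exact ⟨contDiffAt_const, invariant_time w⟩
    · exact ⟨(SmoothAt.prodMk (.const (c := (0 : 𝕂)))
        (.smul .const (hXz w (fun i => (hw i).1) i))).restrictScalars.contDiffAt, ((hw i).2 u).prod⟩
  · exact (SmoothAt.prodMk .const (.sum fun i =>
      (haz i).smul (hXz z (fun i => (hz.self_of_nhds i).1) i))).restrictScalars
  · have hsum : ((1 : 𝕂), ∑ i, a i w • X i w.2) = Y none w + ∑ i, Y (some (i, a i w)) w := by
      ext <;> simp [Y, Prod.fst_sum, Prod.snd_sum]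
    rw [hsum]
    exact add_mem (Submodule.subset_span ⟨none, rfl⟩)
      (sum_mem fun i _ => Submodule.subset_span ⟨some (i, a i w), rfl⟩)

end Invariant

section FlowDerivative

variable {𝕂 : Type*} [RCLike 𝕂] {r : Regularity} {E : Type*} [NormedAddCommGroup E]
  [NormedSpace 𝕂 E] [NormedSpace ℝ E] [IsScalarTower ℝ 𝕂 E] {X : E → E} {x₀ : E} {Ψ : 𝕂 × E → E}

theorem hasDerivAt_comp_ofReal {f : 𝕂 → E} {f' : E} {s : ℝ} (h : HasDerivAt f f' (s : 𝕂)) :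
    HasDerivAt (fun s : ℝ => f s) f' s := by
  simpa [Function.comp_def] using h.scomp s (RCLike.ofRealCLM (K := 𝕂)).hasDerivAt

namespace IsSmoothFlow

theorem eventually_eq (hΨ : IsSmoothFlow r X x₀ Ψ) (hX : SmoothAt 𝕂 r X x₀) {Φ : 𝕂 → E → E}
    (hΦ : ∀ᶠ z : 𝕂 × E in 𝓝 (0, x₀),
      Φ 0 z.2 = z.2 ∧ HasDerivAt (fun s => Φ s z.2) (X (Φ z.1 z.2)) z.1) :
    ∀ᶠ z : ℝ × E in 𝓝 (0, x₀), Ψ ((z.1 : 𝕂), z.2) = Φ z.1 z.2 := by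
  have hcast := tendsto_ofReal_prodMk 𝕂 x₀
  filter_upwards [eventually_exists_ball ((hΨ.hasDerivAt.and
    (hcast.eventually (hΨ.tendsto.eventually hX))).and (hcast.eventually hΦ)),
    (continuous_snd.tendsto ((0 : ℝ), x₀)).eventually hΨ.apply_zero] with z ⟨ε, hz, hball⟩ h₀
  have hε : 0 < ε := (norm_nonneg _).trans_lt hz
  refine eqOn_of_hasDerivAt (v := X) (γ := fun s : ℝ => Ψ ((s : 𝕂), z.2))
    (γ' := fun s : ℝ => Φ s z.2) Metric.isOpen_ball (convex_ball (0 : ℝ) ε).isPreconnected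
    (fun s hs => ?_) (fun s hs => ?_) (fun s hs => ?_) (Metric.mem_ball_self hε) ?_
    (mem_ball_zero_iff.2 hz)
  · exact ((hball s (mem_ball_zero_iff.1 hs)).1.2.restrict_scalars ℝ).of_le r.one_le_order
  · exact (hball s (mem_ball_zero_iff.1 hs)).1.1
  · exact hasDerivAt_comp_ofReal (hball s (mem_ball_zero_iff.1 hs)).2.2
  · have hΦ₀ := (hball 0 (by simpa using hε)).2.1
    simp only [RCLike.ofReal_zero]
    rw [h₀, hΦ₀]

theorem eventually_fderiv_apply_inl (hΨ : IsSmoothFlow r X x₀ Ψ) :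
    ∀ᶠ x in 𝓝 x₀, fderiv 𝕂 Ψ (0, x) (1, 0) = X x := by
  have hderiv := ((Continuous.prodMk_right (0 : ℝ)).tendsto x₀).eventually hΨ.hasDerivAt
  have hsmooth := ((Continuous.prodMk_right (0 : 𝕂)).tendsto x₀).eventually
    hΨ.smoothAt.eventually
  filter_upwards [hderiv, hsmooth, hΨ.apply_zero] with x hX hs h₀
  simp only [RCLike.ofReal_zero, h₀] at hX
  have hline : HasDerivAt (fun t : 𝕂 => Ψ (t, x)) (fderiv 𝕂 Ψ (0, x) (1, 0)) ((0 : ℝ) : 𝕂) := by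
    rw [RCLike.ofReal_zero]
    exact hs.hasFDerivAt.comp_hasDerivAt (0 : 𝕂) ((hasDerivAt_id 0).prodMk (hasDerivAt_const _ x))
  exact (hasDerivAt_comp_ofReal hline).unique hX

-- The mixed second derivative of the flow is computed in both orders.
theorem fderiv_eq_zero (hΨ : IsSmoothFlow r X x₀ Ψ)
    (h : ∀ᶠ s : ℝ in 𝓝 0, HasFDerivAt (fun x => Ψ ((s : 𝕂), x)) (.id 𝕂 E) x₀) :
    fderiv 𝕂 X x₀ = 0 := by
  have hD : HasFDerivAt (fderiv 𝕂 Ψ) (fderiv 𝕂 (fderiv 𝕂 Ψ) (0, x₀)) (0, x₀) :=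
    hΨ.smoothAt.fderiv.hasFDerivAt
  have hsymm := hΨ.smoothAt.contDiffAt.isSymmSndFDerivAt (by simpa using r.coe_le_order 2)
  have hslice : ∀ᶠ s : ℝ in 𝓝 0, ∀ v, fderiv 𝕂 Ψ ((s : 𝕂), x₀) (0, v) = v := by
    have hline : Tendsto (fun s : ℝ => ((s : 𝕂), x₀)) (𝓝 0) (𝓝 (0, x₀)) :=
      (RCLike.continuous_ofReal.prodMk continuous_const).tendsto' _ _ (by simp)
    filter_upwards [h, hline.eventually hΨ.smoothAt.eventually] with s hs hΨs v
    have hcomp := hΨs.hasFDerivAt.comp x₀ (hasFDerivAt_prodMk_right (s : 𝕂) x₀)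
    exact DFunLike.congr_fun (hcomp.unique hs) v
  ext v
  have htime : fderiv 𝕂 (fderiv 𝕂 Ψ) (0, x₀) (1, 0) (0, v) = 0 := by
    have hline : HasDerivAt (fun t : 𝕂 => fderiv 𝕂 Ψ (t, x₀) (0, v))
        (fderiv 𝕂 (fderiv 𝕂 Ψ) (0, x₀) (1, 0) (0, v)) ((0 : ℝ) : 𝕂) := by
      rw [RCLike.ofReal_zero]
      have hcurve := hD.comp_hasDerivAt (0 : 𝕂)
        ((hasDerivAt_id (0 : 𝕂)).prodMk (hasDerivAt_const (0 : 𝕂) x₀))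
      exact (ContinuousLinearMap.apply 𝕂 E ((0 : 𝕂), v)).hasFDerivAt.comp_hasDerivAt 0 hcurve
    exact (hasDerivAt_comp_ofReal hline).unique
      ((hasDerivAt_const (0 : ℝ) v).congr_of_eventuallyEq (hslice.mono fun s hs => hs v))
  have hspace : fderiv 𝕂 X x₀ v = fderiv 𝕂 (fderiv 𝕂 Ψ) (0, x₀) (0, v) (1, 0) := by
    have hX : HasFDerivAt X _ x₀ := ((ContinuousLinearMap.apply 𝕂 E
      ((1 : 𝕂), (0 : E))).hasFDerivAt.comp x₀ (hD.comp x₀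
        (hasFDerivAt_prodMk_right (0 : 𝕂) x₀))).congr_of_eventuallyEq
          (hΨ.eventually_fderiv_apply_inl.mono fun _ hx => hx.symm)
    rw [hX.fderiv]
    rfl
  rw [hspace, hsymm, htime]
  rfl

end IsSmoothFlow

end FlowDerivative

section Represents

variable {𝕂 : Type*} [RCLike 𝕂] {r : Regularity} {p q : ℕ}

namespace Represents

variable {F G : (Fin p → 𝕂) → (Fin q → 𝕂)} {f : Tuple 𝕂 r p q}

theorem smoothAt (h : Represents F f) : SmoothAt 𝕂 r F 0 := .pi fun i => by
  obtain ⟨G, hG, hfG⟩ := (f i).2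
  exact SmoothAt.congr hG (Germ.coe_eq.1 ((h i).symm.trans hfG))

theorem eventuallyEq (hF : Represents F f) (hG : Represents G f) : F =ᶠ[𝓝 0] G := by
  have hFG (i : Fin q) : (fun x => F x i) =ᶠ[𝓝 0] fun x => G x i :=
    Germ.coe_eq.1 ((hF i).symm.trans (hG i))
  filter_upwards [eventually_all.2 hFG] with x hx using funext hx

end Represents

theorem exists_represents (f : Tuple 𝕂 r p q) :
    ∃ F : (Fin p → 𝕂) → (Fin q → 𝕂), Represents F f := by
  choose G _ hfG using fun i => (f i).2
  exact ⟨fun x i => G i x, hfG⟩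

end Represents

section Theta

universe u

variable {𝕂 : Type u} [RCLike 𝕂] {r : Regularity} {p : ℕ} {V : Set (Fin p → 𝕂)}
  {ξ : Tuple 𝕂 r p p} {X : (Fin p → 𝕂) → (Fin p → 𝕂)}

theorem eventually_invariant_smul_of_mem_Theta (hξ : ξ ∈ Theta r V) (hX : Represents X ξ) :
    ∀ᶠ x in 𝓝 0, ∀ u : 𝕂, Invariant (fun x => u • X x) V x := by
  obtain ⟨Φ, ⟨Y, hY, hΦ⟩, hΦV⟩ := hξ
  have hslice : ∀ᶠ x in 𝓝 (0 : Fin p → 𝕂), ∀ᶠ t in 𝓝 (0 : 𝕂),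
      (Φ 0 x = x ∧ HasDerivAt (fun s => Φ s x) (Y (Φ t x)) t) ∧ (Φ t x ∈ V ↔ x ∈ V) :=
    ((continuous_swap.tendsto ((0 : Fin p → 𝕂), (0 : 𝕂))).eventually (hΦ.and hΦV)).curry_nhds
  filter_upwards [hslice, (hY.eventuallyEq hX).eventually_nhds, hY.smoothAt] with x hΦx hYX hYx u
  have hmul : Tendsto (fun s : ℝ => (s : 𝕂) * u) (𝓝 0) (𝓝 0) :=
    (by fun_prop : Continuous fun s : ℝ => (s : 𝕂) * u).tendsto' _ _ (by simp)
  refine Invariant.congr (X := fun x => u • Y x) (fun c hc₀ hc => ?_)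
    (hYX.mono fun y hy => by simp only [hy])
  have hcΦ : c =ᶠ[𝓝 0] fun s : ℝ => Φ ((s : 𝕂) * u) x := by
    refine eventuallyEq_of_hasDerivAt (v := fun x => u • Y x) ?_ hc ?_
      (by simp [hc₀, hΦx.self_of_nhds.1.1])
    · rw [hc₀]
      exact ((hYx.const_smul u).restrict_scalars ℝ).of_le r.one_le_order
    · filter_upwards [hmul.eventually hΦx] with s hs
      have hline : HasDerivAt (fun s : ℝ => (s : 𝕂) * u) u s := by
        simpa using hasDerivAt_comp_ofReal ((hasDerivAt_id (s : 𝕂)).mul_const u)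
      exact hs.1.2.scomp s hline
  filter_upwards [hcΦ, hmul.eventually hΦx] with s hs hΦs
  rw [hs]
  exact hΦs.2

theorem apply_zero_eq_zero_of_mem_ThetaOne (hξ : ξ ∈ ThetaOne r V) (hX : Represents X ξ) :
    X 0 = 0 := by
  obtain ⟨Φ, ⟨Y, hY, hΦ⟩, -, hΦ₁⟩ := hξ
  obtain ⟨hΦ₀, hderiv⟩ := hΦ.self_of_nhds
  simp only [Prod.fst_zero, Prod.snd_zero] at hΦ₀ hderiv
  rw [hΦ₀] at hderiv
  rw [← (hY.eventuallyEq hX).self_of_nhds]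
  exact hderiv.unique ((hasDerivAt_const (0 : 𝕂) 0).congr_of_eventuallyEq
    (hΦ₁.mono fun t ht => ht.1))

theorem fderiv_eq_zero_of_mem_ThetaOne (hξ : ξ ∈ ThetaOne r V) (hX : Represents X ξ) :
    fderiv 𝕂 X 0 = 0 := by
  obtain ⟨Φ, ⟨Y, hY, hΦ⟩, -, hΦ₁⟩ := hξ
  obtain ⟨Ψ, hΨ⟩ := exists_isSmoothFlow hY.smoothAt
  rw [← (hY.eventuallyEq hX).fderiv_eq]
  refine hΨ.fderiv_eq_zero ?_
  have hofReal : Tendsto (fun s : ℝ => (s : 𝕂)) (𝓝 0) (𝓝 0) :=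
    RCLike.continuous_ofReal.tendsto' _ _ (by simp)
  filter_upwards [(hΨ.eventually_eq hY.smoothAt hΦ).curry_nhds, hofReal.eventually hΦ₁]
    with s hs hΦs
  exact hΦs.2.congr_of_eventuallyEq hs

end Theta

end Fields

/-! ### Linear deformations -/

section Deformation

variable {𝕂 : Type*} [RCLike 𝕂] {ι : Type*} [Fintype ι]

/-- The operator whose matrix has the columns `v`; the columns may lie in any normed space. -/
def columnMap {M : Type*} [NormedAddCommGroup M] [NormedSpace 𝕂 M] (v : ι → M) : (ι → 𝕂) →L[𝕂] M :=
  ∑ a, (ContinuousLinearMap.proj a).smulRight (v a)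

section ColumnMap

variable {M : Type*} [NormedAddCommGroup M] [NormedSpace 𝕂 M]

theorem columnMap_apply (v : ι → M) (y : ι → 𝕂) : columnMap v y = ∑ a, y a • v a := by
  simp [columnMap]

theorem columnMap_zero : columnMap (fun _ => 0 : ι → M) = (0 : (ι → 𝕂) →L[𝕂] M) := by
  simp [columnMap]

theorem columnMap_add (v w : ι → M) :
    columnMap (𝕂 := 𝕂) v + columnMap w = columnMap fun a => v a + w a := by
  ext1 y
  simp only [add_apply, columnMap_apply, smul_add, Finset.sum_add_distrib]

theorem comp_columnMap {N : Type*} [NormedAddCommGroup N] [NormedSpace 𝕂 N] (L : M →L[𝕂] N)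
    (v : ι → M) : L.comp (columnMap v) = columnMap fun a => L (v a) := by
  ext1 y
  simp only [ContinuousLinearMap.comp_apply, columnMap_apply, map_sum, map_smul]

theorem SmoothAt.columnMap {r : Regularity} {E : Type*} [NormedAddCommGroup E] [NormedSpace 𝕂 E]
    {v : ι → E → M} {x : E} (hv : ∀ a, SmoothAt 𝕂 r (v a) x) :
    SmoothAt 𝕂 r (fun y => columnMap (𝕂 := 𝕂) fun a => v a y) x :=
  .sum fun a => (hv a).mono fun _ hy => contDiffAt_const.smulRight hy

end ColumnMap

section ContactTangent

variable {E F : Type*} [NormedAddCommGroup E] [NormedSpace 𝕂 E] [NormedAddCommGroup F]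
  [NormedSpace 𝕂 F] {H Δ : E → F} {X : ι → E → E} {W : ι → E → F →L[𝕂] F}

/-- The infinitesimal action on `H`, at `x`, of the combinations of the pairs `(X a, W a)` of a
vector field and a field of operators along the fibres. -/
def contactTangent (H : E → F) (X : ι → E → E) (W : ι → E → F →L[𝕂] F) (x : E) :
    (ι → 𝕂) →L[𝕂] F :=
  columnMap fun a => fderiv 𝕂 H x (X a x) + W a x (H x)

theorem contactTangent_add_smul {x : E} (hH : DifferentiableAt 𝕂 H x)
    (hΔ : DifferentiableAt 𝕂 Δ x) (t : 𝕂) : contactTangent (fun x => H x + t • Δ x) X W x =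
      contactTangent H X W x + t • contactTangent Δ X W x := by
  have hderiv : fderiv 𝕂 (fun x => H x + t • Δ x) x = fderiv 𝕂 H x + t • fderiv 𝕂 Δ x :=
    (hH.hasFDerivAt.add (hΔ.hasFDerivAt.const_smul t)).fderiv
  ext1 y
  simp only [contactTangent, columnMap_apply, hderiv, add_apply,
    smul_apply, map_add, map_smul, Finset.smul_sum, ← Finset.sum_add_distrib]
  refine Finset.sum_congr rfl fun a _ => ?_
  module

theorem fderiv_lineFamily_apply {z : 𝕂 × E} (hH : DifferentiableAt 𝕂 H z.2)
    (hΔ : DifferentiableAt 𝕂 Δ z.2) (v : E) :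
    fderiv 𝕂 (fun z : 𝕂 × E => H z.2 + z.1 • Δ z.2) z (1, v) =
      Δ z.2 + fderiv 𝕂 (fun x => H x + z.1 • Δ x) z.2 v := by
  have hline : HasFDerivAt (fun z : 𝕂 × E => H z.2 + z.1 • Δ z.2) _ z :=
    (hH.hasFDerivAt.comp z (hasFDerivAt_snd (𝕜 := 𝕂) (p := z))).add
      ((hasFDerivAt_fst (𝕜 := 𝕂) (p := z)).smul
        (hΔ.hasFDerivAt.comp z (hasFDerivAt_snd (𝕜 := 𝕂) (p := z))))
  have hslice : HasFDerivAt (fun x => H x + z.1 • Δ x) _ z.2 :=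
    hH.hasFDerivAt.add (hΔ.hasFDerivAt.const_smul z.1)
  simp [hline.fderiv, hslice.fderiv]
  abel

end ContactTangent

theorem SmoothAt.comp_snd {r : Regularity} {D E F : Type*} [NormedAddCommGroup D] [NormedSpace 𝕂 D]
    [NormedAddCommGroup E] [NormedSpace 𝕂 E] [NormedAddCommGroup F] [NormedSpace 𝕂 F] {f : E → F}
    {x : E} {y : D} (hf : SmoothAt 𝕂 r f x) : SmoothAt 𝕂 r (fun z : D × E => f z.2) (y, x) :=
  SmoothAt.comp (f := Prod.snd) (y, x) hf .snd

theorem exists_smoothAt_solution {r : Regularity} {E L : Type*} [NormedAddCommGroup E]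
    [NormedSpace 𝕂 E] [NormedAddCommGroup L] [NormedSpace 𝕂 L] [CompleteSpace L] {K : E → L →L[𝕂] L}
    {d : E → L} {x : E} (hK : SmoothAt 𝕂 r K x) (hKx : K x = 0) (hd : SmoothAt 𝕂 r d x) :
    ∃ α : E → L, SmoothAt 𝕂 r α x ∧ ∀ᶠ y in 𝓝 x, α y - K y (α y) = d y := by
  have hT : SmoothAt 𝕂 r (fun y => ContinuousLinearMap.id 𝕂 L - K y) x :=
    SmoothAt.sub .const hK
  have hTx : (ContinuousLinearMap.id 𝕂 L - K x).IsInvertible := by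
    rw [hKx, sub_zero]
    exact ContinuousLinearMap.isInvertible_equiv (f := .refl 𝕂 L)
  refine ⟨fun y => (ContinuousLinearMap.id 𝕂 L - K y).inverse (d y),
    (hT.clm_inverse hTx).clm_apply hd, ?_⟩
  filter_upwards [eventually_isInvertible hT.continuousAt hTx] with y hy
  exact hy.self_apply_inverse (d y)

universe u

variable {𝕂 : Type u} [RCLike 𝕂] {E F : Type u} [NormedAddCommGroup E] [NormedSpace 𝕂 E]
  [NormedSpace ℝ E] [IsScalarTower ℝ 𝕂 E] [FiniteDimensional ℝ E] [NormedAddCommGroup F]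
  [NormedSpace 𝕂 F] {r : Regularity} {V : Set E} {H Δ : E → F}

theorem isInfinitesimalEquivalence_lineFamily {X : ι → E → E} {W : ι → E → F →L[𝕂] F} {t₀ : 𝕂}
    {α : 𝕂 × E → ι → 𝕂} (hH : SmoothAt 𝕂 r H 0) (hΔ : SmoothAt 𝕂 r Δ 0)
    (hX : ∀ a, SmoothAt 𝕂 r (X a) 0) (hX₀ : ∀ a, X a 0 = 0)
    (hV : ∀ a, ∀ᶠ x in 𝓝 0, ∀ u : 𝕂, Invariant (fun x => u • X a x) V x)
    (hW : ∀ a, SmoothAt 𝕂 r (W a) 0) (hα : SmoothAt 𝕂 r α (t₀, 0))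
    (hαΔ : ∀ᶠ z in 𝓝 (t₀, 0),
      contactTangent (fun x => H x + z.1 • Δ x) X W z.2 (α z) = Δ z.2) :
    IsInfinitesimalEquivalence r V t₀ (fun z => H z.2 + z.1 • Δ z.2)
      (fun z => ∑ a, (-α z a) • X a z.2) (fun z => ∑ a, α z a • W a z.2) := by
  have hα' (a : ι) : SmoothAt 𝕂 r (fun z => α z a) (t₀, 0) :=
    hα.mono fun z hz => contDiffAt_pi.1 hz a
  have hneg (a : ι) : SmoothAt 𝕂 r (fun z => -α z a) (t₀, 0) := (hα' a).mono fun _ hz => hz.neg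
  refine ⟨hH.comp_snd.add (.smul .fst hΔ.comp_snd), .sum fun a => (hneg a).smul (hX a).comp_snd,
    .sum fun a => (hα' a).smul (hW a).comp_snd, .of_forall fun t => by simp [hX₀], ?_,
    eventually_invariant_suspension hX hV hneg⟩
  have hsnd : Tendsto (fun z : 𝕂 × E => z.2) (𝓝 (t₀, 0)) (𝓝 0) := continuous_snd.tendsto _
  filter_upwards [hαΔ, hsnd.eventually hH.eventually, hsnd.eventually hΔ.eventually]
    with z hz hHz hΔz
  rw [fderiv_lineFamily_apply hHz.differentiableAt hΔz.differentiableAt]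
  refine (congrArg (· + _) hz.symm).trans ?_
  simp [contactTangent, columnMap_apply, Finset.sum_add_distrib, smul_add]

variable [NormedSpace ℝ F] [IsScalarTower ℝ 𝕂 F] [CompleteSpace F]

/-- If the generators `e` are, up to terms of higher order, tangent to the contact orbit of `H`
(with error coefficients `C₀`), and the action on the generators moves `Δ = ∑ d e` only to higher
order (with coefficients `C₁`), then inverting `1 - C₀ + t C₁` makes `Δ` tangent to the orbit of
every `H + t Δ`. -/
theorem contactEquivalent_add {e : E → (ι → 𝕂) →L[𝕂] F} {X : ι → E → E} {W : ι → E → F →L[𝕂] F}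
    {C₀ C₁ : E → (ι → 𝕂) →L[𝕂] (ι → 𝕂)} {d : E → ι → 𝕂} (hH : SmoothAt 𝕂 r H 0)
    (hΔ : SmoothAt 𝕂 r Δ 0) (hX : ∀ a, SmoothAt 𝕂 r (X a) 0) (hX₀ : ∀ a, X a 0 = 0)
    (hV : ∀ a, ∀ᶠ x in 𝓝 0, ∀ u : 𝕂, Invariant (fun x => u • X a x) V x)
    (hW : ∀ a, SmoothAt 𝕂 r (W a) 0) (hC₀ : SmoothAt 𝕂 r C₀ 0) (hC₀_zero : C₀ 0 = 0)
    (hC₁ : SmoothAt 𝕂 r C₁ 0) (hC₁_zero : C₁ 0 = 0) (hd : SmoothAt 𝕂 r d 0)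
    (he : ∀ᶠ x in 𝓝 0, e x = contactTangent H X W x + (e x).comp (C₀ x))
    (heΔ : ∀ᶠ x in 𝓝 0, contactTangent Δ X W x = (e x).comp (C₁ x))
    (hΔd : ∀ᶠ x in 𝓝 0, Δ x = e x (d x)) :
    ContactEquivalent 𝕂 r V H (fun x => H x + Δ x) := by
  have : CompleteSpace E := FiniteDimensional.complete ℝ E
  suffices h : ContactEquivalent 𝕂 r V (fun x => H x + ((0 : ℝ) : 𝕂) • Δ x)
      (fun x => H x + ((1 : ℝ) : 𝕂) • Δ x) by simpa using h
  refine ContactEquivalent.of_locally (H := fun (t : ℝ) x => H x + (t : 𝕂) • Δ x) zero_le_one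
    fun t _ => ?_
  have hsnd : Tendsto (fun z : 𝕂 × E => z.2) (𝓝 ((t : 𝕂), 0)) (𝓝 0) := continuous_snd.tendsto _
  have hK : SmoothAt 𝕂 r (fun z : 𝕂 × E => C₀ z.2 - z.1 • C₁ z.2) ((t : 𝕂), 0) :=
    hC₀.comp_snd.sub (.smul .fst hC₁.comp_snd)
  obtain ⟨α, hα, hαd⟩ := exists_smoothAt_solution hK (by simp [hC₀_zero, hC₁_zero]) hd.comp_snd
  have hαΔ : ∀ᶠ z in 𝓝 ((t : 𝕂), 0),
      contactTangent (fun x => H x + z.1 • Δ x) X W z.2 (α z) = Δ z.2 := by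
    filter_upwards [hαd, hsnd.eventually hH.eventually, hsnd.eventually hΔ.eventually,
      hsnd.eventually (he.and (heΔ.and hΔd))] with z hz hHz hΔz ⟨hez, heΔz, hΔdz⟩
    rw [contactTangent_add_smul hHz.differentiableAt hΔz.differentiableAt, heΔz,
      ← sub_eq_iff_eq_add.2 hez, hΔdz, ← hz]
    simp only [add_apply, sub_apply,
      smul_apply, ContinuousLinearMap.comp_apply, map_sub, map_smul]
    abel
  filter_upwards [(isInfinitesimalEquivalence_lineFamily hH hΔ hX hX₀ hV hW hα
    hαΔ).eventually_contactEquivalent] with τ hτ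
  simpa only [RCLike.ofReal_add] using hτ

theorem contactEquivalent_add_of_eq_sum {e : ι → E → F} {X : ι → E → E} {W : ι → E → F →L[𝕂] F}
    {C₀ C₁ : ι → ι → E → 𝕂} {d : ι → E → 𝕂} (hH : SmoothAt 𝕂 r H 0) (hΔ : SmoothAt 𝕂 r Δ 0)
    (hX : ∀ a, SmoothAt 𝕂 r (X a) 0) (hX₀ : ∀ a, X a 0 = 0)
    (hV : ∀ a, ∀ᶠ x in 𝓝 0, ∀ u : 𝕂, Invariant (fun x => u • X a x) V x)
    (hW : ∀ a, SmoothAt 𝕂 r (W a) 0) (hC₀ : ∀ a b, SmoothAt 𝕂 r (C₀ a b) 0)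
    (hC₀_zero : ∀ a b, C₀ a b 0 = 0) (hC₁ : ∀ a b, SmoothAt 𝕂 r (C₁ a b) 0)
    (hC₁_zero : ∀ a b, C₁ a b 0 = 0) (hd : ∀ a, SmoothAt 𝕂 r (d a) 0)
    (he : ∀ a, e a =ᶠ[𝓝 0] fun x =>
      fderiv 𝕂 H x (X a x) + W a x (H x) + ∑ b, C₀ a b x • e b x)
    (heΔ : ∀ a, (fun x => fderiv 𝕂 Δ x (X a x) + W a x (Δ x)) =ᶠ[𝓝 0] fun x =>
      ∑ b, C₁ a b x • e b x)
    (hΔd : Δ =ᶠ[𝓝 0] fun x => ∑ a, d a x • e a x) :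
    ContactEquivalent 𝕂 r V H (fun x => H x + Δ x) := by
  have hcomp (C : ι → ι → E → 𝕂) (x : E) :
      (columnMap fun a => e a x).comp (columnMap fun a b => C a b x) =
        columnMap (𝕂 := 𝕂) fun a => ∑ b, C a b x • e b x := by
    simp only [comp_columnMap, columnMap_apply]
  refine contactEquivalent_add (e := fun x => columnMap fun a => e a x) (X := X) (W := W)
    (C₀ := fun x => columnMap fun a b => C₀ a b x) (C₁ := fun x => columnMap fun a b => C₁ a b x)
    (d := fun x a => d a x) hH hΔ hX hX₀ hV hW (SmoothAt.columnMap fun a => .pi (hC₀ a))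
    (by simp only [hC₀_zero]; exact columnMap_zero) (SmoothAt.columnMap fun a => .pi (hC₁ a))
    (by simp only [hC₁_zero]; exact columnMap_zero) (.pi hd) ?_ ?_ ?_
  · filter_upwards [eventually_all.2 he] with x hx
    rw [hcomp, contactTangent, columnMap_add]
    exact congrArg columnMap (funext hx)
  · filter_upwards [eventually_all.2 heΔ] with x hx
    rw [hcomp, contactTangent]
    exact congrArg columnMap (funext hx)
  · filter_upwards [hΔd] with x hx
    rw [columnMap_apply, hx]

end Deformation

/-! ### Germs and their representatives -/

section Order

variable {𝕂 : Type*} [RCLike 𝕂]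

theorem isBigO_pow_succ_of_fderiv {E G : Type*} [NormedAddCommGroup E] [NormedSpace 𝕂 E]
    [NormedAddCommGroup G] [NormedSpace 𝕂 G] {F : E → G} {k : ℕ}
    (hF : ∀ᶠ x in 𝓝 0, DifferentiableAt 𝕂 F x) (hF₀ : F 0 = 0)
    (h : fderiv 𝕂 F =O[𝓝 0] fun x => ‖x‖ ^ k) : F =O[𝓝 0] fun x => ‖x‖ ^ (k + 1) := by
  let _ : NormedSpace ℝ E := NormedSpace.restrictScalars ℝ 𝕂 E
  obtain ⟨C, hC, hbound⟩ := h.exists_nonneg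
  obtain ⟨δ, hδ, hball⟩ := Metric.eventually_nhds_iff_ball.1 (hF.and hbound.bound)
  refine Asymptotics.IsBigO.of_bound C ?_
  filter_upwards [Metric.ball_mem_nhds 0 hδ] with x hx
  have hsub {y : E} (hy : y ∈ Metric.closedBall (0 : E) ‖x‖) : y ∈ Metric.ball (0 : E) δ :=
    mem_ball_zero_iff.2 ((mem_closedBall_zero_iff.1 hy).trans_lt (mem_ball_zero_iff.1 hx))
  have hmean := (convex_closedBall (0 : E) ‖x‖).norm_image_sub_le_of_norm_fderiv_le (𝕜 := 𝕂)
    (f := F) (C := C * ‖x‖ ^ k) (fun y hy => (hball y (hsub hy)).1) (fun y hy => ?_)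
    (Metric.mem_closedBall_self (norm_nonneg _)) (mem_closedBall_zero_iff.2 le_rfl)
  · simpa [hF₀, pow_succ, mul_assoc] using hmean
  · refine (hball y (hsub hy)).2.trans ?_
    rw [norm_pow, norm_norm]
    gcongr
    exact mem_closedBall_zero_iff.1 hy

universe u

-- The induction passes from `F` to `fderiv 𝕂 F`, whose codomain must lie in the same universe.
theorem isBigO_of_iteratedFDeriv_eq_zero {E : Type u} [NormedAddCommGroup E] [NormedSpace 𝕂 E]
    (k : ℕ) {G : Type u} [NormedAddCommGroup G] [NormedSpace 𝕂 G] {F : E → G}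
    (hF : ∀ᶠ x in 𝓝 0, ContDiffAt 𝕂 k F x) (h : ∀ i < k, iteratedFDeriv 𝕂 i F 0 = 0) :
    F =O[𝓝 0] fun x => ‖x‖ ^ k := by
  induction k generalizing G with
  | zero => simpa using hF.self_of_nhds.continuousAt.isBigO_one ℝ
  | succ k ih =>
    refine isBigO_pow_succ_of_fderiv (𝕂 := 𝕂) (hF.mono fun x hx => hx.differentiableAt (by simp))
      ?_ (ih (hF.mono fun x hx => hx.fderiv_right (by simp)) fun i hi => ?_)
    · rw [← norm_eq_zero, ← norm_iteratedFDeriv_zero (𝕜 := 𝕂), h 0 k.succ_pos, norm_zero]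
    · rw [← norm_eq_zero, norm_iteratedFDeriv_fderiv, h (i + 1) (Nat.succ_lt_succ hi), norm_zero]

theorem eq_zero_of_homogeneous_of_isBigO {E G : Type*} [NormedAddCommGroup E] [NormedSpace 𝕂 E]
    [NormedAddCommGroup G] [NormedSpace 𝕂 G] {k : ℕ} {P : E → G}
    (hP : ∀ (s : 𝕂) x, P (s • x) = s ^ k • P x) (h : P =O[𝓝 0] fun x => ‖x‖ ^ (k + 1)) (x : E) :
    P x = 0 := by
  have hline : Tendsto (fun s : 𝕂 => s • x) (𝓝[≠] 0) (𝓝 0) :=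
    ((continuous_id.smul continuous_const).tendsto' 0 0 (zero_smul 𝕂 x)).mono_left
      nhdsWithin_le_nhds
  have hinv : (fun s : 𝕂 => (s ^ k)⁻¹) =O[𝓝[≠] 0] fun s => (‖s‖ ^ k)⁻¹ :=
    Asymptotics.IsBigO.of_bound 1 (.of_forall fun s => by simp)
  have hbound : (fun _ : 𝕂 => P x) =O[𝓝[≠] 0] fun s : 𝕂 => ‖s‖ * ‖x‖ ^ (k + 1) := by
    refine (hinv.smul (h.comp_tendsto hline)).congr' ?_ ?_ <;>
      filter_upwards [self_mem_nhdsWithin] with s (hs : s ≠ 0)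
    · simp only [Function.comp_apply, hP]
      rw [inv_smul_smul₀ (pow_ne_zero k hs)]
    · simp only [Function.comp_apply, norm_smul, mul_pow, smul_eq_mul]
      rw [pow_succ ‖s‖, mul_assoc, inv_mul_cancel_left₀ (pow_ne_zero k (norm_ne_zero_iff.2 hs))]
  have hzero : Tendsto (fun s : 𝕂 => ‖s‖ * ‖x‖ ^ (k + 1)) (𝓝[≠] 0) (𝓝 0) :=
    (Continuous.tendsto' (by fun_prop) _ _ (by simp)).mono_left nhdsWithin_le_nhds
  exact tendsto_nhds_unique tendsto_const_nhds (hbound.trans_tendsto hzero)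

end Order

section SumOfSmul

variable {R M ι : Type*} [CommSemiring R] [AddCommMonoid M] [Module R M] [Fintype ι]

theorem mem_smul_span_range_iff {I : Ideal R} {e : ι → M} {x : M} :
    x ∈ I • Submodule.span R (range e) ↔ ∃ c : ι → R, (∀ i, c i ∈ I) ∧ x = ∑ i, c i • e i := by
  rw [Submodule.mem_ideal_smul_span_iff_exists_sum]
  constructor
  · rintro ⟨c, hc, rfl⟩
    exact ⟨c, hc, Finsupp.sum_fintype _ _ fun i => zero_smul R (e i)⟩
  · rintro ⟨c, hc, rfl⟩
    exact ⟨Finsupp.equivFunOnFinite.symm c, hc, Finsupp.sum_fintype _ _ fun i => zero_smul R (e i)⟩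

end SumOfSmul

section Germs

variable {𝕂 : Type*} [RCLike 𝕂] {r : Regularity} {p : ℕ}

namespace SmoothGerm

/-- The germ at the origin of a function that is smooth there. -/
def mk {F : (Fin p → 𝕂) → 𝕂} (hF : SmoothAt 𝕂 r F 0) : SmoothGerm 𝕂 r p :=
  ⟨F, F, hF, rfl⟩

/-- The function `F` represents the germ `f`: the scalar counterpart of `Represents`. -/
def IsRep (f : SmoothGerm 𝕂 r p) (F : (Fin p → 𝕂) → 𝕂) : Prop :=
  f.1 = (F : Germ (𝓝 (0 : Fin p → 𝕂)) 𝕂)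

theorem exists_isRep (f : SmoothGerm 𝕂 r p) : ∃ F, IsRep f F :=
  let ⟨F, _, hF⟩ := f.2
  ⟨F, hF⟩

theorem isRep_mk {F : (Fin p → 𝕂) → 𝕂} (hF : SmoothAt 𝕂 r F 0) : IsRep (mk hF) F := rfl

namespace IsRep

variable {f g : SmoothGerm 𝕂 r p} {F G : (Fin p → 𝕂) → 𝕂}

theorem eventuallyEq (hF : IsRep f F) (hG : IsRep f G) : F =ᶠ[𝓝 0] G :=
  Germ.coe_eq.1 (hF.symm.trans hG)

theorem ext (hF : IsRep f F) (hG : IsRep g G) (h : F =ᶠ[𝓝 0] G) : f = g :=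
  Subtype.ext (hF.trans ((Germ.coe_eq.2 h).trans hG.symm))

theorem congr (hF : IsRep f F) (h : F =ᶠ[𝓝 0] G) : IsRep f G :=
  hF.trans (Germ.coe_eq.2 h)

theorem smoothAt (hF : IsRep f F) : SmoothAt 𝕂 r F 0 := by
  obtain ⟨G, hG, hfG⟩ := f.2
  exact SmoothAt.congr hG (hF.eventuallyEq hfG)

theorem add (hF : IsRep f F) (hG : IsRep g G) : IsRep (f + g) fun x => F x + G x :=
  congrArg₂ (· + ·) hF hG

theorem sub (hF : IsRep f F) (hG : IsRep g G) : IsRep (f - g) fun x => F x - G x :=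
  congrArg₂ (· - ·) hF hG

theorem mul (hF : IsRep f F) (hG : IsRep g G) : IsRep (f * g) fun x => F x * G x :=
  congrArg₂ (· * ·) hF hG

theorem zero : IsRep (0 : SmoothGerm 𝕂 r p) fun _ => 0 := rfl

theorem one : IsRep (1 : SmoothGerm 𝕂 r p) fun _ => 1 := rfl

theorem sum {ι : Type*} (s : Finset ι) {f : ι → SmoothGerm 𝕂 r p} {F : ι → (Fin p → 𝕂) → 𝕂}
    (hF : ∀ i, IsRep (f i) (F i)) : IsRep (∑ i ∈ s, f i) fun x => ∑ i ∈ s, F i x := by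
  induction s using Finset.cons_induction with
  | empty => simpa only [Finset.sum_empty] using zero
  | cons a s ha ih => simpa only [Finset.sum_cons] using (hF a).add ih

theorem prod {ι : Type*} (s : Finset ι) {f : ι → SmoothGerm 𝕂 r p} {F : ι → (Fin p → 𝕂) → 𝕂}
    (hF : ∀ i, IsRep (f i) (F i)) : IsRep (∏ i ∈ s, f i) fun x => ∏ i ∈ s, F i x := by
  induction s using Finset.cons_induction with
  | empty => simpa only [Finset.prod_empty] using one
  | cons a s ha ih => simpa only [Finset.prod_cons] using (hF a).mul ih

theorem pderiv (hF : IsRep f F) (j : Fin p) :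
    IsRep (pderiv j f) fun x => fderiv 𝕂 F x (Pi.single j 1) := by
  obtain ⟨f, hf⟩ := f
  cases hF
  rfl

theorem mem_maxIdeal_iff (hF : IsRep f F) : f ∈ maxIdeal 𝕂 r p ↔ F 0 = 0 := by
  change Germ.value f.1 = 0 ↔ _
  rw [hF]
  rfl

theorem jet_apply (hF : IsRep f F) {l : ℕ} (k : Fin (l + 1)) :
    jet l f k = iteratedFDeriv 𝕂 k F 0 := by
  obtain ⟨f, hf⟩ := f
  cases hF
  rfl

end IsRep

/-- The germ of a constant function. -/
def const (c : 𝕂) : SmoothGerm 𝕂 r p := mk (F := fun _ => c) .const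

/-- The germ of the `j`-th coordinate function. -/
def coord (j : Fin p) : SmoothGerm 𝕂 r p := mk (.of_contDiff (contDiff_apply 𝕂 𝕂 j))

/-- The monomial `∏ i, x (a i)` of degree `k`, encoded by the sequence `a` of its factors; a
monomial has several encodings. -/
def monomial {k : ℕ} (a : Fin k → Fin p) : SmoothGerm 𝕂 r p := ∏ i, coord (a i)

theorem isRep_const (c : 𝕂) : IsRep (const c : SmoothGerm 𝕂 r p) fun _ => c := rfl

theorem isRep_coord (j : Fin p) : IsRep (coord j : SmoothGerm 𝕂 r p) fun x => x j := rfl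

theorem isRep_monomial {k : ℕ} (a : Fin k → Fin p) :
    IsRep (monomial a : SmoothGerm 𝕂 r p) fun x => ∏ i, x (a i) :=
  .prod _ fun i => isRep_coord (a i)

end SmoothGerm

end Germs

/-! ### Powers of the maximal ideal -/

section MaxIdeal

namespace SmoothGerm

section

universe u

variable {𝕂 : Type u} [RCLike 𝕂] {r : Regularity} {p : ℕ}

theorem exists_eq_sum_mul_coord {F : (Fin p → 𝕂) → 𝕂} (hF : SmoothAt 𝕂 r F 0) (hF₀ : F 0 = 0) :
    ∃ g : Fin p → (Fin p → 𝕂) → 𝕂, (∀ j, SmoothAt 𝕂 r (g j) 0) ∧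
      ∀ᶠ x in 𝓝 0, F x = ∑ j, g j x * x j := by
  obtain ⟨g, hg, hFg⟩ := hF.exists_eq_add_apply_self
  refine ⟨fun j x => g x (Pi.single j 1), fun j => hg.clm_apply .const, ?_⟩
  filter_upwards [hFg] with x hx
  rw [hx, hF₀, zero_add]
  simpa [mul_comm] using congrArg (g x) (pi_eq_sum_univ' x)

theorem maxIdeal_eq_span_coord : maxIdeal 𝕂 r p = Ideal.span (range coord) := by
  refine le_antisymm (fun f hf => ?_) (Ideal.span_le.2 ?_)
  · obtain ⟨F, hF⟩ := exists_isRep f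
    obtain ⟨g, hg, hFg⟩ := exists_eq_sum_mul_coord hF.smoothAt (hF.mem_maxIdeal_iff.1 hf)
    exact Ideal.mem_span_range_iff_exists_fun.2 ⟨fun j => mk (hg j),
      .symm (hF.ext (.sum _ fun j => (isRep_mk (hg j)).mul (isRep_coord j)) hFg)⟩
  · rintro _ ⟨j, rfl⟩
    exact (isRep_coord j).mem_maxIdeal_iff.2 rfl

theorem maxIdeal_pow_eq_span_monomial (k : ℕ) :
    maxIdeal 𝕂 r p ^ k = Ideal.span (range fun a : Fin k → Fin p => monomial a) := by
  have hpow : range (coord : Fin p → SmoothGerm 𝕂 r p) ^ k =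
      range fun a : Fin k → Fin p => monomial a := by
    ext f
    rw [Set.mem_pow]
    constructor
    · rintro ⟨g, rfl⟩
      choose a ha using fun i => (g i).2
      exact ⟨a, by simp [monomial, ha, List.prod_ofFn]⟩
    · rintro ⟨a, rfl⟩
      exact ⟨fun i => ⟨coord (a i), a i, rfl⟩, by simp [monomial, List.prod_ofFn]⟩
  rw [maxIdeal_eq_span_coord, ← hpow]
  exact Submodule.span_pow (R := SmoothGerm 𝕂 r p) _ k

theorem mem_maxIdeal_pow_iff {k : ℕ} {f : SmoothGerm 𝕂 r p} : f ∈ maxIdeal 𝕂 r p ^ k ↔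
    ∃ c : (Fin k → Fin p) → SmoothGerm 𝕂 r p, ∑ a, c a * monomial a = f := by
  rw [maxIdeal_pow_eq_span_monomial, Ideal.mem_span_range_iff_exists_fun]

theorem sum_mul_monomial_mem {k : ℕ} {c : (Fin k → Fin p) → SmoothGerm 𝕂 r p}
    (hc : ∀ a, c a ∈ maxIdeal 𝕂 r p) : ∑ a, c a * monomial a ∈ maxIdeal 𝕂 r p ^ (k + 1) := by
  rw [pow_succ', maxIdeal_pow_eq_span_monomial]
  exact sum_mem fun a _ => Ideal.mul_mem_mul (hc a) (Ideal.subset_span ⟨a, rfl⟩)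

end

section Order

variable {𝕂 : Type*} [RCLike 𝕂] {p k : ℕ}

theorem isBigO_prod_apply (a : Fin k → Fin p) :
    (fun x : Fin p → 𝕂 => ∏ i, x (a i)) =O[𝓝 0] fun x => ‖x‖ ^ k := by
  refine Asymptotics.IsBigO.of_bound 1 (.of_forall fun x => ?_)
  rw [norm_prod, one_mul, norm_pow, norm_norm]
  simpa using Finset.prod_le_prod (s := .univ) (fun i _ => norm_nonneg (x (a i)))
    fun i _ => norm_le_pi_norm x (a i)

theorem sum_mul_prod_smul (c : (Fin k → Fin p) → 𝕂) (s : 𝕂) (x : Fin p → 𝕂) :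
    ∑ a, c a * ∏ i, (s • x) (a i) = s ^ k • ∑ a, c a * ∏ i, x (a i) := by
  simp only [Pi.smul_apply, smul_eq_mul, Finset.prod_mul_distrib, Finset.prod_const,
    Finset.card_univ, Fintype.card_fin, Finset.mul_sum, mul_left_comm]

theorem isBigO_norm_pow_succ {E : Type*} [NormedAddCommGroup E] (k : ℕ) :
    (fun x : E => ‖x‖ ^ (k + 1)) =O[𝓝 0] fun x => ‖x‖ ^ k := by
  refine Asymptotics.IsBigO.of_bound 1 ?_
  filter_upwards [Metric.closedBall_mem_nhds 0 one_pos] with x hx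
  rw [one_mul, norm_pow, norm_pow, norm_norm]
  exact pow_le_pow_of_le_one (norm_nonneg _) (mem_closedBall_zero_iff.1 hx) k.le_succ

end Order

universe u

variable {𝕂 : Type u} [RCLike 𝕂] {r : Regularity} {p k : ℕ} {f : SmoothGerm 𝕂 r p}
  {F : (Fin p → 𝕂) → 𝕂}

theorem isBigO_of_mem_maxIdeal_pow (hF : IsRep f F) (h : f ∈ maxIdeal 𝕂 r p ^ k) :
    F =O[𝓝 0] fun x => ‖x‖ ^ k := by
  obtain ⟨c, rfl⟩ := mem_maxIdeal_pow_iff.1 h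
  choose C hC using fun a => exists_isRep (c a)
  refine (hF.eventuallyEq (.sum _ fun a => (hC a).mul (isRep_monomial a))).trans_isBigO
    (.fun_sum fun a _ => ?_)
  simpa using ((hC a).smoothAt.continuousAt.isBigO_one ℝ).mul (isBigO_prod_apply a)

theorem exists_form_add_of_mem_maxIdeal_pow (h : f ∈ maxIdeal 𝕂 r p ^ k) :
    ∃ c : (Fin k → Fin p) → 𝕂, ∃ g ∈ maxIdeal 𝕂 r p ^ (k + 1),
      f = ∑ a, const (c a) * monomial a + g := by
  obtain ⟨c, rfl⟩ := mem_maxIdeal_pow_iff.1 h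
  choose C hC using fun a => exists_isRep (c a)
  refine ⟨fun a => C a 0, ∑ a, (c a - const (C a 0)) * monomial a, sum_mul_monomial_mem fun a =>
    ((hC a).sub (isRep_const (C a 0))).mem_maxIdeal_iff.2 (sub_self _), ?_⟩
  simp only [sub_mul, Finset.sum_sub_distrib, add_sub_cancel]

theorem mem_maxIdeal_pow_of_isBigO (hF : IsRep f F) (h : F =O[𝓝 0] fun x => ‖x‖ ^ k) :
    f ∈ maxIdeal 𝕂 r p ^ k := by
  induction k with
  | zero => simp
  | succ k ih =>
    obtain ⟨c, g, hg, rfl⟩ := exists_form_add_of_mem_maxIdeal_pow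
      (ih (h.trans (isBigO_norm_pow_succ k)))
    obtain ⟨G, hG⟩ := exists_isRep g
    let P : (Fin p → 𝕂) → 𝕂 := fun x => ∑ a, c a * ∏ i, x (a i)
    have hP : IsRep (∑ a, const (c a) * monomial a : SmoothGerm 𝕂 r p) P :=
      .sum _ fun a => (isRep_const (c a)).mul (isRep_monomial a)
    have hPF : P =ᶠ[𝓝 0] fun x => F x - G x :=
      (hF.eventuallyEq (hP.add hG)).mono fun x hx => eq_sub_of_add_eq hx.symm
    have hP₀ : ∀ x, P x = 0 := eq_zero_of_homogeneous_of_isBigO (sum_mul_prod_smul c)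
      (hPF.trans_isBigO (h.sub (isBigO_of_mem_maxIdeal_pow hG hg)))
    rw [hP.ext .zero (.of_forall hP₀), zero_add]
    exact hg

theorem sub_mem_maxIdeal_pow_of_jet_eq {l : ℕ} {g : SmoothGerm 𝕂 r p} (h : jet l g = jet l f) :
    g - f ∈ maxIdeal 𝕂 r p ^ (l + 1) ∧ ∀ j, pderiv j (g - f) ∈ maxIdeal 𝕂 r p ^ l := by
  obtain ⟨F, hF⟩ := exists_isRep f
  obtain ⟨G, hG⟩ := exists_isRep g
  let D : (Fin p → 𝕂) → 𝕂 := G - F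
  have hD : IsRep (g - f) D := hG.sub hF
  have hzero (k : ℕ) (hk : k < l + 1) : iteratedFDeriv 𝕂 k D 0 = 0 := by
    have hjet := congrFun h ⟨k, hk⟩
    rw [hG.jet_apply, hF.jet_apply] at hjet
    rw [iteratedFDeriv_sub_apply (hG.smoothAt.contDiffAt.of_le (r.coe_le_order k))
      (hF.smoothAt.contDiffAt.of_le (r.coe_le_order k))]
    exact sub_eq_zero.2 hjet
  refine ⟨mem_maxIdeal_pow_of_isBigO hD (isBigO_of_iteratedFDeriv_eq_zero (𝕂 := 𝕂) _
    (hD.smoothAt.mono fun x hx => hx.of_le (r.coe_le_order _)) hzero), fun j => ?_⟩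
  have hfderiv : fderiv 𝕂 D =O[𝓝 0] fun x => ‖x‖ ^ l :=
    isBigO_of_iteratedFDeriv_eq_zero (𝕂 := 𝕂) l
      (hD.smoothAt.fderiv.mono fun x hx => hx.of_le (r.coe_le_order _)) fun k hk => by
        rw [← norm_eq_zero, norm_iteratedFDeriv_fderiv, hzero _ (Nat.succ_lt_succ hk), norm_zero]
  have happly := (ContinuousLinearMap.apply 𝕂 𝕂 (Pi.single j 1 : Fin p → 𝕂)).isBigO_comp
    (fderiv 𝕂 D) (𝓝 0)
  exact mem_maxIdeal_pow_of_isBigO (hD.pderiv j) (happly.trans hfderiv)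

theorem mem_maxIdeal_sq_of_mem_ThetaOne {V : Set (Fin p → 𝕂)} {ξ : Tuple 𝕂 r p p}
    (hξ : ξ ∈ ThetaOne r V) (j : Fin p) : ξ j ∈ maxIdeal 𝕂 r p ^ 2 := by
  obtain ⟨X, hX⟩ := exists_represents ξ
  have hXO : X =O[𝓝 0] fun x => ‖x‖ ^ 2 := isBigO_of_iteratedFDeriv_eq_zero (𝕂 := 𝕂) 2
    (hX.smoothAt.mono fun x hx => hx.of_le (r.coe_le_order _)) fun i hi => by
      rw [← norm_eq_zero]
      interval_cases i
      · rw [norm_iteratedFDeriv_zero, apply_zero_eq_zero_of_mem_ThetaOne hξ hX, norm_zero]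
      · rw [norm_iteratedFDeriv_one, fderiv_eq_zero_of_mem_ThetaOne hξ hX, norm_zero]
  exact mem_maxIdeal_pow_of_isBigO (hX j) (Asymptotics.isBigO_pi.1 hXO j)

end SmoothGerm

end MaxIdeal

/-! ### Determinacy -/

section Determinacy

open SmoothGerm

section IdealTheta

variable {𝕂 : Type*} [RCLike 𝕂] {r : Regularity} {p q : ℕ} {I : Ideal (SmoothGerm 𝕂 r p)}

theorem top_eq_span_single :
    (⊤ : Submodule (SmoothGerm 𝕂 r p) (Tuple 𝕂 r p q)) =
      Submodule.span _ (range fun i => Pi.single i 1) := by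
  rw [← (Pi.basisFun (SmoothGerm 𝕂 r p) (Fin q)).span_eq]
  congr
  ext1 i
  exact Pi.basisFun_apply _ _ i

theorem mem_idealTheta_iff {w : Tuple 𝕂 r p q} : w ∈ idealTheta q I ↔ ∀ i, w i ∈ I := by
  rw [idealTheta, top_eq_span_single, mem_smul_span_range_iff]
  constructor
  · rintro ⟨c, hc, rfl⟩ i
    simpa [Finset.sum_apply, Pi.single_apply] using hc i
  · exact fun hw => ⟨w, hw, (pi_eq_sum_univ' w).trans (by simp)⟩

theorem idealTheta_mul (I J : Ideal (SmoothGerm 𝕂 r p)) :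
    idealTheta q (I * J) = I • idealTheta q J :=
  mul_smul I J ⊤

theorem applyField_mem_idealTheta {ξ : Tuple 𝕂 r p p} {f : Tuple 𝕂 r p q} {a b : ℕ}
    (hξ : ∀ j, ξ j ∈ maxIdeal 𝕂 r p ^ a) (hf : ∀ i j, pderiv j (f i) ∈ maxIdeal 𝕂 r p ^ b) :
    applyField ξ f ∈ idealTheta q (maxIdeal 𝕂 r p ^ (a + b)) := by
  refine mem_idealTheta_iff.2 fun i => ?_
  rw [pow_add]
  exact sum_mem fun j _ => Ideal.mul_mem_mul (hξ j) (hf i j)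

end IdealTheta

universe u

variable {𝕂 : Type u} [RCLike 𝕂] {r : Regularity} {p q k : ℕ} {h : Tuple 𝕂 r p q}

/-- The monomial germ `A.1` times the `A.2`-th unit vector; for fixed degree these generate
`𝔪 ^ k θ(h)`. -/
def monomialField (A : (Fin k → Fin p) × Fin q) : Tuple 𝕂 r p q :=
  (monomial A.1 : SmoothGerm 𝕂 r p) • (Pi.single A.2 1 : Tuple 𝕂 r p q)

theorem idealTheta_maxIdeal_pow_eq_span : idealTheta q (maxIdeal 𝕂 r p ^ k) =
    Submodule.span _ (range (monomialField : (Fin k → Fin p) × Fin q → Tuple 𝕂 r p q)) := by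
  rw [idealTheta, maxIdeal_pow_eq_span_monomial, top_eq_span_single, Submodule.span_smul_span]
  congr
  ext w
  simp [monomialField, Set.mem_smul]

theorem Represents.apply_zero {H : (Fin p → 𝕂) → (Fin q → 𝕂)} (hH : Represents H h)
    (h_zero : ∀ i, h i ∈ maxIdeal 𝕂 r p) : H 0 = 0 :=
  funext fun i => (IsRep.mem_maxIdeal_iff (hH i)).1 (h_zero i)

theorem pullbackMax_le_span (h_zero : ∀ i, h i ∈ maxIdeal 𝕂 r p) :
    pullbackMax h ≤ Ideal.span (range h) := by
  refine Ideal.span_le.2 ?_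
  rintro f ⟨φ, hφ, Φ, H, hΦ : IsRep φ Φ, hH, hf⟩
  obtain ⟨g, hg, hΦg⟩ := exists_eq_sum_mul_coord hΦ.smoothAt (hΦ.mem_maxIdeal_iff.1 hφ)
  have hH₀ := hH.apply_zero h_zero
  have hgH (j : Fin q) : SmoothAt 𝕂 r (fun x => g j (H x)) 0 :=
    SmoothAt.comp 0 (hH₀ ▸ hg j) hH.smoothAt
  exact Ideal.mem_span_range_iff_exists_fun.2 ⟨fun j => mk (hgH j),
    (IsRep.sum _ fun j => (isRep_mk (hgH j)).mul (hH j)).ext hf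
      ((hH.smoothAt.tendsto hH₀).eventually (hΦg.mono fun y hy => hy.symm))⟩

theorem exists_eq_sum_smul_of_mem_idealTheta (h_zero : ∀ i, h i ∈ maxIdeal 𝕂 r p)
    {J : Ideal (SmoothGerm 𝕂 r p)} {w : Tuple 𝕂 r p q}
    (hw : w ∈ idealTheta q (J * pullbackMax h)) :
    ∃ W : Fin q → Tuple 𝕂 r p q, (∀ m, W m ∈ idealTheta q J) ∧ w = ∑ m, h m • W m := by
  have hcoord (i : Fin q) : ∃ c : Fin q → SmoothGerm 𝕂 r p, (∀ m, c m ∈ J) ∧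
      w i = ∑ m, c m • h m :=
    mem_smul_span_range_iff.1
      (Ideal.mul_mono_right (pullbackMax_le_span h_zero) (mem_idealTheta_iff.1 hw i))
  choose c hc hwc using hcoord
  refine ⟨fun m i => c i m, fun m => mem_idealTheta_iff.2 fun i => hc i m, funext fun i => ?_⟩
  simp [hwc i, Finset.sum_apply, mul_comm]

/-- The infinitesimal action on `f` of the vector field `ξ` on the source and of the linear vector
field on the fibres whose matrix has the columns `W`. -/
def contactAction (ξ : Tuple 𝕂 r p p) (W : Fin q → Tuple 𝕂 r p q) (f : Tuple 𝕂 r p q) :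
    Tuple 𝕂 r p q :=
  applyField ξ f + ∑ m, f m • W m

namespace Represents

variable {F G : (Fin p → 𝕂) → (Fin q → 𝕂)} {f g : Tuple 𝕂 r p q}

theorem add (hF : Represents F f) (hG : Represents G g) :
    Represents (fun x => F x + G x) (f + g) := fun i => IsRep.add (hF i) (hG i)

theorem sum_smul {ι : Type*} [Fintype ι] {c : ι → SmoothGerm 𝕂 r p} {C : ι → (Fin p → 𝕂) → 𝕂}
    {e : ι → Tuple 𝕂 r p q} {E : ι → (Fin p → 𝕂) → (Fin q → 𝕂)} (hC : ∀ a, IsRep (c a) (C a))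
    (hE : ∀ a, Represents (E a) (e a)) :
    Represents (fun x => ∑ a, C a x • E a x) (∑ a, c a • e a) := by
  intro i
  simp only [Finset.sum_apply]
  exact IsRep.sum _ fun a => (hC a).mul (hE a i)

theorem applyField {X : (Fin p → 𝕂) → (Fin p → 𝕂)} {ξ : Tuple 𝕂 r p p} (hX : Represents X ξ)
    (hF : Represents F f) : Represents (fun x => fderiv 𝕂 F x (X x)) (applyField ξ f) := by
  intro i
  have hsum : IsRep (VK.applyField ξ f i) _ :=
    .sum Finset.univ fun j => (IsRep.mul (hX j) (IsRep.pderiv (hF i) j))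
  refine hsum.congr ?_
  filter_upwards [hF.smoothAt.eventually] with x hx
  rw [(hasFDerivAt_pi'.1 hx.hasFDerivAt i).fderiv]
  simpa using (congrArg (fun v => fderiv 𝕂 F x v i) (pi_eq_sum_univ' (X x))).symm

theorem contactAction {X : (Fin p → 𝕂) → (Fin p → 𝕂)} {ξ : Tuple 𝕂 r p p}
    {W : Fin q → (Fin p → 𝕂) → (Fin q → 𝕂)} {w : Fin q → Tuple 𝕂 r p q} (hX : Represents X ξ)
    (hW : ∀ m, Represents (W m) (w m)) (hF : Represents F f) :
    Represents (fun x => fderiv 𝕂 F x (X x) + columnMap (fun m => W m x) (F x))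
      (contactAction ξ w f) := by
  simp only [columnMap_apply]
  exact (hX.applyField hF).add (sum_smul (fun m => hF m) hW)

end Represents

theorem equivalent_of_contactAction {ι : Type*} [Fintype ι] {V : Set (Fin p → 𝕂)}
    {δ : Tuple 𝕂 r p q} {ξ : ι → Tuple 𝕂 r p p} {W : ι → Fin q → Tuple 𝕂 r p q}
    {e : ι → Tuple 𝕂 r p q} {c₀ c₁ : ι → ι → SmoothGerm 𝕂 r p} {d : ι → SmoothGerm 𝕂 r p}
    (hξ : ∀ a, ξ a ∈ Theta r V) (hξ₀ : ∀ a j, ξ a j ∈ maxIdeal 𝕂 r p)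
    (hc₀ : ∀ a b, c₀ a b ∈ maxIdeal 𝕂 r p) (hc₁ : ∀ a b, c₁ a b ∈ maxIdeal 𝕂 r p)
    (hh : ∀ a, e a = contactAction (ξ a) (W a) h + ∑ b, c₀ a b • e b)
    (hδ : ∀ a, contactAction (ξ a) (W a) δ = ∑ b, c₁ a b • e b) (hd : δ = ∑ a, d a • e a) :
    Equivalent V h (h + δ) := by
  obtain ⟨H, hH⟩ := exists_represents h
  obtain ⟨Δ, hΔ⟩ := exists_represents δ
  choose X hX using fun a => exists_represents (ξ a)
  choose WF hW using fun a m => exists_represents (W a m)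
  choose E hE using fun a => exists_represents (e a)
  choose C₀ hC₀ using fun a b => exists_isRep (c₀ a b)
  choose C₁ hC₁ using fun a b => exists_isRep (c₁ a b)
  choose D hD using fun a => exists_isRep (d a)
  refine (contactEquivalent_add_of_eq_sum (e := E) (X := X)
    (W := fun a x => columnMap fun m => WF a m x) (C₀ := C₀) (C₁ := C₁) (d := D) hH.smoothAt
    hΔ.smoothAt (fun a => (hX a).smoothAt) (fun a => (hX a).apply_zero (hξ₀ a))
    (fun a => eventually_invariant_smul_of_mem_Theta (hξ a) (hX a))
    (fun a => SmoothAt.columnMap fun m => (hW a m).smoothAt)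
    (fun a b => (hC₀ a b).smoothAt) (fun a b => (hC₀ a b).mem_maxIdeal_iff.1 (hc₀ a b))
    (fun a b => (hC₁ a b).smoothAt) (fun a b => (hC₁ a b).mem_maxIdeal_iff.1 (hc₁ a b))
    (fun a => (hD a).smoothAt) (fun a => ?_) (fun a => ?_) ?_).equivalent hH (hH.add hΔ)
  · refine (hE a).eventuallyEq ?_
    rw [hh a]
    exact ((hX a).contactAction (hW a) hH).add (.sum_smul (hC₀ a) hE)
  · refine ((hX a).contactAction (hW a) hΔ).eventuallyEq ?_
    rw [hδ a]
    exact .sum_smul (hC₁ a) hE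
  · refine hΔ.eventuallyEq ?_
    rw [hd]
    exact .sum_smul hD hE

theorem equivalent_of_tangent {V : Set (Fin p → 𝕂)} {J : Ideal (SmoothGerm 𝕂 r p)}
    {Θ : Set (Tuple 𝕂 r p p)} {δ : Tuple 𝕂 r p q} (hΘ : Θ ⊆ Theta r V)
    (hΘ₀ : ∀ ξ ∈ Θ, ∀ j, ξ j ∈ maxIdeal 𝕂 r p) (h_zero : ∀ i, h i ∈ maxIdeal 𝕂 r p)
    (hT : (idealTheta q (maxIdeal 𝕂 r p ^ k) : Set (Tuple 𝕂 r p q)) ⊆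
      ((fun ξ => applyField ξ h) '' Θ + (idealTheta q (J * pullbackMax h) : Set (Tuple 𝕂 r p q))) +
        (idealTheta q (maxIdeal 𝕂 r p ^ (k + 1)) : Set (Tuple 𝕂 r p q)))
    (hδ : δ ∈ idealTheta q (maxIdeal 𝕂 r p ^ k))
    (hδΘ : ∀ ξ ∈ Θ, applyField ξ δ ∈ idealTheta q (maxIdeal 𝕂 r p ^ (k + 1)))
    (hδJ : ∀ i, ∀ w ∈ J, δ i * w ∈ maxIdeal 𝕂 r p ^ (k + 1)) : Equivalent V h (h + δ) := by
  let e : (Fin k → Fin p) × Fin q → Tuple 𝕂 r p q := monomialField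
  have hspan : idealTheta q (maxIdeal 𝕂 r p ^ k) = Submodule.span _ (range e) :=
    idealTheta_maxIdeal_pow_eq_span
  have hsucc {w : Tuple 𝕂 r p q} : w ∈ idealTheta q (maxIdeal 𝕂 r p ^ (k + 1)) ↔
      ∃ c : (Fin k → Fin p) × Fin q → SmoothGerm 𝕂 r p, (∀ b, c b ∈ maxIdeal 𝕂 r p) ∧
        w = ∑ b, c b • e b := by
    rw [pow_succ', idealTheta_mul, hspan, mem_smul_span_range_iff]
  have htangent (a) : ∃ ξ ∈ Θ, ∃ W : Fin q → Tuple 𝕂 r p q, (∀ m, W m ∈ idealTheta q J) ∧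
      ∃ c : (Fin k → Fin p) × Fin q → SmoothGerm 𝕂 r p, (∀ b, c b ∈ maxIdeal 𝕂 r p) ∧
        e a = contactAction ξ W h + ∑ b, c b • e b := by
    have hea : e a ∈ idealTheta q (maxIdeal 𝕂 r p ^ k) := hspan ▸ Submodule.subset_span ⟨a, rfl⟩
    obtain ⟨_, ⟨_, ⟨ξ, hξ, rfl⟩, w, hw, rfl⟩, z, hz, hsum⟩ := hT hea
    obtain ⟨W, hW, rfl⟩ := exists_eq_sum_smul_of_mem_idealTheta h_zero hw
    obtain ⟨c, hc, rfl⟩ := hsucc.1 hz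
    exact ⟨ξ, hξ, W, hW, c, hc, hsum.symm⟩
  choose ξ hξ W hW c₀ hc₀ hh using htangent
  have haction (a) : contactAction (ξ a) (W a) δ ∈ idealTheta q (maxIdeal 𝕂 r p ^ (k + 1)) :=
    add_mem (hδΘ _ (hξ a)) (sum_mem fun m _ => mem_idealTheta_iff.2 fun i =>
      hδJ m _ (mem_idealTheta_iff.1 (hW a m) i))
  choose c₁ hc₁ hδc₁ using fun a => hsucc.1 (haction a)
  obtain ⟨d, hd⟩ := (Submodule.mem_span_range_iff_exists_fun _).1 (hspan ▸ hδ)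
  exact equivalent_of_contactAction (fun a => hΘ (hξ a)) (fun a => hΘ₀ _ (hξ a)) hc₀ hc₁ hh hδc₁
    hd.symm

theorem determined_of_tangentOne {V : Set (Fin p → 𝕂)} {l : ℕ}
    (h_zero : ∀ i, h i ∈ maxIdeal 𝕂 r p)
    (hT : (idealTheta q (maxIdeal 𝕂 r p ^ (l + 1)) : Set (Tuple 𝕂 r p q)) ⊆
      tangentOne V h + (idealTheta q (maxIdeal 𝕂 r p ^ (l + 2)) : Set (Tuple 𝕂 r p q))) :
    Determined V l h := by
  intro g _ hjet
  have hδ (i) := sub_mem_maxIdeal_pow_of_jet_eq (hjet i)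
  have hsq : ∀ ξ ∈ ThetaOne r V, ∀ j, ξ j ∈ maxIdeal 𝕂 r p ^ 2 :=
    fun ξ hξ j => mem_maxIdeal_sq_of_mem_ThetaOne hξ j
  rw [← add_sub_cancel h g]
  refine equivalent_of_tangent (Θ := ThetaOne r V) (fun ξ ⟨Φ, hΦ, hΦV, _⟩ => ⟨Φ, hΦ, hΦV⟩)
    (fun ξ hξ j => Ideal.pow_le_self two_ne_zero (hsq ξ hξ j)) h_zero hT
    (mem_idealTheta_iff.2 fun i => (hδ i).1) (fun ξ hξ => ?_) fun i w hw => ?_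
  · rw [add_assoc, add_comm l]
    exact applyField_mem_idealTheta (hsq ξ hξ) fun i => (hδ i).2
  · exact Ideal.mul_mem_mul (hδ i).1 hw

theorem determined_of_tangentExt {V : Set (Fin p → 𝕂)} {l : ℕ}
    (h_zero : ∀ i, h i ∈ maxIdeal 𝕂 r p)
    (hΘ₀ : ∀ ξ ∈ Theta r V, ∀ j, ξ j ∈ maxIdeal 𝕂 r p)
    (hT : (idealTheta q (maxIdeal 𝕂 r p ^ l) : Set (Tuple 𝕂 r p q)) ⊆
      tangentExt V h + (idealTheta q (maxIdeal 𝕂 r p ^ (l + 1)) : Set (Tuple 𝕂 r p q))) :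
    Determined V l h := by
  intro g _ hjet
  have hδ (i) := sub_mem_maxIdeal_pow_of_jet_eq (hjet i)
  rw [← add_sub_cancel h g]
  refine equivalent_of_tangent (J := ⊤) subset_rfl hΘ₀ h_zero (by rwa [Ideal.top_mul])
    (mem_idealTheta_iff.2 fun i => Ideal.pow_le_pow_right l.le_succ (hδ i).1) (fun ξ hξ => ?_)
    fun i w _ => Ideal.mul_mem_right w _ (hδ i).1
  rw [add_comm l]
  exact applyField_mem_idealTheta (fun j => (pow_one (maxIdeal 𝕂 r p)).symm ▸ hΘ₀ ξ hξ j)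
    fun i => (hδ i).2

end Determinacy

end VK

end

theorem theorem3p6_general {𝕂 : Type*} [RCLike 𝕂] (r : VK.Regularity) {p q : ℕ}
    (V : Set (Fin p → 𝕂)) (h : VK.Tuple 𝕂 r p q) (h_zero : ∀ i, h i ∈ VK.maxIdeal 𝕂 r p) (l : ℕ) :
    ((VK.idealTheta q (VK.maxIdeal 𝕂 r p ^ (l + 1)) : Set (VK.Tuple 𝕂 r p q)) ⊆
        VK.tangentOne V h +
          (VK.idealTheta q (VK.maxIdeal 𝕂 r p ^ (l + 2)) : Set (VK.Tuple 𝕂 r p q)) →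
      VK.Determined V l h) ∧
    ((∀ ξ ∈ VK.Theta r V, ∀ j, ξ j ∈ VK.maxIdeal 𝕂 r p) →
      (VK.idealTheta q (VK.maxIdeal 𝕂 r p ^ l) : Set (VK.Tuple 𝕂 r p q)) ⊆
        VK.tangentExt V h +
          (VK.idealTheta q (VK.maxIdeal 𝕂 r p ^ (l + 1)) : Set (VK.Tuple 𝕂 r p q)) →
      VK.Determined V l h) :=
  ⟨VK.determined_of_tangentOne h_zero, VK.determined_of_tangentExt h_zero⟩

theorem theorem3p6 {𝕂 : Type*} [RCLike 𝕂] (r : VK.Regularity) {p q : ℕ} (V : Set (Fin p → 𝕂))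
    (h : VK.Tuple 𝕂 r p q) (h_zero : ∀ i, h i ∈ VK.maxIdeal 𝕂 r p) (l : ℕ)
    (h_fg : ∃ S : Finset (VK.Tuple 𝕂 r p p),
      (Submodule.span (VK.SmoothGerm 𝕂 r p) (S : Set (VK.Tuple 𝕂 r p p)) :
        Set (VK.Tuple 𝕂 r p p)) = VK.Theta r V) :
    ((VK.idealTheta q (VK.maxIdeal 𝕂 r p ^ (l + 1)) : Set (VK.Tuple 𝕂 r p q)) ⊆
        VK.tangentOne V h +
          (VK.idealTheta q (VK.maxIdeal 𝕂 r p ^ (l + 2)) : Set (VK.Tuple 𝕂 r p q)) →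
      VK.Determined V l h) ∧
    ((∀ ξ ∈ VK.Theta r V, ∀ j, ξ j ∈ VK.maxIdeal 𝕂 r p) →
      (VK.idealTheta q (VK.maxIdeal 𝕂 r p ^ l) : Set (VK.Tuple 𝕂 r p q)) ⊆
        VK.tangentExt V h +
          (VK.idealTheta q (VK.maxIdeal 𝕂 r p ^ (l + 1)) : Set (VK.Tuple 𝕂 r p q)) →
      VK.Determined V l h) :=
  theorem3p6_general r V h h_zero l
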